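/- **Setting.** Let $O\subset\mathbb{R}^2$ be an open (bounded) convex polygon with $n\ge 3$ vertices, $F=\mathbb{R}^2\setminus O$. Points $x,y\in F$ are visible from each other iff $\overline{xy}\cap O=\emptyset$; for $S\subseteq F$ let $V(S)=\{x\in F:\exists y\in S,\ \overline{xy}\cap O=\emptyset\}$. A path is a continuous map $[0,1]\to F$; it is a watchman route if $V$ of its image is $F$. An edge of $O$ is seen when all of it is visible from one visited point. **Scope.** As long as not all edges have been seen, let $v^R_{ext}$ (resp. $v^L_{ext}$) be the counterclockwise (resp. clockwise) end vertex of the chain of edges seen so far, $LOS_R$ (resp. $LOS_L$) the line of sight turned furthest counterclockwise (resp. clockwise) among those from visited points that see the last edge of the chain to this vertex, $m=\overline{v^R_{ext}v^L_{ext}}$, and let the *scope* $\psi\in(-\pi,\pi]$ be the counterclockwise angle from the direction of $LOS_R$ to that of $LOS_L$. It is *opening* if $\psi\ge0$ and *closing* if $\psi<0$; then the lines of sight meet behind $O$ in an angle $|\psi|$. The exploration is *finished* when the chain of seen edges has closed up around $O$ (so that a vertex has been listed from both sides). **Spiral search** with first length $Q$ on a (broken) line through the current position: walk legs of lengths $Q,2Q,4Q,\dots$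 in alternating directions, the first one towards the closer of the two projections of $v^R_{ext},v^L_{ext}$ to the line; $Q$ is the length of the projection of $m$ to the line. **Algorithm ONPA**, from a starting point $s\in F$: 1. If $\psi>\pi/2$: spiral search on the line through $s$ parallel to $m$, until the first moment at which the exploration is finished or $\psi\le\pi/2$. If it is finished, stop; if the scope is closing, go to 3; otherwise return straight to $s$ and go to 2. 2. If $0\le\psi\le\pi/2$: spiral search on the line through $s$ perpendicular to the bisector of the scope, until the first moment at which the exploration is finished or the scope is closing with $|\psi|\ge\pi/8$. If this line runs into $O$, it is replaced by the broken line that goes around $O$ along its boundary (on either side), with lengths measured along it. If finished, stop; otherwise go to 3. 3. While not finished: update $m$, and walk straight from the current position $p$ to the foot of the perpendicular on the line of $m$, if this foot does not lie in the interior of the segment $m$ and is visible from $p$. Otherwise $O$ is in the way: choose one of the two directions around $O$, that is, one of the two closed rays of the line of $m$ outside $m$, that contains a point visible from $p$, and walk straight to the closest visible point of that ray. **Theorem (Correctness).** For every convex polygon $O$ and every starting point $s\in F$, every execution of ONPA (however ties and the choices left open above are resolved) stops after finitely many moves, without getting stuck. Its path starts in $s$, has finite length, stays in $F$, and explores $\mathbb{R}^2\setminus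 O$ entirely: every $p\in F$ is visible from some point of the path. Thus it is a watchman route. -/

import Mathlib

open Set

noncomputable section

namespace ONPA

/-! The Euclidean plane `ℝ²` is modelled by `ℂ` (same norm, same real inner product). -/

/-- The planar cross product; it is positive when `b` points to the left of `a`. -/
def cross (a b : ℂ) : ℝ := a.re * b.im - a.im * b.re

/-- A convex polygon, given by its `n ≥ 3` vertices in counterclockwise order: every vertex that
is not an endpoint of an edge lies strictly to the left of this (directed) edge. -/
structure ConvexPolygon where
  n : ℕ
  three_le : 3 ≤ n
  vertex : ZMod n → ℂ
  convex : ∀ i k : ZMod n, k ≠ i → k ≠ i + 1 →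
    0 < cross (vertex (i + 1) - vertex i) (vertex k - vertex i)

namespace ConvexPolygon

variable (K : ConvexPolygon)

/-- The obstacle `O`: the open convex polygon. -/
def obstacle : Set ℂ := interior (convexHull ℝ (range K.vertex))

/-- The free space `F = ℝ² ∖ O`. -/
def free : Set ℂ := K.obstacleᶜ

/-- Two points are visible from each other iff the straight segment between them misses `O`. -/
def Visible (x y : ℂ) : Prop := segment ℝ x y ∩ K.obstacle = ∅

/-- The visible set `V(S)` of a set `S`. -/
def visibleSet (S : Set ℂ) : Set ℂ := {x | x ∈ K.free ∧ ∃ y ∈ S, K.Visible x y}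

/-- A path: a continuous map from `[0,1]` to the free space. -/
def IsPath (f : ℝ → ℂ) : Prop := ContinuousOn f (Icc 0 1) ∧ MapsTo f (Icc 0 1) K.free

/-- A watchman route: a path from which all of the free space is visible. -/
def IsWatchmanRoute (f : ℝ → ℂ) : Prop :=
  K.IsPath f ∧ K.visibleSet (f '' Icc 0 1) = K.free

/-! ### What the robot has seen -/

/-- The edge from vertex `i` to vertex `i + 1` is visible (entirely) from `x`. -/
def SeesEdge (x : ℂ) (i : ZMod K.n) : Prop :=
  ∀ y ∈ segment ℝ (K.vertex i) (K.vertex (i + 1)), K.Visible x y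

/-- The edge `i` has been seen by a robot that has visited the points of `P`. -/
def EdgeSeen (P : Set ℂ) (i : ZMod K.n) : Prop := ∃ x ∈ P, K.SeesEdge x i

/-- The chain of seen edges has closed up around the polygon: its clockwise end and its
counterclockwise end are the same vertex, which is then listed twice. -/
def Finished (P : Set ℂ) : Prop := ∀ i, K.EdgeSeen P i

/-- The data of a scope: the extreme vertices `R` (counterclockwise) and `L` (clockwise), and the
points `pR`, `pL` from which they have been seen extremely. -/
structure Scope where
  R : ZMod K.n
  L : ZMod K.n
  pR : ℂ
  pL : ℂ

namespace Scope

variable {K}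
variable (σ : K.Scope)

/-- The right extreme vertex. -/
def vR : ℂ := K.vertex σ.R

/-- The left extreme vertex. -/
def vL : ℂ := K.vertex σ.L

/-- The direction of the right extreme line of sight. -/
def uR : ℂ := σ.vR - σ.pR

/-- The direction of the left extreme line of sight. -/
def uL : ℂ := σ.vL - σ.pL

/-- The signed scope: the counterclockwise angle, in `(-π, π]`, from the right to the left extreme
line of sight. It is the angle of an opening scope when it is nonnegative (the two lines of sight
diverge or are parallel, and the unobserved region is unbounded); when it is negative the lines
of sight meet behind the obstacle, the scope is closing, and the triangle they form has there the
angle `-σ.angle`. -/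
def angle : ℝ := Complex.arg (σ.uL / σ.uR)

end Scope

/-- `σ` is the scope of a robot that has visited exactly the points of `P`. Edge `R - 1` is the
last seen edge counterclockwise, edge `L` the last seen edge clockwise; among the points of `P`
that see this edge, `pR` (resp. `pL`) is one whose line of sight to the extreme vertex is turned
furthest counterclockwise (resp. clockwise). -/
structure IsScope (P : Set ℂ) (σ : K.Scope) : Prop where
  seenR : K.EdgeSeen P (σ.R - 1)
  unseenR : ¬ K.EdgeSeen P σ.R
  seenL : K.EdgeSeen P σ.L
  unseenL : ¬ K.EdgeSeen P (σ.L - 1)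
  memR : σ.pR ∈ P
  seesR : K.SeesEdge σ.pR (σ.R - 1)
  extremeR : ∀ q ∈ P, K.SeesEdge q (σ.R - 1) → 0 ≤ cross (σ.vR - q) σ.uR
  memL : σ.pL ∈ P
  seesL : K.SeesEdge σ.pL σ.L
  extremeL : ∀ q ∈ P, K.SeesEdge q σ.L → cross (σ.vL - q) σ.uL ≤ 0

/-! ### Spiral search on a line -/

end ConvexPolygon

/-- Position, after travelling the distance `t`, of a one-dimensional spiral search from `0`: legs
of length `Q, 2Q, 4Q, …` in alternating directions, the first one in the positive direction. Leg
number `k = 0, 1, …` starts after the distance `(2 ^ k - 1) Q`, at position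
`(1 - (-2) ^ k) Q / 3`. -/
def zigzag (Q t : ℝ) : ℝ :=
  let k := Nat.log 2 ⌊t / Q + 1⌋₊
  (1 - (-2) ^ k) * Q / 3 + (-1) ^ k * (t - (2 ^ k - 1) * Q)

namespace ConvexPolygon

variable (K : ConvexPolygon)

/-- The unit vector `w` points from `p` towards the closer one of the projections of the two
extreme vertices to the line `p + ℝ w` (either one in case of a tie). -/
def TowardsCloser (σ : K.Scope) (p w : ℂ) : Prop :=
  (0 ≤ inner ℝ w (σ.vR - p) ∧ |inner ℝ w (σ.vR - p)| ≤ |inner ℝ w (σ.vL - p)|) ∨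
  (0 ≤ inner ℝ w (σ.vL - p) ∧ |inner ℝ w (σ.vL - p)| ≤ |inner ℝ w (σ.vR - p)|)

/-- `β` is the line `p + ℝ w`, or, if this line runs into the obstacle, a broken line, parametrized
by arc length, which is obtained from the line by walking around the obstacle along its boundary
(on either side). -/
structure IsBrokenLine (p w : ℂ) (β : ℝ → ℂ) : Prop where
  start : β 0 = p
  straight : (∀ t : ℝ, p + t • w ∉ K.obstacle) → ∀ t : ℝ, β t = p + t • w
  mem_free : ∀ t, β t ∈ K.free
  mem_line_or_frontier : ∀ t, (∃ r : ℝ, β t = p + r • w) ∨ β t ∈ frontier K.obstacle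
  unitSpeed : HasUnitSpeedOn β univ
  injective : Function.Injective β
  atTop : Filter.Tendsto (fun t => inner ℝ w (β t)) Filter.atTop Filter.atTop
  atBot : Filter.Tendsto (fun t => inner ℝ w (β t)) Filter.atBot Filter.atBot

end ConvexPolygon

/-- The ray on the line through `a` and `b` that starts in `a` and points away from `b`. -/
def outerRay (a b : ℂ) : Set ℂ := {q | ∃ t : ℝ, 0 ≤ t ∧ q = a + t • (a - b)}

/-! ### Executions of the algorithm -/

/-- The phases of the algorithm: deciding on a search while the scope is opening, the spiral search
parallel to the segment of the extreme vertices (direction `w`, first leg `Q`), the spiral search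
perpendicular to the bisector of the scope (on the broken line `β`, first leg `Q`), and the approach
of the far side. -/
inductive Phase where
  | opening
  | parallel (w : ℂ) (Q : ℝ)
  | bisection (β : ℝ → ℂ) (Q : ℝ)
  | closing

/-- A state: the path walked so far is `path` on `[0, time]`. -/
structure State where
  time : ℝ
  path : ℝ → ℂ
  phase : Phase

namespace State

/-- The initial state at the starting point `s`. -/
def init (s : ℂ) : State := ⟨0, fun _ => s, Phase.opening⟩

variable (X : State)

/-- The current position. -/
def pos : ℂ := X.path X.time

/-- The points visited so far. -/
def visited : Set ℂ := X.path '' Icc 0 X.time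

/-- The path walked so far, parametrized by `[0,1]`. -/
def route (u : ℝ) : ℂ := X.path (u * X.time)

/-- Append the motion `g` on `[0, τ]`, and go to phase `ph`. -/
def move (g : ℝ → ℂ) (τ : ℝ) (ph : Phase) : State :=
  ⟨X.time + τ, fun t => if t ≤ X.time then X.path t else g (t - X.time), ph⟩

/-- Walk straight, with unit speed, to the point `q`, and go to phase `ph`. -/
def walkTo (q : ℂ) (ph : Phase) : State :=
  X.move (fun t => X.pos + (t / ‖q - X.pos‖) • (q - X.pos)) ‖q - X.pos‖ ph

end State

namespace ConvexPolygon

variable (K : ConvexPolygon)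

/-- Starting in state `X`, the motion `g` satisfies the condition `C` on the set of all visited
points for the first time after time `τ`. -/
def FirstTime (C : Set ℂ → Prop) (X : State) (g : ℝ → ℂ) (τ : ℝ) : Prop :=
  IsLeast {r : ℝ | 0 ≤ r ∧ C (X.move g r X.phase).visited} τ

/-- The parallel search stops when it is finished or the scope is at most `π / 2`. -/
def ParallelStop (P : Set ℂ) : Prop :=
  K.Finished P ∨ ∃ σ, K.IsScope P σ ∧ σ.angle ≤ Real.pi / 2

/-- The search perpendicular to the bisector stops when it is finished or the scope is closing with
a triangle of angle `π / 8`. -/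
def BisectionStop (P : Set ℂ) : Prop :=
  K.Finished P ∨ ∃ σ, K.IsScope P σ ∧ σ.angle ≤ -(Real.pi / 8)

/-- The point `q`, on the line of the segment `m` between the extreme vertices but not inside `m`
(which belongs to the closed polygon), is the foot of the perpendicular from `p`, and `O` is not in
the way. -/
def IsFreeFoot (σ : K.Scope) (p q : ℂ) : Prop :=
  (q ∈ outerRay σ.vR σ.vL ∨ q ∈ outerRay σ.vL σ.vR) ∧
    inner ℝ (q - p) (σ.vL - σ.vR) = 0 ∧ K.Visible p q

/-- `q` is the point of `A` closest to `p` among those that are reached from `p` without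
intersecting `O`. -/
def IsClosestFree (A : Set ℂ) (p q : ℂ) : Prop :=
  q ∈ A ∧ K.Visible p q ∧ ∀ q' ∈ A, K.Visible p q' → dist p q ≤ dist p q'

/-- The goal `q` of the next move from `p` towards the segment `m` between the extreme vertices:
perpendicularly to the line of `m` if `O` is not in the way, and otherwise to the closest point of
this line, in one of the two directions around the polygon, that can be reached directly. -/
def IsClosingTarget (σ : K.Scope) (p q : ℂ) : Prop :=
  K.IsFreeFoot σ p q ∨
  ((∀ q', ¬ K.IsFreeFoot σ p q') ∧
    (K.IsClosestFree (outerRay σ.vR σ.vL) p q ∨ K.IsClosestFree (outerRay σ.vL σ.vR) p q))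

/-- One step of the online path algorithm. -/
inductive Step : State → State → Prop
  /-- Opening scope larger than `π / 2`: start a spiral search parallel to the segment `m` between
  the extreme vertices. -/
  | chooseParallel (X : State) (σ : K.Scope) (w : ℂ)
      (hX : X.phase = Phase.opening) (hσ : K.IsScope X.visited σ)
      (hangle : Real.pi / 2 < σ.angle)
      (hw : ‖w‖ = 1) (hpar : cross w (σ.vL - σ.vR) = 0) (hdir : K.TowardsCloser σ X.pos w) :
      Step X { X with phase := Phase.parallel w |inner ℝ w (σ.vL - σ.vR)| }
  /-- The parallel search ends with an opening scope: return to the starting point. -/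
  | parallelReturn (X : State) (w : ℂ) (Q τ : ℝ) (σ : K.Scope)
      (hX : X.phase = Phase.parallel w Q)
      (hτ : FirstTime K.ParallelStop X (fun t => X.pos + zigzag Q t • w) τ)
      (hσ : K.IsScope (X.move (fun t => X.pos + zigzag Q t • w) τ Phase.opening).visited σ)
      (hangle : 0 ≤ σ.angle) :
      Step X ((X.move (fun t => X.pos + zigzag Q t • w) τ Phase.opening).walkTo
        (X.path 0) Phase.opening)
  /-- The parallel search has finished the exploration, or ends with a closing scope. -/
  | parallelClose (X : State) (w : ℂ) (Q τ : ℝ)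
      (hX : X.phase = Phase.parallel w Q)
      (hτ : FirstTime K.ParallelStop X (fun t => X.pos + zigzag Q t • w) τ)
      (hclose : K.Finished (X.move (fun t => X.pos + zigzag Q t • w) τ Phase.closing).visited ∨
        ∃ σ, K.IsScope (X.move (fun t => X.pos + zigzag Q t • w) τ Phase.closing).visited σ ∧
          σ.angle < 0) :
      Step X (X.move (fun t => X.pos + zigzag Q t • w) τ Phase.closing)
  /-- Opening scope of at most `π / 2`: start a spiral search perpendicular to the bisector of the
  scope, with the length of the projection of `m` as length of the first leg. -/
  | chooseBisection (X : State) (σ : K.Scope) (w : ℂ) (β : ℝ → ℂ)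
      (hX : X.phase = Phase.opening) (hσ : K.IsScope X.visited σ)
      (hangle₀ : 0 ≤ σ.angle) (hangle : σ.angle ≤ Real.pi / 2)
      (hw : ‖w‖ = 1) (hperp : inner ℝ w (‖σ.uR‖⁻¹ • σ.uR + ‖σ.uL‖⁻¹ • σ.uL) = 0)
      (hdir : K.TowardsCloser σ X.pos w) (hβ : K.IsBrokenLine X.pos w β) :
      Step X { X with phase := Phase.bisection β |inner ℝ w (σ.vL - σ.vR)| }
  /-- The search perpendicular to the bisector ends. -/
  | bisectionClose (X : State) (β : ℝ → ℂ) (Q τ : ℝ)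
      (hX : X.phase = Phase.bisection β Q)
      (hτ : FirstTime K.BisectionStop X (fun t => β (zigzag Q t)) τ) :
      Step X (X.move (fun t => β (zigzag Q t)) τ Phase.closing)
  /-- While not finished: move towards the segment `m` between the current extreme vertices. -/
  | approach (X : State) (σ : K.Scope) (q : ℂ)
      (hX : X.phase = Phase.closing) (hfin : ¬ K.Finished X.visited)
      (hσ : K.IsScope X.visited σ) (hq : K.IsClosingTarget σ X.pos q) :
      Step X (X.walkTo q Phase.closing)

/-- `X` is reached by an execution of the algorithm from the starting point `s`. -/
def Reaches (s : ℂ) (X : State) : Prop := Relation.ReflTransGen K.Step (State.init s) X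

/-- The execution stops in `X`. -/
def Halted (X : State) : Prop := ∀ Y, ¬ K.Step X Y

end ConvexPolygon

end ONPA

end

/-! ### The polygon as an intersection of half planes; seen edges. -/

namespace ONPA

/-! Everything is expressed by the affine functions `side i`, positive on the inner side of the line
of edge `i`. The obstacle is the set where all of them are positive (`mem_obstacle`), and edge `i`
is seen from `x` exactly when `side i x ≤ 0` (`seesEdge_iff`). A free point lies beyond the line of
some edge; a visited point that sees this edge lies beyond the same line, in a half plane disjoint
from `O`. So seeing all edges means seeing all of the free space (`visibleSet_of_finished`), and it
remains to show that an execution stops, and only when it has finished.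

The scope is well defined: a connected free set that has not seen two given edges stays on one side
of the chord through their midpoints (`chord_mul_pos`), which forces uniqueness of the extreme
vertices and of the angle (`IsScope.angle_eq`); existence is compactness (`exists_isScope`). A
search stops because visited points far out in both directions on a line leave at most one unseen
edge, parallel to the line, and the scope is then at most `-π / 2` (`stopAt_of_far`). The stopping
condition survives limits of times from the right, hence there is a first stopping time
(`exists_isLeast_stopAt`). The broken line is obtained by radial projection to the boundary of `O`
(`exists_isBrokenLine`).

An approach ends on an outer ray of the line of `m`, hence beyond the line of a so far unseen edge
(`IsClosingTarget.exists_new_edge`), so there are at most `n` approaches. An approach can lack a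
goal only in the relative interior of an edge; neither a search that ends unfinished
(`not_inEdgeInterior_of_isLeast`) nor an approach ends there. `Invariant` carries these facts along,
`stepBound` decreases with every step, and a state without successor is finished
(`finished_of_halted`). -/

theorem cross_self (a : ℂ) : cross a a = 0 := by simp [cross, mul_comm]

theorem cross_comm (a b : ℂ) : cross a b = -cross b a := by simp [cross]; ring

theorem continuous_cross {X : Type*} [TopologicalSpace X] {f g : X → ℂ} (hf : Continuous f)
    (hg : Continuous g) : Continuous fun x => cross (f x) (g x) := by
  unfold cross; fun_prop

namespace ConvexPolygon

variable (K : ConvexPolygon)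

/-- The signed distance (up to a positive factor) of `x` from the line of the edge `i`; it is
positive on the side of the polygon. -/
def side (i : ZMod K.n) (x : ℂ) : ℝ := cross (K.vertex (i + 1) - K.vertex i) (x - K.vertex i)

instance : NeZero K.n := ⟨by have := K.three_le; omega⟩

theorem one_ne_zero' : (1 : ZMod K.n) ≠ 0 := by
  have := K.three_le
  have : Fact (1 < K.n) := ⟨by omega⟩
  exact one_ne_zero

theorem two_ne_zero' : (2 : ZMod K.n) ≠ 0 := by
  intro h
  have h3 := K.three_le
  have h2 : ((2 : ℕ) : ZMod K.n) = 0 := by exact_mod_cast h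
  rw [ZMod.natCast_eq_zero_iff] at h2
  have := Nat.le_of_dvd (by norm_num) h2
  omega

theorem succ_ne (i : ZMod K.n) : i + 1 ≠ i := by simpa using K.one_ne_zero'

theorem pred_ne (i : ZMod K.n) : i - 1 ≠ i := by
  intro h; exact K.one_ne_zero' (by simpa using h)

theorem succ_ne_pred (i : ZMod K.n) : i + 1 ≠ i - 1 := by
  intro h
  apply K.two_ne_zero'
  linear_combination h

theorem continuous_side (i : ZMod K.n) : Continuous (K.side i) :=
  continuous_cross continuous_const (by fun_prop)

theorem side_eq (i : ZMod K.n) (x : ℂ) :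
    K.side i x = cross (K.vertex (i + 1) - K.vertex i) (x - K.vertex (i + 1)) := by
  simp [side, cross]; ring

theorem side_pred (j : ZMod K.n) (x : ℂ) :
    K.side (j - 1) x = cross (K.vertex j - K.vertex (j - 1)) (x - K.vertex j) := by
  rw [side_eq, sub_add_cancel]

@[simp] theorem side_vertex (i : ZMod K.n) : K.side i (K.vertex i) = 0 := by simp [side, cross]

@[simp] theorem side_vertex_succ (i : ZMod K.n) : K.side i (K.vertex (i + 1)) = 0 := by
  simp [side_eq, cross]

@[simp] theorem side_pred_vertex (i : ZMod K.n) : K.side (i - 1) (K.vertex i) = 0 := by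
  simp [side_pred, cross]

theorem side_vertex_pos {i k : ZMod K.n} (h : k ≠ i) (h' : k ≠ i + 1) :
    0 < K.side i (K.vertex k) := K.convex i k h h'

theorem side_vertex_nonneg (i k : ZMod K.n) : 0 ≤ K.side i (K.vertex k) := by
  by_cases h : k = i
  · simp [h]
  by_cases h' : k = i + 1
  · simp [h']
  exact (K.side_vertex_pos h h').le

theorem side_combo (i : ZMod K.n) (a b : ℂ) (t : ℝ) :
    K.side i (a + t • (b - a)) = (1 - t) * K.side i a + t * K.side i b := by
  simp [side, cross]; ring

theorem side_add_smul (i : ZMod K.n) (a u : ℂ) (t : ℝ) :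
    K.side i (a + t • u) = K.side i a + t * cross (K.vertex (i + 1) - K.vertex i) u := by
  simp [side, cross]; ring

theorem side_sub (i : ZMod K.n) (a b : ℂ) :
    K.side i b - K.side i a = cross (K.vertex (i + 1) - K.vertex i) (b - a) := by
  simp [side, cross]; ring

theorem convex_side_nonneg (i : ZMod K.n) : Convex ℝ {x | 0 ≤ K.side i x} := by
  intro x hx y hy a b ha hb hab
  have : a • x + b • y = x + b • (y - x) := by
    rw [← eq_sub_iff_add_eq] at hab; subst hab; module
  simp only [mem_ofPred_eq] at *
  rw [this, side_combo, show 1 - b = a by linarith]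
  positivity

theorem convex_side_nonpos (i : ZMod K.n) : Convex ℝ {x | K.side i x ≤ 0} := by
  intro x hx y hy a b ha hb hab
  have : a • x + b • y = x + b • (y - x) := by
    rw [← eq_sub_iff_add_eq] at hab; subst hab; module
  simp only [mem_ofPred_eq] at *
  rw [this, side_combo, show 1 - b = a by linarith]
  nlinarith

/-- The exterior angle at the vertex `j` is positive. -/
theorem turn_pos (j : ZMod K.n) :
    0 < cross (K.vertex j - K.vertex (j - 1)) (K.vertex (j + 1) - K.vertex j) := by
  have h := K.side_vertex_pos (i := j - 1) (k := j + 1) (K.succ_ne_pred j)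
    (by rw [sub_add_cancel]; exact K.succ_ne j)
  rwa [side_pred] at h

/-- The line of sight from `q` to the vertex `j`, decomposed along the two edges at `j`. -/
theorem sight_decomp (j : ZMod K.n) (q : ℂ) :
    cross (K.vertex j - K.vertex (j - 1)) (K.vertex (j + 1) - K.vertex j) • (K.vertex j - q) =
      K.side j q • (K.vertex j - K.vertex (j - 1)) -
        K.side (j - 1) q • (K.vertex (j + 1) - K.vertex j) := by
  rw [side_pred, side]
  apply Complex.ext <;> simp [cross] <;> ring

/-- In the coordinates `side (j - 1)`, `side j` around the vertex `j`, the cross product of two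
lines of sight is a determinant, up to the positive factor of `turn_pos`. Thus comparing how far
lines of sight are turned means comparing ratios of `side` values. -/
theorem cross_sight (j : ZMod K.n) (q x : ℂ) :
    cross (K.vertex j - K.vertex (j - 1)) (K.vertex (j + 1) - K.vertex j) *
      cross (K.vertex j - q) (K.vertex j - x) =
    K.side (j - 1) q * K.side j x - K.side j q * K.side (j - 1) x := by
  rw [side_pred, side_pred, side, side]
  simp [cross]; ring

theorem cross_sight' (j : ZMod K.n) (q x : ℂ) :
    cross (K.vertex j - K.vertex (j - 1)) (K.vertex (j + 1) - K.vertex j) *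
      cross (K.vertex j - q) (x - K.vertex j) =
    K.side j q * K.side (j - 1) x - K.side (j - 1) q * K.side j x := by
  rw [side_pred, side_pred, side, side]
  simp [cross]; ring

/-- Otherwise a linear functional `f` separates `x` from the hull. At a vertex `j` where `f` is
maximal, applying `f` to `sight_decomp` gives `f x ≤ f (vertex j)`, because both `side` values at
`j` are nonnegative. -/
theorem mem_convexHull_of_side_nonneg {x : ℂ} (hx : ∀ i, 0 ≤ K.side i x) :
    x ∈ convexHull ℝ (range K.vertex) := by
  by_contra hx'
  have hcl : IsClosed (convexHull ℝ (range K.vertex)) :=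
    ((finite_range K.vertex).isCompact_convexHull (𝕜 := ℝ)).isClosed
  obtain ⟨f, u, hf, hu⟩ := geometric_hahn_banach_closed_point (convex_convexHull ℝ _) hcl hx'
  obtain ⟨j, hj⟩ := Finite.exists_max fun j => f (K.vertex j)
  have h1 := hf _ (subset_convexHull ℝ _ (mem_range_self j))
  have h := congrArg f (K.sight_decomp j x)
  simp only [map_sub, map_smul, smul_eq_mul] at h
  have h2 := mul_nonneg (hx j) (sub_nonneg.2 (hj (j - 1)))
  have h3 := mul_nonneg (hx (j - 1)) (sub_nonneg.2 (hj (j + 1)))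
  have h4 := mul_pos (K.turn_pos j) (show 0 < f x - f (K.vertex j) by linarith)
  linarith

theorem mem_obstacle {x : ℂ} : x ∈ K.obstacle ↔ ∀ i, 0 < K.side i x := by
  constructor
  · intro hx i
    have hsub : convexHull ℝ (range K.vertex) ⊆ {y | 0 ≤ K.side i y} :=
      convexHull_min (by rintro _ ⟨k, rfl⟩; exact K.side_vertex_nonneg i k)
        (K.convex_side_nonneg i)
    have h0 : 0 ≤ K.side i x := hsub (interior_subset hx)
    by_contra hlt
    have h0 : K.side i x = 0 := by linarith
    -- `u` is the inward normal of the edge: from an interior point on the line of the edge, a small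
    -- step against `u` would stay in the hull and yet cross the line.
    set u : ℂ := Complex.I * (K.vertex (i + 1) - K.vertex i) with hu
    have hd : 0 < cross (K.vertex (i + 1) - K.vertex i) u := by
      have hne := K.turn_pos (i + 1)
      rw [add_sub_cancel_right] at hne
      have : K.vertex (i + 1) - K.vertex i ≠ 0 := by
        intro h; rw [h] at hne; simp [cross] at hne
      rw [← Complex.normSq_pos, Complex.normSq_apply] at this
      simp [hu, cross] at this ⊢; linarith
    have hc : Filter.Tendsto (fun t : ℝ => x + t • u) (nhds 0) (nhds x) := by
      have : Continuous fun t : ℝ => x + t • u := by fun_prop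
      simpa using this.tendsto 0
    have hev := hc.eventually (isOpen_interior.mem_nhds hx)
    obtain ⟨ε, hε, hball⟩ := Metric.eventually_nhds_iff.1 hev
    have h1 := hsub (interior_subset (@hball (-(ε / 2)) (by
      rw [Real.dist_eq, sub_zero, abs_neg, abs_of_pos (half_pos hε)]; linarith)))
    simp only [mem_ofPred_eq, side_add_smul, h0] at h1
    nlinarith
  · intro hx
    have ho : IsOpen (⋂ i, {y | 0 < K.side i y}) :=
      isOpen_iInter_of_finite fun i => isOpen_lt continuous_const (K.continuous_side i)
    refine interior_maximal ?_ ho (mem_iInter.2 hx)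
    intro y hy
    exact K.mem_convexHull_of_side_nonneg fun i => (mem_iInter.1 hy i).le

theorem mem_free {x : ℂ} : x ∈ K.free ↔ ∃ i, K.side i x ≤ 0 := by
  rw [free, mem_compl_iff, mem_obstacle]; push Not; rfl

theorem isOpen_obstacle : IsOpen K.obstacle := isOpen_interior

theorem isClosed_free : IsClosed K.free := K.isOpen_obstacle.isClosed_compl

theorem convex_obstacle : Convex ℝ K.obstacle := (convex_convexHull ℝ _).interior

theorem isBounded_obstacle : Bornology.IsBounded K.obstacle :=
  ((finite_range K.vertex).isCompact_convexHull (𝕜 := ℝ)).isBounded.subset interior_subset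

theorem visible_of_side_nonpos {i : ZMod K.n} {x y : ℂ} (hx : K.side i x ≤ 0)
    (hy : K.side i y ≤ 0) : K.Visible x y := by
  rw [Visible, eq_empty_iff_forall_notMem]
  rintro z ⟨hz, hzO⟩
  have := (K.convex_side_nonpos i).segment_subset hx hy hz
  exact absurd (K.mem_obstacle.1 hzO i) (not_lt.2 this)

/-- The midpoint of the edge `i`. -/
noncomputable def mid (i : ZMod K.n) : ℂ :=
  K.vertex i + (1 / 2 : ℝ) • (K.vertex (i + 1) - K.vertex i)

@[simp] theorem side_mid_self (i : ZMod K.n) : K.side i (K.mid i) = 0 := by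
  rw [mid, side_combo]; simp

theorem side_mid_pos {i j : ZMod K.n} (h : i ≠ j) : 0 < K.side i (K.mid j) := by
  rw [mid, side_combo]
  have h1 := K.side_vertex_nonneg i j
  have h2 := K.side_vertex_nonneg i (j + 1)
  -- It suffices that one end of edge `j` lies off the line of edge `i`; for `j = i + 1` this is the
  -- far end, otherwise `vertex j` itself.
  by_cases hj : j = i + 1
  · have : 0 < K.side i (K.vertex (j + 1)) := by
      apply K.side_vertex_pos
      · rw [hj]; intro h; exact K.two_ne_zero' (by linear_combination h)
      · intro h'; exact h (add_right_cancel h').symm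
    linarith
  · have := K.side_vertex_pos h.symm hj
    linarith

theorem side_mid_nonneg (i j : ZMod K.n) : 0 ≤ K.side i (K.mid j) := by
  by_cases h : i = j
  · simp [h]
  · exact (K.side_mid_pos h).le

theorem combo_mid_mem_obstacle {i j : ZMod K.n} (h : i ≠ j) {t : ℝ} (h0 : 0 < t) (h1 : t < 1) :
    K.mid i + t • (K.mid j - K.mid i) ∈ K.obstacle := by
  rw [mem_obstacle]
  intro k
  rw [side_combo]
  have hi := K.side_mid_nonneg k i
  have hj := K.side_mid_nonneg k j
  by_cases hk : k = i
  · subst hk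
    have := K.side_mid_pos h
    have := mul_pos h0 this
    simp; linarith
  · have := mul_pos (sub_pos.2 h1) (K.side_mid_pos hk)
    have := mul_nonneg h0.le hj
    linarith

theorem obstacle_nonempty : K.obstacle.Nonempty :=
  ⟨_, K.combo_mid_mem_obstacle (K.succ_ne 0) (t := 1 / 2) (by norm_num) (by norm_num)⟩

/-- If `x` is strictly on the inner side, the segment from the midpoint of the edge towards `x`
enters `O` at once: `side i` becomes positive, and the other `side` values, positive at the
midpoint, stay so for a while. Conversely, the closed outer half plane of the edge is convex and
misses `O`. -/
theorem seesEdge_iff {x : ℂ} {i : ZMod K.n} : K.SeesEdge x i ↔ K.side i x ≤ 0 := by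
  constructor
  · intro h
    by_contra hx
    push Not at hx
    have hm : K.mid i ∈ segment ℝ (K.vertex i) (K.vertex (i + 1)) := by
      rw [segment_eq_image']
      exact ⟨1 / 2, by norm_num, rfl⟩
    have hv := h _ hm
    rw [Visible, eq_empty_iff_forall_notMem] at hv
    have hev : ∀ k, ∀ᶠ t : ℝ in nhdsWithin 0 (Ioi 0),
        0 < K.side k (K.mid i + t • (x - K.mid i)) := by
      intro k
      by_cases hk : k = i
      · subst hk
        filter_upwards [self_mem_nhdsWithin] with t ht
        rw [side_combo]
        have := mul_pos (show (0 : ℝ) < t from ht) hx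
        simpa
      · have hc : Continuous fun t : ℝ => K.side k (K.mid i + t • (x - K.mid i)) :=
          (K.continuous_side k).comp (by fun_prop)
        have h0 := K.side_mid_pos hk
        have := hc.tendsto 0
        simp only [zero_smul, add_zero] at this
        exact (this.eventually (lt_mem_nhds h0)).filter_mono nhdsWithin_le_nhds
    have hev' := (Filter.eventually_all.2 hev).and (Ioo_mem_nhdsGT (zero_lt_one (α := ℝ)))
    obtain ⟨t, ht, ht'⟩ := hev'.exists
    refine hv (K.mid i + t • (x - K.mid i)) ⟨?_, K.mem_obstacle.2 ht⟩
    rw [segment_symm, segment_eq_image']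
    exact ⟨t, ⟨ht'.1.le, ht'.2.le⟩, rfl⟩
  · intro hx y hy
    refine K.visible_of_side_nonpos hx ((K.convex_side_nonpos i).segment_subset ?_ ?_ hy) <;> simp

theorem edgeSeen_iff {P : Set ℂ} {i : ZMod K.n} : K.EdgeSeen P i ↔ ∃ x ∈ P, K.side i x ≤ 0 := by
  simp [EdgeSeen, seesEdge_iff]

theorem not_edgeSeen_iff {P : Set ℂ} {i : ZMod K.n} :
    ¬ K.EdgeSeen P i ↔ ∀ x ∈ P, 0 < K.side i x := by
  simp [edgeSeen_iff]

theorem EdgeSeen.mono {K : ConvexPolygon} {P P' : Set ℂ} {i : ZMod K.n} (h : P ⊆ P')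
    (hi : K.EdgeSeen P i) : K.EdgeSeen P' i :=
  let ⟨x, hx, hx'⟩ := hi
  ⟨x, h hx, hx'⟩

/-- When all edges have been seen, all of the free space has been seen. -/
theorem visibleSet_of_finished {P : Set ℂ} (hP : K.Finished P) : K.visibleSet P = K.free := by
  ext x
  refine ⟨fun h => h.1, fun h => ⟨h, ?_⟩⟩
  obtain ⟨i, hi⟩ := K.mem_free.1 h
  obtain ⟨y, hy, hyi⟩ := K.edgeSeen_iff.1 (hP i)
  exact ⟨y, hy, K.visible_of_side_nonpos hi hyi⟩

/-- The edge vectors sum to zero, so the differences `side i o - side i s` do too; for `o` in the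
obstacle they cannot all be positive. Hence a single point never sees all edges. -/
theorem exists_side_pos (s : ℂ) : ∃ i, 0 < K.side i s := by
  by_contra! h
  obtain ⟨o, ho⟩ := K.obstacle_nonempty
  rw [mem_obstacle] at ho
  have h1 : ∑ i, (K.side i o - K.side i s) = 0 := by
    simp_rw [side_sub]
    have hz : ∑ i, (K.vertex (i + 1) - K.vertex i) = 0 := by
      rw [Finset.sum_sub_distrib, sub_eq_zero]
      exact Equiv.sum_comp (Equiv.addRight (1 : ZMod K.n)) K.vertex
    have : ∀ u, ∑ i, cross (K.vertex (i + 1) - K.vertex i) u =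
        cross (∑ i, (K.vertex (i + 1) - K.vertex i)) u := by
      intro u
      simp only [cross, Complex.re_sum, Complex.im_sum, Finset.sum_mul, ← Finset.sum_sub_distrib]
    rw [this, hz]; simp [cross]
  have h2 : 0 < ∑ i, (K.side i o - K.side i s) :=
    Finset.sum_pos (fun i _ => by linarith [ho i, h i]) ⟨0, Finset.mem_univ _⟩
  linarith

end ConvexPolygon
end ONPA

/-! ### Lines of sight to a common vertex. -/

namespace ONPA

theorem cross_eq_zero_trans {a b c : ℂ} (ha : a ≠ 0) (hb : cross a b = 0) (hc : cross a c = 0) :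
    cross b c = 0 := by
  have h : Complex.normSq a * cross b c =
      (a.re * b.re + a.im * b.im) * cross a c - cross a b * (a.re * c.re + a.im * c.im) := by
    simp [cross, Complex.normSq_apply]; ring
  rw [hb, hc] at h
  have := Complex.normSq_pos.2 ha
  simpa [this.ne'] using h

theorem im_div (a b : ℂ) : (b / a).im = cross a b / Complex.normSq a := by
  rw [Complex.div_im, cross]; ring

theorem re_div (a b : ℂ) : (b / a).re = inner ℝ a b / Complex.normSq a := by
  rw [Complex.div_re, Complex.inner]; simp; ring

theorem inner_eq (a b : ℂ) : inner ℝ a b = a.re * b.re + a.im * b.im := by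
  rw [Complex.inner]; simp; ring

namespace ConvexPolygon

variable (K : ConvexPolygon)

/-- Parallel lines of sight to the vertex `j` could still be opposite; this is excluded because both
viewpoints lie strictly on the inner side of edge `j`. The factor is the ratio of their distances
from that edge. -/
theorem sight_eq_smul {j : ZMod K.n} {q q' : ℂ} (hq : 0 < K.side j q) (hq' : 0 < K.side j q')
    (h : cross (K.vertex j - q) (K.vertex j - q') = 0) :
    ∃ c : ℝ, 0 < c ∧ K.vertex j - q' = c • (K.vertex j - q) := by
  refine ⟨K.side j q' / K.side j q, div_pos hq' hq, ?_⟩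
  have h1 := K.cross_sight j q q'
  rw [h, mul_zero] at h1
  have ht := K.turn_pos j
  have e1 := K.sight_decomp j q
  have e2 := K.sight_decomp j q'
  have key : (cross (K.vertex j - K.vertex (j - 1)) (K.vertex (j + 1) - K.vertex j) *
      K.side j q) • (K.vertex j - q') =
      (cross (K.vertex j - K.vertex (j - 1)) (K.vertex (j + 1) - K.vertex j) *
      K.side j q') • (K.vertex j - q) := by
    linear_combination (norm := module) K.side j q • e2 - K.side j q' • e1 -
      h1 • (K.vertex (j + 1) - K.vertex j)
  apply smul_right_injective ℂ (mul_pos ht hq).ne'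
  simp only
  rw [key, smul_smul]
  congr 1
  field_simp

theorem sight_eq_smul' {j : ZMod K.n} {q q' : ℂ} (hq : 0 < K.side (j - 1) q)
    (hq' : 0 < K.side (j - 1) q') (h : cross (K.vertex j - q) (K.vertex j - q') = 0) :
    ∃ c : ℝ, 0 < c ∧ K.vertex j - q' = c • (K.vertex j - q) := by
  refine ⟨K.side (j - 1) q' / K.side (j - 1) q, div_pos hq' hq, ?_⟩
  have h1 := K.cross_sight j q q'
  rw [h, mul_zero] at h1
  have ht := K.turn_pos j
  have e1 := K.sight_decomp j q
  have e2 := K.sight_decomp j q'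
  have key : (cross (K.vertex j - K.vertex (j - 1)) (K.vertex (j + 1) - K.vertex j) *
      K.side (j - 1) q) • (K.vertex j - q') =
      (cross (K.vertex j - K.vertex (j - 1)) (K.vertex (j + 1) - K.vertex j) *
      K.side (j - 1) q') • (K.vertex j - q) := by
    linear_combination (norm := module) K.side (j - 1) q • e2 - K.side (j - 1) q' • e1 -
      h1 • (K.vertex j - K.vertex (j - 1))
  apply smul_right_injective ℂ (mul_pos ht hq).ne'
  simp only
  rw [key, smul_smul]
  congr 1
  field_simp

/-! ### Chords between two unseen edges -/

/-- The signed position of `x` with respect to the chord from the midpoint of the edge `i` to the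
midpoint of the edge `j`. -/
noncomputable def chord (i j : ZMod K.n) (x : ℂ) : ℝ := cross (K.mid j - K.mid i) (x - K.mid i)

theorem chord_combo (i j : ZMod K.n) (a b : ℂ) (t : ℝ) :
    K.chord i j (a + t • (b - a)) = (1 - t) * K.chord i j a + t * K.chord i j b := by
  simp [chord, cross]; ring

theorem chord_add_smul (i j : ZMod K.n) (a u : ℂ) (t : ℝ) :
    K.chord i j (a + t • u) = K.chord i j a + t * cross (K.mid j - K.mid i) u := by
  simp [chord, cross]; ring

theorem continuous_chord (i j : ZMod K.n) : Continuous (K.chord i j) :=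
  continuous_cross continuous_const (by fun_prop)

variable {K} {i j : ZMod K.n}

theorem chord_vertex_left (h : i ≠ j) : 0 < K.chord i j (K.vertex i) := by
  have h1 := K.side_mid_pos h
  have : K.chord i j (K.vertex i) = K.side i (K.mid j) / 2 := by
    simp [chord, side, cross, mid]; ring
  linarith

theorem chord_vertex_succ_left (h : i ≠ j) : K.chord i j (K.vertex (i + 1)) < 0 := by
  have h1 := K.side_mid_pos h
  have : K.chord i j (K.vertex (i + 1)) = -K.side i (K.mid j) / 2 := by
    simp [chord, side, cross, mid]; ring
  linarith

theorem chord_vertex_right (h : i ≠ j) : K.chord i j (K.vertex j) < 0 := by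
  have h1 := K.side_mid_pos h.symm
  have : K.chord i j (K.vertex j) = -K.side j (K.mid i) / 2 := by
    simp [chord, side, cross, mid]; ring
  linarith

theorem chord_vertex_succ_right (h : i ≠ j) : 0 < K.chord i j (K.vertex (j + 1)) := by
  have h1 := K.side_mid_pos h.symm
  have : K.chord i j (K.vertex (j + 1)) = K.side j (K.mid i) / 2 := by
    simp [chord, side, cross, mid]; ring
  linarith

/-- The part of the line through the two midpoints that is strictly inside both half planes is the
open chord, and this lies in `O`. -/
theorem chord_ne_zero (h : i ≠ j) {x : ℂ} (hx : x ∈ K.free) (hi : 0 < K.side i x)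
    (hj : 0 < K.side j x) : K.chord i j x ≠ 0 := by
  intro h0
  have hm : 0 < K.side i (K.mid j) := K.side_mid_pos h
  have hm' : 0 < K.side j (K.mid i) := K.side_mid_pos h.symm
  set m := K.mid j - K.mid i with hmdef
  have hmne : m ≠ 0 := by
    intro hz
    rw [sub_eq_zero.1 hz] at hm
    simp at hm
  have hN := Complex.normSq_pos.2 hmne
  have hxt : x = K.mid i + ((m.re * (x - K.mid i).re + m.im * (x - K.mid i).im) /
      Complex.normSq m) • m := by
    rw [← sub_eq_iff_eq_add']
    apply smul_right_injective ℂ hN.ne'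
    simp only
    rw [smul_smul, mul_div_cancel₀ _ hN.ne']
    have h0' : m.re * (x - K.mid i).im - m.im * (x - K.mid i).re = 0 := h0
    apply Complex.ext
    · simp only [Complex.real_smul, Complex.re_ofReal_mul, Complex.normSq_apply]
      linear_combination (-m.im) * h0'
    · simp only [Complex.real_smul, Complex.im_ofReal_mul, Complex.normSq_apply]
      linear_combination m.re * h0'
  set t := (m.re * (x - K.mid i).re + m.im * (x - K.mid i).im) / Complex.normSq m
  rw [hxt, hmdef, K.side_combo] at hi hj
  simp only [side_mid_self, mul_zero, zero_add, add_zero] at hi hj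
  have h1 : 0 < t := pos_of_mul_pos_left hi hm.le
  have h2 : 0 < 1 - t := pos_of_mul_pos_left hj hm'.le
  apply hx
  rw [hxt]
  exact K.combo_mid_mem_obstacle h h1 (by linarith)

/-- Both points are beyond the line of edge `k`, so the segment between them is free. Before
reaching `y` it is strictly inside the half planes of `i` and `j`, so by `chord_ne_zero` it cannot
cross the line of the chord; a change of sign would put a crossing at the parameter `a / (a - b)`.
-/
theorem chord_same_side (h : i ≠ j) {k : ZMod K.n} {x y : ℂ} (hx : K.side k x ≤ 0)
    (hy : K.side k y ≤ 0) (hix : 0 < K.side i x) (hjx : 0 < K.side j x) (hiy : 0 ≤ K.side i y)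
    (hjy : 0 ≤ K.side j y) (hne : K.chord i j y ≠ 0) : 0 < K.chord i j x * K.chord i j y := by
  have hx0 := chord_ne_zero h (K.mem_free.2 ⟨k, hx⟩) hix hjx
  by_contra hneg
  have hneg : K.chord i j x * K.chord i j y < 0 :=
    lt_of_le_of_ne (not_lt.1 hneg) (mul_ne_zero hx0 hne)
  set a := K.chord i j x
  set b := K.chord i j y
  have hab : a - b ≠ 0 := by
    intro hh
    have : a = b := by linarith
    rw [this] at hneg
    nlinarith [sq_nonneg b]
  have hsq : 0 < (a - b) ^ 2 := by positivity
  have ht0 : 0 ≤ a / (a - b) := by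
    rw [show a / (a - b) = (a * (a - b)) / (a - b) ^ 2 by field_simp]
    apply div_nonneg _ hsq.le
    nlinarith [sq_nonneg a]
  have ht1 : 0 < 1 - a / (a - b) := by
    rw [show 1 - a / (a - b) = (b * b - a * b) / (a - b) ^ 2 by field_simp; ring]
    apply div_pos _ hsq
    nlinarith [sq_nonneg b]
  have hk : K.side k (x + (a / (a - b)) • (y - x)) ≤ 0 := by
    rw [side_combo]; nlinarith
  refine chord_ne_zero h (K.mem_free.2 ⟨k, hk⟩) ?_ ?_ ?_ (x := x + (a / (a - b)) • (y - x))
  · rw [side_combo]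
    have := mul_pos ht1 hix
    have := mul_nonneg ht0 hiy
    linarith
  · rw [side_combo]
    have := mul_pos ht1 hjx
    have := mul_nonneg ht0 hjy
    linarith
  · rw [chord_combo]
    field_simp
    ring

/-- As long as edges `i` and `j` are both unseen, a connected path cannot get from one side of `O`
to the other between them: `chord i j` has no zero on it. This is what makes the chain of seen
edges, and so the scope, unique. -/
theorem chord_mul_pos (h : i ≠ j) {P : Set ℂ} (hP : IsPreconnected P) (hF : P ⊆ K.free)
    (hi : ¬ K.EdgeSeen P i) (hj : ¬ K.EdgeSeen P j) {x y : ℂ} (hx : x ∈ P) (hy : y ∈ P) :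
    0 < K.chord i j x * K.chord i j y := by
  rw [not_edgeSeen_iff] at hi hj
  have hne : ∀ z ∈ P, K.chord i j z ≠ 0 := fun z hz => chord_ne_zero h (hF hz) (hi z hz) (hj z hz)
  by_contra hneg
  have hc := (K.continuous_chord i j).continuousOn (s := P)
  rcases lt_or_gt_of_ne (hne x hx) with h1 | h1 <;> rcases lt_or_gt_of_ne (hne y hy) with h2 | h2
  · exact hneg (mul_pos_of_neg_of_neg h1 h2)
  · obtain ⟨z, hz, hz0⟩ := hP.intermediate_value hx hy hc ⟨h1.le, h2.le⟩
    exact hne z hz hz0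
  · obtain ⟨z, hz, hz0⟩ := hP.intermediate_value hy hx hc ⟨h2.le, h1.le⟩
    exact hne z hz hz0
  · exact hneg (mul_pos h1 h2)

/-! ### Scopes -/

namespace IsScope

variable {P : Set ℂ} {σ σ' : K.Scope}

theorem side_pR_pos (h : K.IsScope P σ) : 0 < K.side σ.R σ.pR :=
  K.not_edgeSeen_iff.1 h.unseenR _ h.memR

theorem side_pR_nonpos (h : K.IsScope P σ) : K.side (σ.R - 1) σ.pR ≤ 0 := K.seesEdge_iff.1 h.seesR

theorem side_pL_pos (h : K.IsScope P σ) : 0 < K.side (σ.L - 1) σ.pL :=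
  K.not_edgeSeen_iff.1 h.unseenL _ h.memL

theorem side_pL_nonpos (h : K.IsScope P σ) : K.side σ.L σ.pL ≤ 0 := K.seesEdge_iff.1 h.seesL

theorem not_finished (h : K.IsScope P σ) : ¬ K.Finished P := fun hf => h.unseenR (hf _)

theorem R_ne_L (h : K.IsScope P σ) : σ.R ≠ σ.L := fun e => h.unseenR (e ▸ h.seenL)

theorem uR_ne_zero (h : K.IsScope P σ) : σ.uR ≠ 0 := by
  intro e
  have := h.side_pR_pos
  rw [← sub_eq_zero.1 e] at this
  simp [Scope.vR] at this

theorem uL_ne_zero (h : K.IsScope P σ) : σ.uL ≠ 0 := by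
  intro e
  have := h.side_pL_pos
  rw [← sub_eq_zero.1 e] at this
  simp [Scope.vL] at this

theorem vL_sub_vR_ne_zero (h : K.IsScope P σ) : σ.vL - σ.vR ≠ 0 := by
  intro e
  have h1 := h.R_ne_L.symm
  have e : K.vertex σ.L = K.vertex σ.R := sub_eq_zero.1 e
  by_cases h2 : σ.L = σ.R + 1
  · have := K.turn_pos σ.L
    rw [h2, add_sub_cancel_right, ← h2, e] at this
    simp [cross] at this
  · have := K.side_vertex_pos h1 h2
    rw [e] at this
    simp at this

/-- The extreme line of sight supports `O`: `pR` is beyond edge `R - 1` and inside edge `R`, so both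
terms of `cross_sight'` contribute with the right sign. `O` is thus to the left of the right line of
sight and, by the mirrored lemma, to the right of the left one. -/
theorem cross_uR_pos (h : K.IsScope P σ) {x : ℂ} (hx : x ∈ K.obstacle) :
    0 < cross σ.uR (x - σ.vR) := by
  have h1 := K.cross_sight' σ.R σ.pR x
  rw [mem_obstacle] at hx
  have h2 := mul_pos h.side_pR_pos (hx (σ.R - 1))
  have h3 := mul_nonneg (neg_nonneg.2 h.side_pR_nonpos) (hx σ.R).le
  refine pos_of_mul_pos_right ?_ (K.turn_pos σ.R).le
  rw [Scope.uR, Scope.vR, h1]; linarith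

theorem cross_uR_nonneg (h : K.IsScope P σ) (k : ZMod K.n) :
    0 ≤ cross σ.uR (K.vertex k - σ.vR) := by
  have h1 := K.cross_sight' σ.R σ.pR (K.vertex k)
  have h2 := mul_nonneg h.side_pR_pos.le (K.side_vertex_nonneg (σ.R - 1) k)
  have h3 := mul_nonneg (neg_nonneg.2 h.side_pR_nonpos) (K.side_vertex_nonneg σ.R k)
  refine nonneg_of_mul_nonneg_right ?_ (K.turn_pos σ.R)
  rw [Scope.uR, Scope.vR, h1]; linarith

theorem cross_uL_neg (h : K.IsScope P σ) {x : ℂ} (hx : x ∈ K.obstacle) :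
    cross σ.uL (x - σ.vL) < 0 := by
  have h1 := K.cross_sight' σ.L σ.pL x
  rw [mem_obstacle] at hx
  have h2 := mul_pos h.side_pL_pos (hx σ.L)
  have h3 := mul_nonneg (neg_nonneg.2 h.side_pL_nonpos) (hx (σ.L - 1)).le
  have : 0 < -cross σ.uL (x - σ.vL) := by
    refine pos_of_mul_pos_right ?_ (K.turn_pos σ.L).le
    rw [mul_neg, Scope.uL, Scope.vL, h1]; linarith
  linarith

theorem cross_uL_nonpos (h : K.IsScope P σ) (k : ZMod K.n) :
    cross σ.uL (K.vertex k - σ.vL) ≤ 0 := by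
  have h1 := K.cross_sight' σ.L σ.pL (K.vertex k)
  have h2 := mul_nonneg h.side_pL_pos.le (K.side_vertex_nonneg σ.L k)
  have h3 := mul_nonneg (neg_nonneg.2 h.side_pL_nonpos) (K.side_vertex_nonneg (σ.L - 1) k)
  have : 0 ≤ -cross σ.uL (K.vertex k - σ.vL) := by
    refine nonneg_of_mul_nonneg_right ?_ (K.turn_pos σ.L)
    rw [mul_neg, Scope.uL, Scope.vL, h1]; linarith
  linarith

/-- Two candidates for `R` give two unseen edges. Each viewpoint `pR` shares a seen edge with its
own extreme vertex, hence lies on the same side of the chord as that vertex; the two vertices are on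
opposite sides, although the visited set stays on one side. -/
theorem R_eq (hP : IsPreconnected P) (hF : P ⊆ K.free) (h : K.IsScope P σ)
    (h' : K.IsScope P σ') : σ.R = σ'.R := by
  by_contra hne
  have hi := K.not_edgeSeen_iff.1 h.unseenR
  have hj := K.not_edgeSeen_iff.1 h'.unseenR
  have g1 := chord_vertex_left hne
  have g2 := chord_vertex_right hne
  have e1 := chord_same_side hne h.side_pR_nonpos (by simp) (hi _ h.memR) (hj _ h.memR)
    (K.side_vertex_nonneg _ _) (K.side_vertex_nonneg _ _) g1.ne'
  have e2 := chord_same_side hne h'.side_pR_nonpos (by simp) (hi _ h'.memR) (hj _ h'.memR)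
    (K.side_vertex_nonneg _ _) (K.side_vertex_nonneg _ _) g2.ne
  have e3 := chord_mul_pos hne hP hF h.unseenR h'.unseenR h.memR h'.memR
  have := pos_of_mul_pos_left e1 g1.le
  have := neg_of_mul_pos_left e2 g2.le
  nlinarith

theorem L_eq (hP : IsPreconnected P) (hF : P ⊆ K.free) (h : K.IsScope P σ)
    (h' : K.IsScope P σ') : σ.L = σ'.L := by
  by_contra hne'
  have hne : σ.L - 1 ≠ σ'.L - 1 := fun e => hne' (sub_left_injective e)
  have hi := K.not_edgeSeen_iff.1 h.unseenL
  have hj := K.not_edgeSeen_iff.1 h'.unseenL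
  have g1 := chord_vertex_succ_left hne
  have g2 := chord_vertex_succ_right hne
  rw [sub_add_cancel] at g1 g2
  have e1 := chord_same_side hne h.side_pL_nonpos (by simp) (hi _ h.memL) (hj _ h.memL)
    (K.side_vertex_nonneg _ _) (K.side_vertex_nonneg _ _) g1.ne
  have e2 := chord_same_side hne h'.side_pL_nonpos (by simp) (hi _ h'.memL) (hj _ h'.memL)
    (K.side_vertex_nonneg _ _) (K.side_vertex_nonneg _ _) g2.ne'
  have e3 := chord_mul_pos hne hP hF h.unseenL h'.unseenL h.memL h'.memL
  have := neg_of_mul_pos_left e1 g1.le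
  have := pos_of_mul_pos_left e2 g2.le
  nlinarith

theorem angle_congr {σ σ' : K.Scope} {c d : ℝ} (hc : 0 < c) (hd : 0 < d)
    (hR : σ'.uR = c • σ.uR) (hL : σ'.uL = d • σ.uL) : σ'.angle = σ.angle := by
  have : σ'.uL / σ'.uR = ((d / c : ℝ) : ℂ) * (σ.uL / σ.uR) := by
    rw [hR, hL]
    simp only [Complex.real_smul]
    push_cast
    have : (c : ℂ) ≠ 0 := by exact_mod_cast hc.ne'
    by_cases h0 : σ.uR = 0
    · simp [h0]
    field_simp
  rw [Scope.angle, this, Complex.arg_real_mul _ (div_pos hd hc), Scope.angle]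

/-- The scope of a connected set of visited points is well defined. -/
theorem angle_eq (hP : IsPreconnected P) (hF : P ⊆ K.free) (h : K.IsScope P σ)
    (h' : K.IsScope P σ') : σ.angle = σ'.angle := by
  have hR := R_eq hP hF h h'
  have hL := L_eq hP hF h h'
  have eR : cross (K.vertex σ'.R - σ'.pR) (K.vertex σ'.R - σ.pR) = 0 := by
    have a1 := h'.extremeR _ h.memR (hR ▸ h.seesR)
    have a2 := h.extremeR _ h'.memR (hR ▸ h'.seesR)
    simp only [Scope.uR, Scope.vR] at a1 a2
    rw [hR] at a2
    rw [cross_comm] at a1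
    linarith
  have eL : cross (K.vertex σ'.L - σ'.pL) (K.vertex σ'.L - σ.pL) = 0 := by
    have a1 := h'.extremeL _ h.memL (hL ▸ h.seesL)
    have a2 := h.extremeL _ h'.memL (hL ▸ h'.seesL)
    simp only [Scope.uL, Scope.vL] at a1 a2
    rw [hL] at a2
    rw [cross_comm] at a1
    linarith
  obtain ⟨c, hc, ec⟩ := K.sight_eq_smul h'.side_pR_pos (hR ▸ h.side_pR_pos) eR
  obtain ⟨d, hd, ed⟩ := K.sight_eq_smul' h'.side_pL_pos (hL ▸ h.side_pL_pos) eL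
  exact angle_congr hc hd (by rw [Scope.uR, Scope.vR, hR, ec]; rfl)
    (by rw [Scope.uL, Scope.vL, hL, ed]; rfl)

theorem angle_nonneg_iff (h : K.IsScope P σ) : 0 ≤ σ.angle ↔ 0 ≤ cross σ.uR σ.uL := by
  have := Complex.normSq_pos.2 h.uR_ne_zero
  rw [Scope.angle, Complex.arg_nonneg_iff, im_div]
  exact ⟨fun h => by simpa [this.ne'] using mul_nonneg h this.le, fun h => by positivity⟩

/-- From a single point the scope is opening. -/
theorem angle_nonneg_of_singleton {s : ℂ} (h : K.IsScope {s} σ) : 0 ≤ σ.angle := by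
  rw [h.angle_nonneg_iff]
  have h1 := h.cross_uR_nonneg σ.L
  have e1 : σ.pR = s := h.memR
  have e2 : σ.pL = s := h.memL
  have : cross σ.uR σ.uL = cross σ.uR (K.vertex σ.L - σ.vR) := by
    simp [Scope.uR, Scope.uL, Scope.vR, Scope.vL, e1, e2, cross]; ring
  rwa [this]

/-- The line through a point parallel to the segment of its extreme vertices avoids the polygon. -/
theorem parallel_line_free {s : ℂ} (h : K.IsScope {s} σ) (t : ℝ) :
    s + t • (σ.vL - σ.vR) ∈ K.free := by
  intro hx
  have h1 := h.cross_uR_pos hx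
  have h2 := h.cross_uL_neg hx
  have e1 : σ.pR = s := h.memR
  have e2 : σ.pL = s := h.memL
  -- Both lines of sight start in `s`, and their cross products with the displacement along `m`
  -- agree; a point of `O` would make one positive and the other negative.
  have : cross σ.uR (s + t • (σ.vL - σ.vR) - σ.vR) = cross σ.uL (s + t • (σ.vL - σ.vR) - σ.vL) := by
    simp [Scope.uR, Scope.uL, e1, e2, cross]; ring
  linarith

/-- The projection of the segment of the extreme vertices to a line perpendicular to the bisector
of an opening scope is not degenerate. -/
theorem bisection_length_pos (h : K.IsScope P σ) (hangle : σ.angle ≤ Real.pi / 2) {w : ℂ}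
    (hw : ‖w‖ = 1) (hperp : inner ℝ w (‖σ.uR‖⁻¹ • σ.uR + ‖σ.uL‖⁻¹ • σ.uL) = 0) :
    0 < |inner ℝ w (σ.vL - σ.vR)| := by
  rw [abs_pos]
  intro h0
  have hw0 : w ≠ 0 := by rintro rfl; simp at hw
  have hIw : Complex.I * w ≠ 0 := mul_ne_zero Complex.I_ne_zero hw0
  have hcI : ∀ z, cross (Complex.I * w) z = -inner ℝ w z := by
    intro z; rw [inner_eq]; simp [cross]; ring
  set m := σ.vL - σ.vR with hm
  -- A degenerate projection makes `m` perpendicular to `w`, as the bisector vector is. The cross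
  -- products of the two lines of sight with `m` are nonnegative and have a vanishing positive
  -- combination, so both lines of sight are parallel to `m`. As `O` is on the left of one and on
  -- the right of the other, they are opposite, and the angle would be `π`.
  have hB : cross (‖σ.uR‖⁻¹ • σ.uR + ‖σ.uL‖⁻¹ • σ.uL) m = 0 :=
    cross_eq_zero_trans hIw (by rw [hcI, hperp, neg_zero]) (by rw [hcI, h0, neg_zero])
  have hR : 0 < ‖σ.uR‖⁻¹ := inv_pos.2 (norm_pos_iff.2 h.uR_ne_zero)
  have hL : 0 < ‖σ.uL‖⁻¹ := inv_pos.2 (norm_pos_iff.2 h.uL_ne_zero)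
  have e : cross (‖σ.uR‖⁻¹ • σ.uR + ‖σ.uL‖⁻¹ • σ.uL) m =
      ‖σ.uR‖⁻¹ * cross σ.uR m + ‖σ.uL‖⁻¹ * cross σ.uL m := by
    simp [cross]; ring
  have c1 : 0 ≤ cross σ.uR m := h.cross_uR_nonneg σ.L
  have c2 : 0 ≤ cross σ.uL m := by
    have := h.cross_uL_nonpos σ.R
    have e2 : cross σ.uL m = -cross σ.uL (K.vertex σ.R - σ.vL) := by
      simp [hm, Scope.vR, cross]; ring
    linarith
  have z1 : cross σ.uR m = 0 := by nlinarith [mul_nonneg hR.le c1, mul_nonneg hL.le c2]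
  have z2 : cross σ.uL m = 0 := by nlinarith [mul_nonneg hR.le c1, mul_nonneg hL.le c2]
  have hmne := h.vL_sub_vR_ne_zero
  have z3 : cross σ.uR σ.uL = 0 :=
    cross_eq_zero_trans (a := m) hmne (by rw [cross_comm, z1, neg_zero])
      (by rw [cross_comm, z2, neg_zero])
  obtain ⟨x, hx⟩ := K.obstacle_nonempty
  have p1 := h.cross_uR_pos hx
  have p2 := h.cross_uL_neg hx
  have p3 : cross σ.uL (x - σ.vR) < 0 := by
    have : cross σ.uL (x - σ.vR) = cross σ.uL (x - σ.vL) + cross σ.uL m := by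
      simp [hm, cross]; ring
    linarith
  have hN := Complex.normSq_pos.2 h.uR_ne_zero
  have hre : (σ.uL / σ.uR).re < 0 := by
    rw [re_div]
    apply div_neg_of_neg_of_pos _ hN
    have : Complex.normSq σ.uR * cross σ.uL (x - σ.vR) =
        inner ℝ σ.uR σ.uL * cross σ.uR (x - σ.vR) -
          cross σ.uR σ.uL * inner ℝ σ.uR (x - σ.vR) := by
      rw [inner_eq, inner_eq, Complex.normSq_apply]; simp only [cross]; ring
    rw [z3, zero_mul, sub_zero] at this
    have h4 := mul_neg_of_pos_of_neg hN p3
    rw [this] at h4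
    exact neg_of_mul_neg_left h4 p1.le
  have him : (σ.uL / σ.uR).im = 0 := by rw [im_div, z3, zero_div]
  have := Complex.arg_eq_pi_iff.2 ⟨hre, him⟩
  rw [Scope.angle, this] at hangle
  linarith [Real.pi_pos]

end IsScope

end ConvexPolygon
end ONPA

namespace ONPA
namespace ConvexPolygon

variable (K : ConvexPolygon)

/-! ### Existence of the scope -/

variable {K} in
theorem exists_transition {p : ZMod K.n → Prop} {i j : ZMod K.n} (hi : p i) (hj : ¬ p j) :
    ∃ k, p (k - 1) ∧ ¬ p k := by
  by_contra! h
  have : ∀ m : ℕ, p (i + m) := by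
    intro m
    induction m with
    | zero => simpa
    | succ m ih =>
      apply h
      convert ih using 1
      push_cast; ring
  apply hj
  have := this (j - i).val
  rwa [ZMod.natCast_zmod_val, add_sub_cancel] at this

variable {K} in
theorem exists_transition' {p : ZMod K.n → Prop} {i j : ZMod K.n} (hi : p i) (hj : ¬ p j) :
    ∃ k, p k ∧ ¬ p (k - 1) := by
  by_contra! h
  have : ∀ m : ℕ, p (i - m) := by
    intro m
    induction m with
    | zero => simpa
    | succ m ih =>
      have := h _ ih
      convert this using 1
      push_cast; ring
  apply hj
  have := this (i - j).val
  rwa [ZMod.natCast_zmod_val, sub_sub_cancel] at this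

theorem exists_isScope {P : Set ℂ} (hc : IsCompact P) (hne : P.Nonempty) (hF : P ⊆ K.free)
    (hfin : ¬ K.Finished P) : ∃ σ, K.IsScope P σ := by
  obtain ⟨x, hx⟩ := hne
  obtain ⟨i, hi⟩ := K.mem_free.1 (hF hx)
  have hi : K.EdgeSeen P i := K.edgeSeen_iff.2 ⟨x, hx, hi⟩
  obtain ⟨j, hj⟩ : ∃ j, ¬ K.EdgeSeen P j := by simpa [Finished] using hfin
  obtain ⟨R, hR, hR'⟩ := exists_transition hi hj
  obtain ⟨L, hL, hL'⟩ := exists_transition' hi hj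
  have hRpos := K.not_edgeSeen_iff.1 hR'
  have hLpos := K.not_edgeSeen_iff.1 hL'
  obtain ⟨a, ha, haR⟩ := K.edgeSeen_iff.1 hR
  obtain ⟨b, hb, hbL⟩ := K.edgeSeen_iff.1 hL
  have hcR : IsCompact (P ∩ {q | K.side (R - 1) q ≤ 0}) :=
    hc.inter_right (isClosed_le (K.continuous_side _) continuous_const)
  have hcL : IsCompact (P ∩ {q | K.side L q ≤ 0}) :=
    hc.inter_right (isClosed_le (K.continuous_side _) continuous_const)
  -- By `cross_sight` the line of sight turned furthest counterclockwise minimizes this ratio over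
  -- the visited points that see edge `R - 1`. The denominator is positive because edge `R` is
  -- unseen.
  obtain ⟨pR, hpR, hmaxR⟩ := hcR.exists_isMinOn ⟨a, ha, haR⟩
    (f := fun q => K.side (R - 1) q / K.side R q)
    ((K.continuous_side _).continuousOn.div (K.continuous_side _).continuousOn
      fun q hq => (hRpos q hq.1).ne')
  obtain ⟨pL, hpL, hmaxL⟩ := hcL.exists_isMinOn ⟨b, hb, hbL⟩
    (f := fun q => K.side L q / K.side (L - 1) q)
    ((K.continuous_side _).continuousOn.div (K.continuous_side _).continuousOn
      fun q hq => (hLpos q hq.1).ne')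
  refine ⟨⟨R, L, pR, pL⟩, hR, hR', hL, hL', hpR.1, K.seesEdge_iff.2 hpR.2, ?_, hpL.1,
    K.seesEdge_iff.2 hpL.2, ?_⟩
  · intro q hq hqR
    have h1 := hmaxR ⟨hq, K.seesEdge_iff.1 hqR⟩
    simp only [mem_ofPred_eq] at h1
    rw [div_le_div_iff₀ (hRpos _ hpR.1) (hRpos _ hq)] at h1
    refine nonneg_of_mul_nonneg_right ?_ (K.turn_pos R)
    simp only [Scope.vR, Scope.uR]
    rw [K.cross_sight]
    linarith
  · intro q hq hqL
    have h1 := hmaxL ⟨hq, K.seesEdge_iff.1 hqL⟩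
    simp only [mem_ofPred_eq] at h1
    rw [div_le_div_iff₀ (hLpos _ hpL.1) (hLpos _ hq)] at h1
    have : 0 ≤ -cross (K.vertex L - q) (K.vertex L - pL) := by
      refine nonneg_of_mul_nonneg_right ?_ (K.turn_pos L)
      rw [mul_neg, K.cross_sight]
      linarith
    simp only [Scope.vL, Scope.uL]
    linarith

/-! ### The approach of the far side -/

/-- The point `p` lies in the relative interior of an edge. -/
def InEdgeInterior (p : ℂ) : Prop := ∃ i, K.side i p = 0 ∧ ∀ j, j ≠ i → 0 < K.side j p

theorem isClosed_visible (p : ℂ) : IsClosed {q | K.Visible p q} := by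
  have : {q | K.Visible p q} = ⋂ t ∈ Icc (0 : ℝ) 1, {q | p + t • (q - p) ∈ K.free} := by
    ext q
    simp only [mem_ofPred_eq, Visible, mem_iInter, segment_eq_image', eq_empty_iff_forall_notMem,
      mem_inter_iff, not_and, mem_image, free, mem_compl_iff]
    constructor
    · intro h t ht; exact h _ ⟨t, ht, rfl⟩
    · rintro h _ ⟨t, ht, rfl⟩; exact h t ht
  rw [this]
  exact isClosed_biInter fun t _ => K.isClosed_free.preimage (by fun_prop)

theorem isClosed_outerRay {a b : ℂ} (h : a ≠ b) : IsClosed (outerRay a b) := by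
  have he := isClosedEmbedding_smul_left (𝕜 := ℝ) (sub_ne_zero.2 h)
  have : outerRay a b = (fun q => q - a) ⁻¹' ((fun t : ℝ => t • (a - b)) '' Ici 0) := by
    ext q
    simp only [outerRay, mem_ofPred_eq, mem_preimage, mem_image, mem_Ici]
    refine exists_congr fun t => and_congr_right fun _ => ?_
    rw [eq_sub_iff_add_eq, eq_comm, add_comm]
  rw [this]
  exact (he.isClosedMap _ isClosed_Ici).preimage (by fun_prop)

theorem exists_isClosestFree {a b p q : ℂ} (h : a ≠ b) (hq : q ∈ outerRay a b)
    (hv : K.Visible p q) : ∃ q', K.IsClosestFree (outerRay a b) p q' := by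
  have hcl : IsClosed (outerRay a b ∩ {q | K.Visible p q}) :=
    (isClosed_outerRay h).inter (K.isClosed_visible p)
  have hne : (outerRay a b ∩ {q | K.Visible p q}).Nonempty := ⟨q, hq, hv⟩
  obtain ⟨q', hq', hd⟩ := hcl.exists_infDist_eq_dist hne p
  exact ⟨q', hq'.1, hq'.2, fun y hy hyv => hd ▸ Metric.infDist_le_dist_of_mem ⟨hy, hyv⟩⟩

/-- A segment from `p` to a point at height `h` above the line of edge `i` crosses this line only
after the fixed fraction `c / (c + h)` of its length. If the goal is far enough away in direction
`u`, the segment is by then already outside a disc that contains `O`. -/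
theorem exists_visible_of_parallel {i : ZMod K.n} {p a u : ℂ} (hp : K.side i p < 0)
    (ha : 0 ≤ K.side i a) (hu : u ≠ 0) (hD : cross (K.vertex (i + 1) - K.vertex i) u = 0) :
    ∃ t : ℝ, 1 ≤ t ∧ K.Visible p (a + t • u) := by
  obtain ⟨M, hM⟩ := K.isBounded_obstacle.exists_norm_le
  set c := -K.side i p with hc
  set h := K.side i a with hh
  have hcpos : 0 < c := by linarith
  have hsum : 0 < c + h := by linarith
  have hun : 0 < ‖u‖ := norm_pos_iff.2 hu
  set t := max 1 ((M + ‖p‖ + ‖a - p‖ + 1) * (c + h) / (c * ‖u‖)) with ht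
  have ht1 : 1 ≤ t := le_max_left _ _
  refine ⟨t, ht1, ?_⟩
  rw [Visible, eq_empty_iff_forall_notMem]
  rintro z ⟨hz, hzO⟩
  rw [segment_eq_image'] at hz
  obtain ⟨l, ⟨hl0, hl1⟩, rfl⟩ := hz
  have h1 := K.mem_obstacle.1 hzO i
  simp only at h1
  rw [side_combo, side_add_smul, hD, mul_zero, add_zero, ← hh,
    show K.side i p = -c by linarith] at h1
  have hl : c < l * (c + h) := by nlinarith
  have h2 := hM _ hzO
  have h3 : (M + ‖p‖ + ‖a - p‖ + 1) * (c + h) ≤ t * (c * ‖u‖) := by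
    rw [← div_le_iff₀ (by positivity)]; exact le_max_right _ _
  have h4 : l * t * ‖u‖ ≤ ‖p + l • (a + t • u - p)‖ + (‖p‖ + ‖a - p‖) := by
    have e : (l * t) • u = (p + l • (a + t • u - p)) - (p + l • (a - p)) := by module
    have e1 : ‖(l * t) • u‖ = l * t * ‖u‖ := by
      rw [norm_smul, Real.norm_eq_abs, abs_of_nonneg (by positivity)]
    rw [← e1, e]
    refine (norm_sub_le _ _).trans (add_le_add le_rfl ((norm_add_le _ _).trans ?_))
    rw [norm_smul, Real.norm_eq_abs, abs_of_nonneg hl0]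
    have := mul_le_of_le_one_left (norm_nonneg (a - p)) hl1
    linarith
  have h5 : c * (t * ‖u‖) ≤ l * (c + h) * (t * ‖u‖) :=
    mul_le_mul_of_nonneg_right hl.le (by positivity)
  have h6 : (M + ‖p‖ + ‖a - p‖ + 1) * (c + h) ≤ (l * t * ‖u‖) * (c + h) := by
    calc _ ≤ t * (c * ‖u‖) := h3
      _ = c * (t * ‖u‖) := by ring
      _ ≤ l * (c + h) * (t * ‖u‖) := h5
      _ = _ := by ring
  have h7 := le_of_mul_le_mul_right h6 hsum
  linarith

variable {K}

/-- Let `p` be on or beyond the line of edge `i`. If `m` is not parallel to the edge, the line of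
`m` meets the line of the edge outside the interior of `m`, in a point that `p` sees. If it is
parallel and `p` is strictly beyond the line, a distant point works. If `p` is on the line, some
other edge `j` serves instead, because `p` is not in the interior of edge `i`. -/
theorem exists_visible_outerRay {p : ℂ} (hp : p ∈ K.free) (hgood : ¬ K.InEdgeInterior p)
    {R L : ZMod K.n} (hne : K.vertex L - K.vertex R ≠ 0) :
    ∃ q, (q ∈ outerRay (K.vertex R) (K.vertex L) ∨ q ∈ outerRay (K.vertex L) (K.vertex R)) ∧
      K.Visible p q := by
  obtain ⟨i, hi⟩ := K.mem_free.1 hp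
  set u := K.vertex L - K.vertex R with hu
  have memR : ∀ t : ℝ, t ≤ 0 → K.vertex R + t • u ∈ outerRay (K.vertex R) (K.vertex L) :=
    fun t ht => ⟨-t, by linarith, by rw [hu]; module⟩
  have memL : ∀ t : ℝ, 1 ≤ t → K.vertex R + t • u ∈ outerRay (K.vertex L) (K.vertex R) :=
    fun t ht => ⟨t - 1, by linarith, by rw [hu]; module⟩
  have cross_u : ∀ k, cross (K.vertex (k + 1) - K.vertex k) u =
      K.side k (K.vertex L) - K.side k (K.vertex R) := fun k => (K.side_sub k _ _).symm
  have hR := K.side_vertex_nonneg i R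
  have hL := K.side_vertex_nonneg i L
  rcases lt_trichotomy (cross (K.vertex (i + 1) - K.vertex i) u) 0 with hD | hD | hD
  · refine ⟨K.vertex R + (K.side i (K.vertex R) / -cross (K.vertex (i + 1) - K.vertex i) u) • u,
      Or.inr (memL _ ?_), K.visible_of_side_nonpos hi ?_⟩
    · rw [le_div_iff₀ (by linarith)]; linarith [cross_u i]
    · rw [side_add_smul, div_neg, neg_mul, div_mul_cancel₀ _ hD.ne, add_neg_cancel]
  · rcases hi.lt_or_eq with hi | hi
    · obtain ⟨t, ht, hv⟩ := K.exists_visible_of_parallel hi hR hne hD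
      exact ⟨_, Or.inr (memL t ht), hv⟩
    · have : ∃ j, j ≠ i ∧ K.side j p ≤ 0 := by
        by_contra! h
        exact hgood ⟨i, hi, h⟩
      obtain ⟨j, hji, hj⟩ := this
      have hR' := K.side_vertex_nonneg j R
      have hL' := K.side_vertex_nonneg j L
      rcases lt_trichotomy (cross (K.vertex (j + 1) - K.vertex j) u) 0 with hD' | hD' | hD'
      · refine ⟨K.vertex R +
          (K.side j (K.vertex R) / -cross (K.vertex (j + 1) - K.vertex j) u) • u,
          Or.inr (memL _ ?_), K.visible_of_side_nonpos hj ?_⟩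
        · rw [le_div_iff₀ (by linarith)]; linarith [cross_u j]
        · rw [side_add_smul, div_neg, neg_mul, div_mul_cancel₀ _ hD'.ne, add_neg_cancel]
      -- If `j` is parallel to `m` as well, then edges `i` and `j` are parallel and `side j` takes
      -- at `vertex i` the same nonpositive value as at `p`. Convexity allows this only for `i = j +
      -- 1`, and adjacent edges are not parallel.
      · exfalso
        have hdi : K.vertex (i + 1) - K.vertex i ≠ 0 := by
          intro h
          have := K.turn_pos (i + 1)
          rw [add_sub_cancel_right, h] at this
          simp [cross] at this
        have e1 : cross (p - K.vertex i) u = 0 := cross_eq_zero_trans hdi hi hD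
        have e2 : cross (K.vertex (j + 1) - K.vertex j) (p - K.vertex i) = 0 :=
          cross_eq_zero_trans hne (by rw [cross_comm, hD', neg_zero])
            (by rw [cross_comm, e1, neg_zero])
        have e3 : cross (K.vertex (j + 1) - K.vertex j) (K.vertex (i + 1) - K.vertex i) = 0 :=
          cross_eq_zero_trans hne (by rw [cross_comm, hD', neg_zero])
            (by rw [cross_comm, hD, neg_zero])
        rw [← side_sub] at e2
        by_cases hij : i = j + 1
        · have := K.turn_pos i
          rw [← hij] at e3
          rw [show i - 1 = j by rw [hij, add_sub_cancel_right], e3] at this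
          exact lt_irrefl _ this
        · have := K.side_vertex_pos hji.symm hij
          linarith
      · refine ⟨K.vertex R +
          (-K.side j (K.vertex R) / cross (K.vertex (j + 1) - K.vertex j) u) • u,
          Or.inl (memR _ (div_nonpos_of_nonpos_of_nonneg (by linarith) hD'.le)),
          K.visible_of_side_nonpos hj ?_⟩
        rw [side_add_smul]
        field_simp
        simp
  · refine ⟨K.vertex R + (-K.side i (K.vertex R) / cross (K.vertex (i + 1) - K.vertex i) u) • u,
      Or.inl (memR _ (div_nonpos_of_nonpos_of_nonneg (by linarith) hD.le)),
      K.visible_of_side_nonpos hi ?_⟩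
    rw [side_add_smul]
    field_simp
    simp

theorem exists_isClosingTarget {P : Set ℂ} {σ : K.Scope} (hσ : K.IsScope P σ) {p : ℂ}
    (hp : p ∈ K.free) (hgood : ¬ K.InEdgeInterior p) : ∃ q, K.IsClosingTarget σ p q := by
  by_cases hf : ∃ q, K.IsFreeFoot σ p q
  · exact ⟨hf.choose, Or.inl hf.choose_spec⟩
  have hne := hσ.vL_sub_vR_ne_zero
  obtain ⟨q, hq | hq, hv⟩ := exists_visible_outerRay hp hgood hne
  · obtain ⟨q', hq'⟩ := K.exists_isClosestFree (sub_ne_zero.1 hne).symm hq hv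
    exact ⟨q', Or.inr ⟨not_exists.1 hf, Or.inl hq'⟩⟩
  · obtain ⟨q', hq'⟩ := K.exists_isClosestFree (sub_ne_zero.1 hne) hq hv
    exact ⟨q', Or.inr ⟨not_exists.1 hf, Or.inr hq'⟩⟩

theorem IsClosingTarget.mem_outerRay {σ : K.Scope} {p q : ℂ} (h : K.IsClosingTarget σ p q) :
    (q ∈ outerRay σ.vR σ.vL ∨ q ∈ outerRay σ.vL σ.vR) ∧ K.Visible p q := by
  rcases h with h | ⟨_, h | h⟩
  · exact ⟨h.1, h.2.2⟩
  · exact ⟨Or.inl h.1, h.2.1⟩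
  · exact ⟨Or.inr h.1, h.2.1⟩

/-- Along the line of `m` both functions are affine, vanish at vertex `j` and are nonnegative at
vertex `k`, so they are nonpositive beyond `j`. A goal on the ray therefore sees both edges at `j`;
one of them is unseen so far if `j` is extreme, and together they keep the goal out of all edge
interiors. -/
theorem side_nonpos_of_mem_outerRay {j k : ZMod K.n} {q : ℂ}
    (hq : q ∈ outerRay (K.vertex j) (K.vertex k)) : K.side j q ≤ 0 ∧ K.side (j - 1) q ≤ 0 := by
  obtain ⟨t, ht, rfl⟩ := hq
  have e : K.vertex j + t • (K.vertex j - K.vertex k) =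
      K.vertex j + (-t) • (K.vertex k - K.vertex j) := by module
  rw [e, side_combo, side_combo]
  have h1 := mul_nonneg ht (K.side_vertex_nonneg j k)
  have h2 := mul_nonneg ht (K.side_vertex_nonneg (j - 1) k)
  constructor
  · simp; linarith
  · simp; linarith

theorem not_inEdgeInterior_of_mem_outerRay {j k : ZMod K.n} {q : ℂ}
    (hq : q ∈ outerRay (K.vertex j) (K.vertex k)) : ¬ K.InEdgeInterior q := by
  obtain ⟨h1, h2⟩ := side_nonpos_of_mem_outerRay hq
  rintro ⟨i, -, hi⟩
  by_cases hij : j = i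
  · exact absurd (hi (j - 1) (hij ▸ K.pred_ne j)) (not_lt.2 h2)
  · exact absurd (hi j hij) (not_lt.2 h1)

/-- The goal of an approach sees a new edge. -/
theorem IsClosingTarget.exists_new_edge {P : Set ℂ} {σ : K.Scope} (hσ : K.IsScope P σ) {p q : ℂ}
    (h : K.IsClosingTarget σ p q) : ∃ i, ¬ K.EdgeSeen P i ∧ K.side i q ≤ 0 := by
  rcases h.mem_outerRay.1 with h | h
  · exact ⟨σ.R, hσ.unseenR, (side_nonpos_of_mem_outerRay h).1⟩
  · exact ⟨σ.L - 1, hσ.unseenL, (side_nonpos_of_mem_outerRay h).2⟩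

theorem IsClosingTarget.not_inEdgeInterior {σ : K.Scope} {p q : ℂ}
    (h : K.IsClosingTarget σ p q) : ¬ K.InEdgeInterior q := by
  rcases h.mem_outerRay.1 with h | h <;> exact not_inEdgeInterior_of_mem_outerRay h

/-! ### Stopping times of the searches -/

variable (K) in
/-- The exploration is finished, or the scope is at most `θ`. -/
def StopAt (θ : ℝ) (P : Set ℂ) : Prop := K.Finished P ∨ ∃ σ, K.IsScope P σ ∧ σ.angle ≤ θ

theorem not_stopAt_of_lt {P : Set ℂ} {θ : ℝ} (hP : IsPreconnected P) (hF : P ⊆ K.free)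
    {σ : K.Scope} (hσ : K.IsScope P σ) (h : θ < σ.angle) : ¬ K.StopAt θ P := by
  rintro (hf | ⟨σ', hσ', h'⟩)
  · exact hσ.not_finished hf
  · rw [hσ'.angle_eq hP hF hσ] at h'; linarith

/-- `Complex.arg` jumps only on the negative real axis, so only a limit `b / a` there is in
question. The one-sided conditions, which come from extremality, force `v k / u k` to have
nonnegative imaginary part and negative real part for some `k`; its argument then exceeds `π / 2 ≥
θ`. -/
theorem arg_le_of_tendsto {a b : ℂ} {u v : ℕ → ℂ} {θ : ℝ} (hθ : θ ≤ Real.pi / 2) (ha : a ≠ 0)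
    (hb : b ≠ 0) (hu : Filter.Tendsto u Filter.atTop (nhds a))
    (hv : Filter.Tendsto v Filter.atTop (nhds b)) (h1 : ∀ k, 0 ≤ cross a (u k))
    (h2 : ∀ k, cross b (v k) ≤ 0) (h : ∀ k, Complex.arg (v k / u k) ≤ θ) :
    Complex.arg (b / a) ≤ θ := by
  have ht : Filter.Tendsto (fun k => v k / u k) Filter.atTop (nhds (b / a)) := hv.div hu ha
  by_cases hs : b / a ∈ Complex.slitPlane
  · exact le_of_tendsto ((Complex.continuousAt_arg hs).tendsto.comp ht)
      (Filter.Eventually.of_forall h)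
  exfalso
  rw [Complex.mem_slitPlane_iff] at hs
  push Not at hs
  obtain ⟨hre, him⟩ := hs
  have hN := Complex.normSq_pos.2 ha
  have hN' := Complex.normSq_pos.2 hb
  have hcr : cross a b = 0 := by
    rw [im_div] at him
    simpa [hN.ne'] using him
  have hre' : (b / a).re < 0 := by
    refine lt_of_le_of_ne hre fun h0 => div_ne_zero hb ha (Complex.ext h0 him)
  have hin : inner ℝ a b < 0 := by
    rw [re_div] at hre'
    by_contra hh
    exact absurd hre' (not_lt.2 (div_nonneg (not_lt.1 hh) hN.le))
  have t1 : Filter.Tendsto (fun k => (v k / u k).re) Filter.atTop (nhds (b / a).re) :=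
    (Complex.continuous_re.tendsto _).comp ht
  have t2 : Filter.Tendsto (fun k => inner ℝ a (u k)) Filter.atTop (nhds (inner ℝ a a)) :=
    tendsto_const_nhds.inner hu
  have t3 : Filter.Tendsto (fun k => inner ℝ a (v k)) Filter.atTop (nhds (inner ℝ a b)) :=
    tendsto_const_nhds.inner hv
  have hin0 : 0 < inner ℝ a a := by rw [inner_eq]; rwa [Complex.normSq_apply] at hN
  obtain ⟨k, ⟨k1, k2⟩, k3⟩ := (((t1.eventually (gt_mem_nhds hre')).and
    (t2.eventually (lt_mem_nhds hin0))).and (t3.eventually (gt_mem_nhds hin))).exists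
  have c1 : 0 ≤ cross a (v k) := by
    have e : Complex.normSq a * cross b (v k) = inner ℝ a b * cross a (v k) -
        cross a b * inner ℝ a (v k) := by
      rw [inner_eq, inner_eq, Complex.normSq_apply]; simp only [cross]; ring
    rw [hcr, zero_mul, sub_zero] at e
    have := mul_nonpos_of_nonneg_of_nonpos hN.le (h2 k)
    rw [e] at this
    exact nonneg_of_mul_nonpos_right this hin
  have c2 : 0 ≤ cross (u k) (v k) := by
    have e : Complex.normSq a * cross (u k) (v k) = inner ℝ a (u k) * cross a (v k) -
        cross a (u k) * inner ℝ a (v k) := by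
      rw [inner_eq, inner_eq, Complex.normSq_apply]; simp only [cross]; ring
    refine nonneg_of_mul_nonneg_right ?_ hN
    rw [e]
    have := mul_nonneg k2.le c1
    have := mul_nonneg (h1 k) (neg_nonneg.2 k3.le)
    linarith
  have c3 : 0 ≤ Complex.arg (v k / u k) := by
    rw [Complex.arg_nonneg_iff, im_div]
    exact div_nonneg c2 (Complex.normSq_nonneg _)
  have c4 : |Complex.arg (v k / u k)| ≤ Real.pi / 2 := by
    rw [abs_of_nonneg c3]; linarith [h k]
  rw [Complex.abs_arg_le_pi_div_two_iff] at c4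
  linarith

section Path

variable {f : ℝ → ℂ} {T : ℝ}

theorem edgeSeen_of_tendsto (hf : ContinuousOn f (Ici 0)) {u : ℕ → ℝ}
    (hu : Filter.Tendsto u Filter.atTop (nhds T)) {i : ZMod K.n}
    (h : ∀ k, K.EdgeSeen (f '' Icc 0 (u k)) i) : K.EdgeSeen (f '' Icc 0 T) i := by
  simp only [edgeSeen_iff, exists_mem_image] at h ⊢
  choose t ht hs using h
  obtain ⟨B, hB⟩ := hu.bddAbove_range
  obtain ⟨t', ht', φ, hφ, hlim⟩ := isCompact_Icc.tendsto_subseq (x := t) (s := Icc 0 B)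
    fun k => ⟨(ht k).1, (ht k).2.trans (hB (mem_range_self k))⟩
  have hle : t' ≤ T := le_of_tendsto_of_tendsto' hlim (hu.comp hφ.tendsto_atTop)
    fun k => (ht (φ k)).2
  refine ⟨t', ⟨ht'.1, hle⟩, ?_⟩
  have hf' : Filter.Tendsto (fun k => f (t (φ k))) Filter.atTop (nhds (f t')) :=
    (hf t' ht'.1).tendsto.comp (tendsto_nhdsWithin_iff.2
      ⟨hlim, Filter.Eventually.of_forall fun k => (ht (φ k)).1⟩)
  exact le_of_tendsto (((K.continuous_side i).tendsto _).comp hf')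
    (Filter.Eventually.of_forall fun k => hs (φ k))

/-- The viewpoints have convergent subsequences of visiting times, with limits at most `T`. Seeing
an edge and being extreme are closed conditions; the unseen edges stay unseen because `T ≤ u k`
means that less has been visited. -/
theorem exists_scope_of_tendsto (hf : ContinuousOn f (Ici 0)) {u : ℕ → ℝ}
    (hu : Filter.Tendsto u Filter.atTop (nhds T)) (hT' : ∀ k, T ≤ u k) {θ : ℝ}
    (hθ : θ ≤ Real.pi / 2) {R L : ZMod K.n}
    (h : ∀ k, ∃ pR pL, K.IsScope (f '' Icc 0 (u k)) ⟨R, L, pR, pL⟩ ∧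
      (⟨R, L, pR, pL⟩ : K.Scope).angle ≤ θ) :
    ∃ pR pL, K.IsScope (f '' Icc 0 T) ⟨R, L, pR, pL⟩ ∧
      (⟨R, L, pR, pL⟩ : K.Scope).angle ≤ θ := by
  choose pR pL hσ hang using h
  have hR : ∀ k, ∃ t, t ∈ Icc 0 (u k) ∧ f t = pR k := fun k => (hσ k).memR
  have hL : ∀ k, ∃ t, t ∈ Icc 0 (u k) ∧ f t = pL k := fun k => (hσ k).memL
  choose tR htR ftR using hR
  choose tL htL ftL using hL
  obtain ⟨B, hB⟩ := hu.bddAbove_range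
  obtain ⟨aR, haR, φ, hφ, limR⟩ := isCompact_Icc.tendsto_subseq (x := tR) (s := Icc 0 B)
    fun k => ⟨(htR k).1, (htR k).2.trans (hB (mem_range_self k))⟩
  obtain ⟨aL, haL, ψ, hψ, limL⟩ := isCompact_Icc.tendsto_subseq (x := tL ∘ φ) (s := Icc 0 B)
    fun k => ⟨(htL _).1, (htL _).2.trans (hB (mem_range_self _))⟩
  have hlim : Filter.Tendsto (fun k => u (φ (ψ k))) Filter.atTop (nhds T) :=
    hu.comp (hφ.tendsto_atTop.comp hψ.tendsto_atTop)
  have limR' : Filter.Tendsto (fun k => tR (φ (ψ k))) Filter.atTop (nhds aR) :=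
    limR.comp hψ.tendsto_atTop
  have hRle : aR ≤ T := le_of_tendsto_of_tendsto' limR' hlim fun k => (htR _).2
  have hLle : aL ≤ T := le_of_tendsto_of_tendsto' limL hlim fun k => (htL _).2
  have fR : Filter.Tendsto (fun k => pR (φ (ψ k))) Filter.atTop (nhds (f aR)) := by
    simp only [← ftR]
    exact (hf aR haR.1).tendsto.comp (tendsto_nhdsWithin_iff.2
      ⟨limR', Filter.Eventually.of_forall fun k => (htR _).1⟩)
  have fL : Filter.Tendsto (fun k => pL (φ (ψ k))) Filter.atTop (nhds (f aL)) := by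
    simp only [← ftL]
    exact (hf aL haL.1).tendsto.comp (tendsto_nhdsWithin_iff.2
      ⟨limL, Filter.Eventually.of_forall fun k => (htL _).1⟩)
  have hsub : ∀ k, f '' Icc 0 T ⊆ f '' Icc 0 (u k) := fun k =>
    image_mono (Icc_subset_Icc_right (hT' k))
  have memR : f aR ∈ f '' Icc 0 T := mem_image_of_mem f ⟨haR.1, hRle⟩
  have memL : f aL ∈ f '' Icc 0 T := mem_image_of_mem f ⟨haL.1, hLle⟩
  have seesR : K.SeesEdge (f aR) (R - 1) := K.seesEdge_iff.2 <|
    le_of_tendsto (((K.continuous_side (R - 1)).tendsto _).comp fR)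
      (Filter.Eventually.of_forall fun k => (hσ (φ (ψ k))).side_pR_nonpos)
  have seesL : K.SeesEdge (f aL) L := K.seesEdge_iff.2 <|
    le_of_tendsto (((K.continuous_side L).tendsto _).comp fL)
      (Filter.Eventually.of_forall fun k => (hσ (φ (ψ k))).side_pL_nonpos)
  have hS : K.IsScope (f '' Icc 0 T) ⟨R, L, f aR, f aL⟩ := by
    refine ⟨⟨_, memR, seesR⟩, fun hh => (hσ 0).unseenR (hh.mono (hsub 0)), ⟨_, memL, seesL⟩,
      fun hh => (hσ 0).unseenL (hh.mono (hsub 0)), memR, seesR, ?_, memL, seesL, ?_⟩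
    · intro q hq hqR
      have hcont : Continuous fun z => cross (K.vertex R - q) (K.vertex R - z) :=
        continuous_cross continuous_const (by fun_prop)
      exact ge_of_tendsto ((hcont.tendsto _).comp fR)
        (Filter.Eventually.of_forall fun k => (hσ (φ (ψ k))).extremeR q (hsub _ hq) hqR)
    · intro q hq hqL
      have hcont : Continuous fun z => cross (K.vertex L - q) (K.vertex L - z) :=
        continuous_cross continuous_const (by fun_prop)
      exact le_of_tendsto ((hcont.tendsto _).comp fL)
        (Filter.Eventually.of_forall fun k => (hσ (φ (ψ k))).extremeL q (hsub _ hq) hqL)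
  refine ⟨f aR, f aL, hS, ?_⟩
  refine arg_le_of_tendsto (u := fun k => K.vertex R - pR (φ (ψ k)))
    (v := fun k => K.vertex L - pL (φ (ψ k))) hθ hS.uR_ne_zero hS.uL_ne_zero
    (fR.const_sub _) (fL.const_sub _) ?_ ?_ fun k => hang (φ (ψ k))
  · exact fun k => (hσ (φ (ψ k))).extremeR _ (hsub _ memR) seesR
  · exact fun k => (hσ (φ (ψ k))).extremeL _ (hsub _ memL) seesL

/-- If a search along a path meets the stopping condition, then there is a first time when it does
so. -/
theorem exists_isLeast_stopAt (hf : ContinuousOn f (Ici 0)) {θ : ℝ}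
    (hθ : θ ≤ Real.pi / 2) (hne : ∃ r, 0 ≤ r ∧ K.StopAt θ (f '' Icc 0 (T + r))) :
    ∃ τ, IsLeast {r | 0 ≤ r ∧ K.StopAt θ (f '' Icc 0 (T + r))} τ := by
  set S := {r | 0 ≤ r ∧ K.StopAt θ (f '' Icc 0 (T + r))} with hS
  have hbdd : BddBelow S := ⟨0, fun r hr => hr.1⟩
  have hSne : S.Nonempty := hne
  obtain ⟨u, -, hlim, hu⟩ := exists_seq_tendsto_sInf hSne hbdd
  refine ⟨sInf S, ⟨le_csInf hSne fun r hr => hr.1, ?_⟩, fun r hr => csInf_le hbdd hr⟩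
  have hle : ∀ k, T + sInf S ≤ T + u k := fun k => by linarith [csInf_le hbdd (hu k)]
  have hlim' : Filter.Tendsto (fun k => T + u k) Filter.atTop (nhds (T + sInf S)) :=
    hlim.const_add T
  -- Along a sequence of stopping times that tends to the infimum, infinitely many terms are
  -- finished or infinitely many have a small scope; in the second case infinitely many share the
  -- same pair of extreme vertices, as there are finitely many pairs.
  have hfreq : ∃ᶠ k in Filter.atTop, K.StopAt θ (f '' Icc 0 (T + u k)) :=
    Filter.Frequently.of_forall fun k => (hu k).2
  rw [show (fun k => K.StopAt θ (f '' Icc 0 (T + u k))) = fun k =>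
    (K.Finished (f '' Icc 0 (T + u k)) ∨ ∃ σ, K.IsScope (f '' Icc 0 (T + u k)) σ ∧ σ.angle ≤ θ)
    from rfl, Filter.frequently_or_distrib] at hfreq
  rcases hfreq with hfreq | hfreq
  · obtain ⟨φ, hφ, hfin⟩ := Filter.extraction_of_frequently_atTop hfreq
    exact Or.inl fun i => edgeSeen_of_tendsto hf
      (hlim'.comp hφ.tendsto_atTop) fun k => hfin k i
  · have hfreq' : ∃ RL : ZMod K.n × ZMod K.n, ∃ᶠ k in Filter.atTop,
        ∃ pR pL, K.IsScope (f '' Icc 0 (T + u k)) ⟨RL.1, RL.2, pR, pL⟩ ∧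
          (⟨RL.1, RL.2, pR, pL⟩ : K.Scope).angle ≤ θ := by
      by_contra! hno
      refine hfreq ((Filter.eventually_all.2 hno).mono ?_)
      rintro k hk ⟨⟨R, L, pR, pL⟩, h1, h2⟩
      exact absurd h2 (not_le.2 (hk (R, L) pR pL h1))
    obtain ⟨⟨R, L⟩, hfr⟩ := hfreq'
    obtain ⟨φ, hφ, hsc⟩ := Filter.extraction_of_frequently_atTop hfr
    obtain ⟨pR, pL, h1, h2⟩ := exists_scope_of_tendsto hf
      (hlim'.comp hφ.tendsto_atTop) (fun k => hle _) hθ hsc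
    exact Or.inr ⟨_, h1, h2⟩

end Path

end ConvexPolygon
end ONPA

/-! ### Where a search can stop. -/

namespace ONPA

theorem abs_cross_le (a b : ℂ) : |cross a b| ≤ ‖a‖ * ‖b‖ := by
  have : cross a b = inner ℝ (Complex.I * a) b := by rw [inner_eq]; simp [cross]; ring
  rw [this]
  refine (abs_real_inner_le_norm _ _).trans_eq ?_
  simp

namespace ConvexPolygon

variable {K : ConvexPolygon}

theorem StopAt.mono {θ θ' : ℝ} (h : θ ≤ θ') {P : Set ℂ} (hP : K.StopAt θ P) : K.StopAt θ' P :=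
  hP.imp_right fun ⟨σ, hσ, h'⟩ => ⟨σ, hσ, h'.trans h⟩

/-- A search does not stop in the relative interior of an edge, unless it is finished. -/
theorem not_inEdgeInterior_of_isLeast {f : ℝ → ℂ} {T τ θ : ℝ} (hf : ContinuousOn f (Ici 0))
    (hT : 0 ≤ T) (hτ : IsLeast {r | 0 ≤ r ∧ K.StopAt θ (f '' Icc 0 (T + r))} τ) (hτ0 : 0 < τ)
    (hF : MapsTo f (Icc 0 (T + τ)) K.free) (hfin : ¬ K.Finished (f '' Icc 0 (T + τ))) :
    ¬ K.InEdgeInterior (f (T + τ)) := by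
  rintro ⟨i, hi, hpos⟩
  have hu0 : 0 < T + τ := by linarith
  obtain ⟨σ, hσ, hang⟩ := hτ.1.2.resolve_left hfin
  have hca : ContinuousAt f (T + τ) := hf.continuousAt (Ici_mem_nhds hu0)
  -- Just before the stop all `side j` with `j ≠ i` are still positive, so the path, being free, is
  -- already on or beyond the line of edge `i`: the final position shows no edge that was not seen
  -- earlier.
  have hev : ∀ᶠ u in nhdsWithin (T + τ) (Iio (T + τ)),
      (∀ j, j ≠ i → 0 < K.side j (f u)) ∧ u ∈ Ioo T (T + τ) := by
    refine Filter.Eventually.and (Filter.eventually_all.2 fun j => ?_)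
      (Ioo_mem_nhdsLT (by linarith))
    by_cases hj : j = i
    · exact Filter.Eventually.of_forall fun _ h => absurd hj h
    · have h1 : Filter.Tendsto (fun u => K.side j (f u)) (nhds (T + τ))
        (nhds (K.side j (f (T + τ)))) := ((K.continuous_side j).tendsto _).comp hca
      filter_upwards [(h1.eventually (lt_mem_nhds (hpos j hj))).filter_mono nhdsWithin_le_nhds]
        with u hu _ using hu
  obtain ⟨u1, hu1, hTu1, hu1lt⟩ := hev.exists
  have hu1mem : u1 ∈ Icc 0 (T + τ) := ⟨by linarith, hu1lt.le⟩
  have hu1i : K.side i (f u1) ≤ 0 := by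
    obtain ⟨k, hk⟩ := K.mem_free.1 (hF hu1mem)
    by_cases hki : k = i
    · exact hki ▸ hk
    · exact absurd (hu1 k hki) (not_lt.2 hk)
  -- The extreme line of sight is also realized earlier. If its viewpoint is the final position, it
  -- runs along edge `i = R - 1`, which is the least turned possibility; being extreme, it must be
  -- parallel to the line of sight from the earlier point `f u1`.
  have hR : ∃ t ∈ Ico 0 (T + τ), K.side (σ.R - 1) (f t) ≤ 0 ∧
      ∃ c : ℝ, 0 < c ∧ σ.vR - f t = c • σ.uR := by
    obtain ⟨t, ht, hft⟩ := hσ.memR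
    rcases ht.2.lt_or_eq with h | h
    · exact ⟨t, ⟨ht.1, h⟩, hft ▸ hσ.side_pR_nonpos, 1, one_pos, by rw [one_smul, Scope.uR, hft]⟩
    have hp : σ.pR = f (T + τ) := by rw [← hft, h]
    have hRi : σ.R - 1 = i := by
      by_contra hne
      exact absurd (hpos _ hne) (not_lt.2 (hp ▸ hσ.side_pR_nonpos))
    have hRne : σ.R ≠ i := by rw [← hRi]; exact (K.pred_ne _).symm
    refine ⟨u1, ⟨hu1mem.1, hu1lt⟩, hRi ▸ hu1i, ?_⟩
    have h1 := hσ.extremeR (f u1) (mem_image_of_mem f hu1mem) (K.seesEdge_iff.2 (hRi ▸ hu1i))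
    have h2 := K.cross_sight σ.R (f u1) σ.pR
    rw [hRi, hp, hi, mul_zero, sub_zero, ← hRi, ← hp] at h2
    have h3 := mul_nonpos_of_nonpos_of_nonneg (hRi ▸ hu1i) hσ.side_pR_pos.le
    rw [hRi] at h3
    have h4 := mul_nonneg (K.turn_pos σ.R).le h1
    have h5 : cross (K.vertex σ.R - f u1) (K.vertex σ.R - σ.pR) = 0 := by
      have h6 : cross (K.vertex σ.R - K.vertex (σ.R - 1)) (K.vertex (σ.R + 1) - K.vertex σ.R) *
        cross (K.vertex σ.R - f u1) (K.vertex σ.R - σ.pR) = 0 := by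
        refine le_antisymm ?_ h4
        rw [h2, hRi]; exact h3
      exact (mul_eq_zero.1 h6).resolve_left (K.turn_pos _).ne'
    exact K.sight_eq_smul hσ.side_pR_pos (hu1 _ hRne) (by rw [cross_comm, h5, neg_zero])
  have hL : ∃ t ∈ Ico 0 (T + τ), K.side σ.L (f t) ≤ 0 ∧
      ∃ c : ℝ, 0 < c ∧ σ.vL - f t = c • σ.uL := by
    obtain ⟨t, ht, hft⟩ := hσ.memL
    rcases ht.2.lt_or_eq with h | h
    · exact ⟨t, ⟨ht.1, h⟩, hft ▸ hσ.side_pL_nonpos, 1, one_pos, by rw [one_smul, Scope.uL, hft]⟩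
    have hp : σ.pL = f (T + τ) := by rw [← hft, h]
    have hLi : σ.L = i := by
      by_contra hne
      exact absurd (hpos _ hne) (not_lt.2 (hp ▸ hσ.side_pL_nonpos))
    have hLne : σ.L - 1 ≠ i := by rw [← hLi]; exact K.pred_ne _
    refine ⟨u1, ⟨hu1mem.1, hu1lt⟩, hLi ▸ hu1i, ?_⟩
    have h1 := hσ.extremeL (f u1) (mem_image_of_mem f hu1mem) (K.seesEdge_iff.2 (hLi ▸ hu1i))
    have h0 : K.side σ.L σ.pL = 0 := by rw [hLi, hp, hi]
    have h2 := K.cross_sight σ.L (f u1) σ.pL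
    rw [h0, mul_zero, zero_sub] at h2
    have h3 := mul_nonpos_of_nonpos_of_nonneg (hLi ▸ hu1i : K.side σ.L (f u1) ≤ 0)
      hσ.side_pL_pos.le
    have h4 := mul_nonpos_of_nonneg_of_nonpos (K.turn_pos σ.L).le h1
    have h5 : cross (K.vertex σ.L - f u1) (K.vertex σ.L - σ.pL) = 0 := by
      have h6 : cross (K.vertex σ.L - K.vertex (σ.L - 1)) (K.vertex (σ.L + 1) - K.vertex σ.L) *
        cross (K.vertex σ.L - f u1) (K.vertex σ.L - σ.pL) = 0 := by
        refine le_antisymm h4 ?_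
        rw [h2]; linarith
      exact (mul_eq_zero.1 h6).resolve_left (K.turn_pos _).ne'
    exact K.sight_eq_smul' hσ.side_pL_pos (hu1 _ hLne) (by rw [cross_comm, h5, neg_zero])
  obtain ⟨tR, htR, hsR, c, hc, ec⟩ := hR
  obtain ⟨tL, htL, hsL, d, hd, ed⟩ := hL
  -- By this time, strictly before the stop, the same scope directions were present, so the search
  -- would have stopped earlier.
  set u' := max u1 (max tR tL) with hu'
  have hlt : u' < T + τ := max_lt hu1lt (max_lt htR.2 htL.2)
  have hge : T ≤ u' := hTu1.le.trans (le_max_left _ _)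
  have hsub : f '' Icc 0 u' ⊆ f '' Icc 0 (T + τ) := image_mono (Icc_subset_Icc_right hlt.le)
  have memR : f tR ∈ f '' Icc 0 u' :=
    mem_image_of_mem f ⟨htR.1, (le_max_left _ _).trans (le_max_right _ _)⟩
  have memL : f tL ∈ f '' Icc 0 u' :=
    mem_image_of_mem f ⟨htL.1, (le_max_right _ _).trans (le_max_right _ _)⟩
  have hσ' : K.IsScope (f '' Icc 0 u') ⟨σ.R, σ.L, f tR, f tL⟩ := by
    refine ⟨⟨_, memR, K.seesEdge_iff.2 hsR⟩, fun h => hσ.unseenR (h.mono hsub),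
      ⟨_, memL, K.seesEdge_iff.2 hsL⟩, fun h => hσ.unseenL (h.mono hsub), memR,
      K.seesEdge_iff.2 hsR, ?_, memL, K.seesEdge_iff.2 hsL, ?_⟩
    · intro q hq hqR
      have := hσ.extremeR q (hsub hq) hqR
      have e : cross (σ.vR - q) (σ.vR - f tR) = c * cross (σ.vR - q) σ.uR := by
        rw [ec]; simp [cross]; ring
      exact e ▸ mul_nonneg hc.le this
    · intro q hq hqL
      have := hσ.extremeL q (hsub hq) hqL
      have e : cross (σ.vL - q) (σ.vL - f tL) = d * cross (σ.vL - q) σ.uL := by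
        rw [ed]; simp [cross]; ring
      exact e ▸ mul_nonpos_of_nonneg_of_nonpos hd.le this
  have hang' := IsScope.angle_congr (σ := σ) (σ' := ⟨σ.R, σ.L, f tR, f tL⟩) hc hd ec ed
  have := hτ.2 (show u' - T ∈ {r | 0 ≤ r ∧ K.StopAt θ (f '' Icc 0 (T + r))} from
    ⟨by linarith, Or.inr ⟨_, by rwa [add_sub_cancel], hang'.trans_le hang⟩⟩)
  linarith

/-! ### Searches that go far in both directions -/

variable (K) in
/-- Beyond the distance `T` from `p`, the line `p + ℝ w` has left behind all lines through edges and
midpoints of edges that it is not parallel to, and the polygon is comparatively small. -/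
def IsFar (p w : ℂ) (T : ℝ) : Prop := ∀ t : ℝ, T ≤ |t| →
  (∀ k, cross (K.vertex (k + 1) - K.vertex k) w ≠ 0 →
    0 < K.side k (p + t • w) * (t * cross (K.vertex (k + 1) - K.vertex k) w)) ∧
  (∀ k l, cross (K.mid l - K.mid k) w ≠ 0 →
    0 < K.chord k l (p + t • w) * (t * cross (K.mid l - K.mid k) w)) ∧
  ∀ k, 2 * ‖K.vertex k - p‖ ≤ |t|

theorem exists_isFar (p w : ℂ) : ∃ T, 0 < T ∧ K.IsFar p w T := by
  have key : ∀ a c : ℝ, c ≠ 0 → ∀ᶠ T in Filter.atTop,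
      ∀ t : ℝ, T ≤ |t| → 0 < (a + t * c) * (t * c) := by
    intro a c hc
    filter_upwards [Filter.eventually_gt_atTop (|a| / |c|)] with T hT t ht
    have hc' : 0 < |c| := abs_pos.2 hc
    have h1 : |a| < |t * c| := by
      rw [abs_mul]; rw [div_lt_iff₀ hc'] at hT
      exact hT.trans_le (mul_le_mul_of_nonneg_right ht hc'.le)
    have h2 : -(|a| * |t * c|) ≤ a * (t * c) := by
      rw [← abs_mul]; exact neg_abs_le _
    have h3 : |t * c| * |t * c| = (t * c) * (t * c) := abs_mul_abs_self _
    have h4 : 0 < |t * c| := (abs_nonneg a).trans_lt h1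
    nlinarith
  have e1 : ∀ᶠ T in Filter.atTop, ∀ k, cross (K.vertex (k + 1) - K.vertex k) w ≠ 0 →
      ∀ t : ℝ, T ≤ |t| →
        0 < K.side k (p + t • w) * (t * cross (K.vertex (k + 1) - K.vertex k) w) := by
    refine Filter.eventually_all.2 fun k => ?_
    by_cases hk : cross (K.vertex (k + 1) - K.vertex k) w = 0
    · exact Filter.Eventually.of_forall fun _ h => absurd hk h
    · filter_upwards [key (K.side k p) _ hk] with T hT _ t ht
      rw [side_add_smul]; exact hT t ht
  have e2 : ∀ᶠ T in Filter.atTop, ∀ kl : ZMod K.n × ZMod K.n,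
      cross (K.mid kl.2 - K.mid kl.1) w ≠ 0 → ∀ t : ℝ, T ≤ |t| →
        0 < K.chord kl.1 kl.2 (p + t • w) * (t * cross (K.mid kl.2 - K.mid kl.1) w) := by
    refine Filter.eventually_all.2 fun kl => ?_
    by_cases hk : cross (K.mid kl.2 - K.mid kl.1) w = 0
    · exact Filter.Eventually.of_forall fun _ h => absurd hk h
    · filter_upwards [key (K.chord kl.1 kl.2 p) _ hk] with T hT _ t ht
      rw [chord_add_smul]; exact hT t ht
  have e3 : ∀ᶠ T in Filter.atTop, ∀ k, 2 * ‖K.vertex k - p‖ ≤ T :=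
    Filter.eventually_all.2 fun k => Filter.eventually_ge_atTop _
  obtain ⟨T, ⟨⟨h1, h2⟩, h3⟩, h4⟩ :=
    (((e1.and e2).and e3).and (Filter.eventually_gt_atTop 0)).exists
  exact ⟨T, h4, fun t ht => ⟨fun k hk => h1 k hk t ht, fun k l hk => h2 (k, l) hk t ht,
    fun k => (h3 k).trans ht⟩⟩

theorem IsFar.neg {p w : ℂ} {T : ℝ} (h : K.IsFar p w T) : K.IsFar p (-w) T := by
  have hneg : ∀ a : ℂ, cross a (-w) = -cross a w := fun a => by simp [cross]; ring
  intro t ht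
  obtain ⟨h1, h2, h3⟩ := h (-t) (by rwa [abs_neg])
  simp only [hneg, smul_neg, neg_smul, neg_mul, neg_ne_zero, mul_neg, abs_neg] at *
  exact ⟨h1, h2, h3⟩

/-- If the only unseen edge is parallel to `e`, then its far away lines of sight meet at an obtuse
angle. -/
theorem angle_le_of_far {P : Set ℂ} {σ : K.Scope} (hσ : K.IsScope P σ) (hL : σ.L = σ.R + 1)
    {p e : ℂ} {T r r' l : ℝ} (hT : 0 < T) (hfar : K.IsFar p e T) (he : ‖e‖ = 1) (hl : 0 < l)
    (hd : K.vertex (σ.R + 1) - K.vertex σ.R = l • e) (hr : T ≤ r) (hr' : T ≤ r')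
    (hq : p + (-r) • e ∈ P) (hq' : p + r' • e ∈ P) : σ.angle ≤ -(Real.pi / 2) := by
  have hN : e.re * e.re + e.im * e.im = 1 := by
    have := Complex.normSq_eq_norm_sq e
    rw [he, Complex.normSq_apply] at this
    linarith
  obtain ⟨f1, -, f3⟩ := hfar (-r) (by rw [abs_neg]; exact hr.trans (le_abs_self _))
  obtain ⟨f1', -, f3'⟩ := hfar r' (hr'.trans (le_abs_self _))
  rw [abs_neg, abs_of_nonneg (by linarith)] at f3
  rw [abs_of_nonneg (by linarith)] at f3'
  have hcl : ∀ a : ℂ, cross a (l • e) = l * cross a e := fun a => by simp [cross]; ring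
  have hcl' : ∀ a : ℂ, cross (l • e) a = l * cross e a := fun a => by simp [cross]; ring
  have hs : K.side (σ.R - 1) (p + (-r) • e) ≤ 0 := by
    have ht := K.turn_pos σ.R
    rw [hd, hcl] at ht
    have ht' := pos_of_mul_pos_right ht hl.le
    have := f1 (σ.R - 1) (by rw [sub_add_cancel]; exact ht'.ne')
    rw [sub_add_cancel] at this
    have h2 : -r * cross (K.vertex σ.R - K.vertex (σ.R - 1)) e < 0 := by nlinarith
    exact (neg_of_mul_pos_left this h2.le).le
  have hs' : K.side σ.L (p + r' • e) ≤ 0 := by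
    have ht := K.turn_pos σ.L
    rw [show σ.L - 1 = σ.R by rw [hL, add_sub_cancel_right]] at ht
    rw [hL, hd, ← hL, cross_comm, hcl] at ht
    have ht' : cross (K.vertex (σ.L + 1) - K.vertex σ.L) e < 0 := by
      by_contra hh; nlinarith
    have := f1' σ.L ht'.ne
    have h2 : r' * cross (K.vertex (σ.L + 1) - K.vertex σ.L) e < 0 := by nlinarith
    exact (neg_of_mul_pos_left this h2.le).le
  have xR := hσ.extremeR _ hq (K.seesEdge_iff.2 hs)
  have xL := hσ.extremeL _ hq' (K.seesEdge_iff.2 hs')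
  have uR := hσ.side_pR_pos
  have uL : 0 < K.side σ.R σ.pL := by
    have := hσ.side_pL_pos
    rwa [show σ.L - 1 = σ.R by rw [hL, add_sub_cancel_right]] at this
  have uq := K.not_edgeSeen_iff.1 hσ.unseenR _ hq
  have n0 := f3 σ.R
  have n1 := f3' σ.L
  rw [side, hd, hcl'] at uR uq
  rw [side_eq, hd, hcl', ← hL] at uL
  -- Orthogonal coordinates with first axis `e`; the second, `-cross e`, is positive for vectors
  -- pointing across the line of the unseen edge. Both extreme vertices have the same height `B`.
  set A := inner ℝ e (σ.vR - p) with hA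
  set B := -cross e (σ.vR - p) with hB
  set A' := inner ℝ e (σ.vL - p) with hA'
  set x := inner ℝ e σ.uR with hx
  set y := -cross e σ.uR with hy
  set x' := inner ℝ e σ.uL with hx'
  set y' := -cross e σ.uL with hy'
  have hy0 : 0 < y := by
    have : cross e (σ.pR - K.vertex σ.R) = y := by
      simp [hy, cross, Scope.uR, Scope.vR]; ring
    rw [this] at uR; exact pos_of_mul_pos_right uR hl.le
  have hy0' : 0 < y' := by
    have : cross e (σ.pL - K.vertex σ.L) = y' := by
      simp [hy', cross, Scope.uL, Scope.vL]; ring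
    rw [this] at uL; exact pos_of_mul_pos_right uL hl.le
  have hB0 : 0 < B := by
    have : cross e (p + (-r) • e - K.vertex σ.R) = B := by
      simp [hB, cross, Scope.vR]; ring
    rw [this] at uq; exact pos_of_mul_pos_right uq hl.le
  have hBB : -cross e (σ.vL - p) = B := by
    have : cross e (σ.vL - p) = cross e (σ.vR - p) + cross e (l • e) := by
      rw [← hd, ← hL]; simp [cross, Scope.vL, Scope.vR]; ring
    rw [this, hcl, cross_self]; simp [hB]
  have bA : |A| ≤ ‖σ.vR - p‖ := by
    have := abs_real_inner_le_norm e (σ.vR - p)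
    rwa [he, one_mul] at this
  have bB : B ≤ ‖σ.vR - p‖ := by
    have := abs_cross_le e (σ.vR - p)
    rw [he, one_mul] at this
    linarith [neg_abs_le (cross e (σ.vR - p))]
  have bA' : |A'| ≤ ‖σ.vL - p‖ := by
    have := abs_real_inner_le_norm e (σ.vL - p)
    rwa [he, one_mul] at this
  have bB' : B ≤ ‖σ.vL - p‖ := by
    have := abs_cross_le e (σ.vL - p)
    rw [he, one_mul] at this
    linarith [neg_abs_le (cross e (σ.vL - p))]
  have n0' : 2 * ‖σ.vR - p‖ ≤ r := n0
  have n1' : 2 * ‖σ.vL - p‖ ≤ r' := n1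
  -- This is where the factor `2` in `IsFar` enters: `|A|` and `B` are at most `r / 2`, so from the
  -- far point the vertex appears under a slope of at most `1`. The extreme lines of sight are at
  -- least as flat (`hyx`, `hyx'`), from opposite sides, hence differ by at least a right angle.
  have k1 : B ≤ A + r := by linarith [neg_abs_le A]
  have k2 : B ≤ r' - A' := by linarith [le_abs_self A']
  have ecross : ∀ a b : ℂ, cross a b = inner ℝ e a * cross e b - cross e a * inner ℝ e b := by
    intro a b
    rw [inner_eq, inner_eq]
    simp only [cross]
    linear_combination (-(a.re * b.im - a.im * b.re)) * hN
  have einner : ∀ a b : ℂ, inner ℝ a b = inner ℝ e a * inner ℝ e b + cross e a * cross e b := by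
    intro a b
    rw [inner_eq, inner_eq, inner_eq]
    simp only [cross]
    linear_combination (-(a.re * b.re + a.im * b.im)) * hN
  have hyx : y ≤ x := by
    rw [ecross] at xR
    have a1 : inner ℝ e (σ.vR - (p + (-r) • e)) = A + r := by
      rw [hA, inner_eq, inner_eq]; simp; linear_combination r * hN
    have a2 : cross e (σ.vR - (p + (-r) • e)) = -B := by simp [hB, cross]; ring
    rw [a1, a2, ← hx, show cross e σ.uR = -y by simp [hy]] at xR
    have := mul_le_mul_of_nonneg_right k1 hy0.le
    have : B * y ≤ B * x := by linarith
    exact le_of_mul_le_mul_left this hB0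
  have hyx' : x' ≤ -y' := by
    rw [ecross] at xL
    have a1 : inner ℝ e (σ.vL - (p + r' • e)) = A' - r' := by
      rw [hA', inner_eq, inner_eq]; simp; linear_combination (-r') * hN
    have a2 : cross e (σ.vL - (p + r' • e)) = -B := by rw [← hBB]; simp [cross]; ring
    rw [a1, a2, ← hx', show cross e σ.uL = -y' by simp [hy']] at xL
    have := mul_le_mul_of_nonneg_right k2 hy0'.le
    have : B * x' ≤ B * (-y') := by linarith
    exact le_of_mul_le_mul_left this hB0
  have c1 : cross σ.uR σ.uL < 0 := by
    rw [ecross, ← hx, ← hx', show cross e σ.uL = -y' by simp [hy'],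
      show cross e σ.uR = -y by simp [hy]]
    have := mul_pos hy0 hy0'
    have := mul_le_mul_of_nonneg_right hyx hy0'.le
    have := mul_le_mul_of_nonneg_left hyx' hy0.le
    linarith
  have c2 : inner ℝ σ.uR σ.uL ≤ 0 := by
    rw [einner, ← hx, ← hx', show cross e σ.uL = -y' by simp [hy'],
      show cross e σ.uR = -y by simp [hy]]
    have := mul_le_mul_of_nonneg_right hyx hy0'.le
    have := mul_le_mul_of_nonneg_left hyx' (hy0.le.trans hyx)
    linarith
  have hNu := Complex.normSq_pos.2 hσ.uR_ne_zero
  have i1 : Complex.arg (σ.uL / σ.uR) < 0 := by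
    rw [Complex.arg_neg_iff, im_div]; exact div_neg_of_neg_of_pos c1 hNu
  have i2 : ¬ |Complex.arg (σ.uL / σ.uR)| < Real.pi / 2 := by
    rw [Complex.abs_arg_lt_pi_div_two_iff, not_or]
    exact ⟨not_lt.2 (by rw [re_div]; exact div_nonpos_of_nonpos_of_nonneg c2 hNu.le),
      div_ne_zero hσ.uL_ne_zero hσ.uR_ne_zero⟩
  rw [abs_of_neg i1, not_lt] at i2
  rw [Scope.angle]
  linarith

/-- A search that has gone far in both directions has met every stopping condition. -/
theorem stopAt_of_far {P : Set ℂ} (hc : IsCompact P) (hP : IsPreconnected P) (hF : P ⊆ K.free)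
    {p w : ℂ} {T r r' : ℝ} (hw : ‖w‖ = 1) (hT : 0 < T) (hfar : K.IsFar p w T) (hr : T ≤ r)
    (hr' : T ≤ r') (hq : p + r • w ∈ P) (hq' : p + (-r') • w ∈ P) :
    K.StopAt (-(Real.pi / 2)) P := by
  by_cases hfin : K.Finished P
  · exact Or.inl hfin
  obtain ⟨σ, hσ⟩ := K.exists_isScope hc ⟨_, hq⟩ hF hfin
  obtain ⟨f1, f2, -⟩ := hfar r (hr.trans (le_abs_self _))
  obtain ⟨f1', f2', -⟩ := hfar (-r') (by rw [abs_neg]; exact hr'.trans (le_abs_self _))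
  have hw0 : w ≠ 0 := by rintro rfl; simp at hw
  -- The function `side k` has opposite signs at the two far points unless edge `k` is parallel to
  -- the line, and a nonpositive value means that the edge is seen.
  have hpar : ∀ k, ¬ K.EdgeSeen P k → cross (K.vertex (k + 1) - K.vertex k) w = 0 := by
    intro k hk
    by_contra hne
    rw [not_edgeSeen_iff] at hk
    have a1 := pos_of_mul_pos_right (f1 k hne) (hk _ hq).le
    have a2 := pos_of_mul_pos_right (f1' k hne) (hk _ hq').le
    have a3 := pos_of_mul_pos_right a1 (by linarith)
    nlinarith
  have hRw := hpar _ hσ.unseenR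
  -- If `R` and `L - 1` were different unseen edges, the chord between them would not be parallel to
  -- `w`, since edge `R` is. The two far points would then lie on opposite sides of the chord.
  have hL : σ.L = σ.R + 1 := by
    by_contra hne
    have hne' : σ.R ≠ σ.L - 1 := fun h => hne (by rw [h, sub_add_cancel])
    have hch := chord_mul_pos hne' hP hF hσ.unseenR hσ.unseenL hq hq'
    have hm : cross (K.mid (σ.L - 1) - K.mid σ.R) w ≠ 0 := by
      intro h0
      have h1 := K.side_mid_pos hne'
      have h2 : cross (K.vertex (σ.R + 1) - K.vertex σ.R) (K.mid (σ.L - 1) - K.mid σ.R) = 0 :=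
        cross_eq_zero_trans hw0 (by rw [cross_comm, hRw, neg_zero])
          (by rw [cross_comm, h0, neg_zero])
      rw [← side_sub, side_mid_self, sub_zero] at h2
      linarith
    have a1 := f2 _ _ hm
    have a2 := f2' _ _ hm
    have a3 := mul_pos a1 a2
    have a4 : 0 < r * r' * (cross (K.mid (σ.L - 1) - K.mid σ.R) w) ^ 2 := by
      have : 0 < r := by linarith
      have : 0 < r' := by linarith
      positivity
    have a5 := mul_pos hch a4
    linarith
  have hN : w.re * w.re + w.im * w.im = 1 := by
    have := Complex.normSq_eq_norm_sq w
    rw [hw, Complex.normSq_apply] at this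
    linarith
  have hd : K.vertex (σ.R + 1) - K.vertex σ.R =
      (inner ℝ w (K.vertex (σ.R + 1) - K.vertex σ.R)) • w := by
    rw [inner_eq]
    simp only [cross] at hRw
    apply Complex.ext
    · simp only [Complex.real_smul, Complex.re_ofReal_mul]
      linear_combination (-(K.vertex (σ.R + 1) - K.vertex σ.R).re) * hN + w.im * hRw
    · simp only [Complex.real_smul, Complex.im_ofReal_mul]
      linear_combination (-(K.vertex (σ.R + 1) - K.vertex σ.R).im) * hN - w.re * hRw
  set l := inner ℝ w (K.vertex (σ.R + 1) - K.vertex σ.R)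
  refine Or.inr ⟨σ, hσ, ?_⟩
  rcases lt_trichotomy l 0 with hl | hl | hl
  · exact angle_le_of_far hσ hL hT hfar.neg (by rwa [norm_neg]) (neg_pos.2 hl)
      (by rw [hd]; simp) hr hr' (by simpa using hq) (by simpa using hq')
  · exfalso
    have := K.turn_pos (σ.R + 1)
    rw [add_sub_cancel_right, hd, hl] at this
    simp [cross] at this
  · exact angle_le_of_far hσ hL hT hfar hw hl hd hr' hr hq' hq

end ConvexPolygon
end ONPA

namespace ONPA

/-! ### The spiral search on a line -/

theorem zigzag_eq_of_lt {Q t : ℝ} (hQ : 0 < Q) {k : ℕ} (h1 : (2 ^ k - 1) * Q ≤ t)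
    (h2 : t < (2 ^ (k + 1) - 1) * Q) :
    zigzag Q t = (1 - (-2) ^ k) * Q / 3 + (-1) ^ k * (t - (2 ^ k - 1) * Q) := by
  have h1' : (2 : ℝ) ^ k ≤ t / Q + 1 := by
    have := (le_div_iff₀ hQ).2 h1
    linarith
  have h2' : t / Q + 1 < (2 : ℝ) ^ (k + 1) := by
    have := (div_lt_iff₀ hQ).2 h2
    linarith
  have h0 : (0 : ℝ) ≤ t / Q + 1 := le_trans (by positivity) h1'
  have hlog : Nat.log 2 ⌊t / Q + 1⌋₊ = k := by
    apply Nat.log_eq_of_pow_le_of_lt_pow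
    · apply Nat.le_floor; push_cast; exact h1'
    · rw [Nat.floor_lt h0]; push_cast; exact h2'
  simp only [zigzag, hlog]

theorem zigzag_eq {Q t : ℝ} (hQ : 0 < Q) {k : ℕ} (h1 : (2 ^ k - 1) * Q ≤ t)
    (h2 : t ≤ (2 ^ (k + 1) - 1) * Q) :
    zigzag Q t = (1 - (-2) ^ k) * Q / 3 + (-1) ^ k * (t - (2 ^ k - 1) * Q) := by
  rcases h2.lt_or_eq with h | rfl
  · exact zigzag_eq_of_lt hQ h1 h
  · have hp : (0 : ℝ) < 2 ^ (k + 1) := by positivity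
    rw [zigzag_eq_of_lt hQ le_rfl (by rw [pow_succ _ (k + 1)]; nlinarith)]
    have e : ((-2 : ℝ)) ^ k = (-1) ^ k * 2 ^ k := by rw [← mul_pow]; norm_num
    rw [pow_succ (-2 : ℝ), e, pow_succ (2 : ℝ)]
    ring

@[simp] theorem zigzag_zero (Q : ℝ) : zigzag Q 0 = 0 := by simp [zigzag]

theorem zigzag_leg {Q : ℝ} (hQ : 0 < Q) (k : ℕ) :
    zigzag Q ((2 ^ k - 1) * Q) = (1 - (-2) ^ k) * Q / 3 := by
  have hp : (0 : ℝ) < 2 ^ k := by positivity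
  rw [zigzag_eq hQ le_rfl (by rw [pow_succ]; nlinarith)]
  simp

theorem abs_zigzag_sub_le {Q : ℝ} (hQ : 0 < Q) (k : ℕ) : ∀ s t : ℝ, 0 ≤ s → s ≤ t →
    t ≤ (2 ^ k - 1) * Q → |zigzag Q s - zigzag Q t| ≤ t - s := by
  induction k with
  | zero =>
    intro s t hs hst ht
    obtain rfl : s = t := le_antisymm hst (by simp at ht; linarith)
    simp
  | succ k ih =>
    intro s t hs hst ht
    have hleg : ∀ a b : ℝ, (2 ^ k - 1) * Q ≤ a → a ≤ b → b ≤ (2 ^ (k + 1) - 1) * Q →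
        |zigzag Q a - zigzag Q b| ≤ b - a := by
      intro a b ha hab hb
      rw [zigzag_eq hQ ha (hab.trans hb), zigzag_eq hQ (ha.trans hab) hb,
        show ∀ c d e : ℝ, c + (-1) ^ k * (a - d) - (c + (-1) ^ k * (b - d)) = (-1) ^ k * (a - b) by
          intros; ring]
      · rw [abs_mul, abs_pow, abs_neg, abs_one, one_pow, one_mul, abs_sub_comm,
          abs_of_nonneg (by linarith)]
      · exact 0
    rcases le_total t ((2 ^ k - 1) * Q) with h | h
    · exact ih s t hs hst h
    rcases le_total s ((2 ^ k - 1) * Q) with h' | h'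
    · have a1 := ih s _ hs h' le_rfl
      have a2 := hleg _ t le_rfl h ht
      have := abs_sub_le (zigzag Q s) (zigzag Q ((2 ^ k - 1) * Q)) (zigzag Q t)
      linarith
    · exact hleg s t h' hst ht

theorem lipschitzOnWith_zigzag {Q : ℝ} (hQ : 0 < Q) : LipschitzOnWith 1 (zigzag Q) (Ici 0) := by
  have key : ∀ s t : ℝ, 0 ≤ s → s ≤ t → |zigzag Q s - zigzag Q t| ≤ t - s := by
    intro s t hs hst
    obtain ⟨k, hk⟩ := pow_unbounded_of_one_lt (t / Q + 1) (one_lt_two (α := ℝ))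
    refine abs_zigzag_sub_le hQ k s t hs hst ?_
    rw [← div_le_iff₀ hQ]; linarith
  refine LipschitzOnWith.of_dist_le_mul fun s hs t ht => ?_
  rw [NNReal.coe_one, one_mul, Real.dist_eq, Real.dist_eq]
  rcases le_total s t with h | h
  · rw [abs_sub_comm s t, abs_of_nonneg (sub_nonneg.2 h)]; exact key s t hs h
  · rw [abs_sub_comm, abs_of_nonneg (sub_nonneg.2 h)]; exact key t s ht h

/-- The spiral search reaches every point of the line. -/
theorem exists_zigzag_eq {Q : ℝ} (hQ : 0 < Q) (y : ℝ) : ∃ t, 0 ≤ t ∧ zigzag Q t = y := by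
  have hc : ContinuousOn (zigzag Q) (Ici 0) := (lipschitzOnWith_zigzag hQ).continuousOn
  -- After `2m` legs the position is `(1 - 4 ^ m) Q / 3`, after one more leg `(1 + 2 * 4 ^ m) Q /
  -- 3`; for this `m` the two positions enclose `y`.
  obtain ⟨m, hm⟩ := pow_unbounded_of_one_lt (3 * |y| / Q + 1) (show (1 : ℝ) < 4 by norm_num)
  have hm' : 3 * |y| + Q < 4 ^ m * Q := by
    have := mul_lt_mul_of_pos_right hm hQ
    rwa [add_mul, div_mul_cancel₀ _ hQ.ne', one_mul] at this
  have hpos : ∀ k : ℕ, (2 ^ k - 1) * Q ∈ Ici (0 : ℝ) := fun k =>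
    mul_nonneg (sub_nonneg.2 (one_le_pow₀ one_le_two)) hQ.le
  have e1 := zigzag_leg hQ (2 * m)
  have e2 := zigzag_leg hQ (2 * m + 1)
  rw [pow_succ (-2 : ℝ), pow_mul (-2 : ℝ)] at e2
  rw [pow_mul (-2 : ℝ)] at e1
  norm_num at e1 e2
  have := isPreconnected_Ici.intermediate_value (hpos (2 * m)) (hpos (2 * m + 1)) hc
  obtain ⟨t, ht, hty⟩ := this (show y ∈ _ from ⟨by
    rw [e1]; nlinarith [neg_abs_le y, abs_nonneg y], by
    rw [e2]; nlinarith [le_abs_self y, abs_nonneg y]⟩)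
  exact ⟨t, ht, hty⟩

/-! ### Broken lines -/

namespace ConvexPolygon

variable {K : ConvexPolygon}

theorem hasUnitSpeedOn_line (p : ℂ) {w : ℂ} (hw : ‖w‖ = 1) :
    HasUnitSpeedOn (fun t : ℝ => p + t • w) univ := by
  have hd : ∀ x y : ℝ, dist (p + x • w) (p + y • w) = |x - y| := by
    intro x y
    rw [dist_add_left, dist_eq_norm, ← sub_smul, norm_smul, hw, mul_one, Real.norm_eq_abs]
  rw [HasUnitSpeedOn, hasConstantSpeedOnWith_iff_ordered]
  intro x _ y _ hxy
  rw [univ_inter, NNReal.coe_one, one_mul]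
  apply le_antisymm
  · have hl : LipschitzOnWith 1 (fun t : ℝ => p + t • w) univ :=
      LipschitzOnWith.of_dist_le_mul fun a _ b _ => by
        rw [hd, NNReal.coe_one, one_mul, Real.dist_eq]
    have := hl.comp_eVariationOn_le (f := fun t : ℝ => p + t • w) (g := id) (s := Icc x y)
      (mapsTo_univ _ _)
    rw [eVariationOn_id_Icc] at this
    simpa using this
  · have := eVariationOn.edist_le (fun t : ℝ => p + t • w) (left_mem_Icc.2 hxy)
      (right_mem_Icc.2 hxy)
    rwa [edist_dist, hd, abs_sub_comm, abs_of_nonneg (sub_nonneg.2 hxy)] at this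

theorem inner_self_of_norm_one {w : ℂ} (hw : ‖w‖ = 1) : inner ℝ w w = 1 := by
  rw [real_inner_self_eq_norm_sq, hw, one_pow]

theorem isBrokenLine_straight {p w : ℂ} (hw : ‖w‖ = 1) (h : ∀ t : ℝ, p + t • w ∉ K.obstacle) :
    K.IsBrokenLine p w fun t => p + t • w := by
  have hin : ∀ t : ℝ, inner ℝ w (p + t • w) = inner ℝ w p + t := by
    intro t; rw [inner_add_right, inner_smul_right, inner_self_of_norm_one hw, mul_one]
  refine ⟨by simp, fun _ _ => rfl, h, fun t => Or.inl ⟨t, rfl⟩, hasUnitSpeedOn_line p hw,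
    ?_, ?_, ?_⟩
  · intro s t hst
    have := congrArg (inner ℝ w) hst
    simp only [hin] at this
    linarith
  · simp only [hin]; exact Filter.tendsto_atTop_add_const_left _ _ Filter.tendsto_id
  · simp only [hin]; exact Filter.tendsto_atBot_add_const_left _ _ Filter.tendsto_id

/-- A locally Lipschitz proper injective curve can be parametrized by arc length. -/
theorem exists_unitSpeed {g : ℝ → ℂ} (hg : LocallyLipschitz g) (hinj : Function.Injective g)
    {w : ℂ} (hw : ‖w‖ = 1)
    (htop : Filter.Tendsto (fun t => inner ℝ w (g t)) Filter.atTop Filter.atTop)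
    (hbot : Filter.Tendsto (fun t => inner ℝ w (g t)) Filter.atBot Filter.atBot) (t₀ : ℝ) :
    ∃ β : ℝ → ℂ, β 0 = g t₀ ∧ (∀ x, ∃ t, β x = g t) ∧ HasUnitSpeedOn β univ ∧
      Function.Injective β ∧
      Filter.Tendsto (fun t => inner ℝ w (β t)) Filter.atTop Filter.atTop ∧
      Filter.Tendsto (fun t => inner ℝ w (β t)) Filter.atBot Filter.atBot := by
  have hlip : ∀ a b : ℝ, ∃ C : NNReal, LipschitzOnWith C g (Icc a b) := fun a b =>
    hg.locallyLipschitzOn.exists_lipschitzOnWith_of_compact isCompact_Icc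
  have hvar : ∀ {C : NNReal} {A B a b : ℝ}, LipschitzOnWith C g (Icc A B) → A ≤ a → b ≤ B →
      eVariationOn g (Icc a b) ≤ C * ENNReal.ofReal (b - a) := by
    intro C A B a b hC ha hb
    have := hC.comp_eVariationOn_le (g := id) (s := Icc a b)
      fun x hx => ⟨ha.trans hx.1, hx.2.trans hb⟩
    rwa [eVariationOn_id_Icc] at this
  have hbv : LocallyBoundedVariationOn g univ := by
    intro a b _ _
    obtain ⟨C, hC⟩ := hlip a b
    rw [univ_inter]
    exact ((hvar hC le_rfl le_rfl).trans_lt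
      (ENNReal.mul_lt_top ENNReal.coe_lt_top ENNReal.ofReal_lt_top)).ne
  set V := variationOnFromTo g univ t₀ with hV
  have hmono : Monotone V := fun a b hab =>
    variationOnFromTo.monotoneOn hbv (mem_univ _) (mem_univ a) (mem_univ b) hab
  have hdiff : ∀ a b, a ≤ b → V b - V a = (eVariationOn g (Icc a b)).toReal := by
    intro a b hab
    rw [hV, variationOnFromTo.sub_right hbv (mem_univ _) (mem_univ _) (mem_univ _),
      variationOnFromTo.eq_of_le _ _ hab, univ_inter]
  have hsub : ∀ a b, a ≤ b → dist (g a) (g b) ≤ V b - V a := by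
    intro a b hab
    rw [hdiff a b hab, dist_edist]
    have := hbv a b (mem_univ _) (mem_univ _)
    rw [univ_inter] at this
    exact ENNReal.toReal_mono this
      (eVariationOn.edist_le _ (left_mem_Icc.2 hab) (right_mem_Icc.2 hab))
  have hcont : Continuous V := by
    rw [continuous_iff_continuousAt]
    intro x
    obtain ⟨C, hC⟩ := hlip (x - 1) (x + 1)
    have hle : ∀ a b, x - 1 ≤ a → b ≤ x + 1 → a ≤ b → V b - V a ≤ C * (b - a) := by
      intro a b ha hb hab
      rw [hdiff a b hab]
      refine (ENNReal.toReal_mono (ENNReal.mul_lt_top ENNReal.coe_lt_top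
        ENNReal.ofReal_lt_top).ne (hvar hC ha hb)).trans_eq ?_
      rw [ENNReal.toReal_mul, ENNReal.toReal_ofReal (by linarith), ENNReal.coe_toReal]
    have hV' : LipschitzOnWith C V (Icc (x - 1) (x + 1)) :=
      LipschitzOnWith.of_dist_le_mul fun a ha b hb => by
        rw [Real.dist_eq, Real.dist_eq]
        rcases le_total a b with h | h
        · rw [abs_sub_comm, abs_of_nonneg (sub_nonneg.2 (hmono h)), abs_sub_comm a,
            abs_of_nonneg (sub_nonneg.2 h)]
          exact hle a b ha.1 hb.2 h
        · rw [abs_of_nonneg (sub_nonneg.2 (hmono h)), abs_of_nonneg (sub_nonneg.2 h)]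
          exact hle b a hb.1 ha.2 h
    exact hV'.continuousOn.continuousAt (Icc_mem_nhds (by linarith) (by linarith))
  have hinn : ∀ a b, |inner ℝ w (g a) - inner ℝ w (g b)| ≤ dist (g a) (g b) := by
    intro a b
    rw [← inner_sub_right, dist_eq_norm]
    simpa only [hw, one_mul] using abs_real_inner_le_norm w (g a - g b)
  -- The arc length grows at least as fast as the progress in direction `w`, which is unbounded on
  -- both ends.
  have hsurj : Function.Surjective V := by
    apply hcont.surjective
    · refine Filter.tendsto_atTop_mono' _ ?_
        (Filter.tendsto_atTop_add_const_right _ (V t₀ - inner ℝ w (g t₀)) htop)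
      filter_upwards [Filter.eventually_ge_atTop t₀] with t ht
      have h1 := hsub _ _ ht
      have h2 := hinn t₀ t
      linarith [neg_abs_le (inner ℝ w (g t₀) - inner ℝ w (g t))]
    · refine Filter.tendsto_atBot_mono' _ ?_
        (Filter.tendsto_atBot_add_const_right _ (V t₀ - inner ℝ w (g t₀)) hbot)
      filter_upwards [Filter.eventually_le_atBot t₀] with t ht
      have h1 := hsub _ _ ht
      have h2 := hinn t t₀
      linarith [neg_abs_le (inner ℝ w (g t) - inner ℝ w (g t₀))]
  have hβ : ∀ t, naturalParameterization g univ t₀ (V t) = g t := fun t => by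
    have := edist_naturalParameterization_eq_zero hbv (mem_univ t₀) (mem_univ t)
    exact edist_eq_zero.1 this
  have hV0 : V t₀ = 0 := variationOnFromTo.self _ _ _
  refine ⟨naturalParameterization g univ t₀, ?_, ?_, ?_, ?_, ?_, ?_⟩
  · rw [← hV0, hβ]
  · intro x
    obtain ⟨t, rfl⟩ := hsurj x
    exact ⟨t, hβ t⟩
  · have := has_unit_speed_naturalParameterization g hbv (mem_univ t₀)
    rwa [image_univ, hsurj.range_eq] at this
  · intro x y hxy
    obtain ⟨t, rfl⟩ := hsurj x
    obtain ⟨t', rfl⟩ := hsurj y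
    rw [hβ, hβ] at hxy
    rw [hinj hxy]
  · rw [Filter.tendsto_atTop_atTop] at htop ⊢
    intro b
    obtain ⟨i, hi⟩ := htop b
    refine ⟨V i + 1, fun x hx => ?_⟩
    obtain ⟨t, rfl⟩ := hsurj x
    rw [hβ]
    refine hi t ?_
    by_contra hlt
    linarith [hmono (not_le.1 hlt).le]
  · rw [Filter.tendsto_atBot_atBot] at hbot ⊢
    intro b
    obtain ⟨i, hi⟩ := hbot b
    refine ⟨V i - 1, fun x hx => ?_⟩
    obtain ⟨t, rfl⟩ := hsurj x
    rw [hβ]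
    refine hi t ?_
    by_contra hlt
    linarith [hmono (not_le.1 hlt).le]

theorem locallyLipschitz_inv {h : ℝ → ℝ} (hh : LocallyLipschitz h) (h0 : ∀ t, h t ≠ 0) :
    LocallyLipschitz fun t => (h t)⁻¹ := by
  intro x
  obtain ⟨C, s, hs, hC⟩ := (contDiffAt_inv ℝ (n := 1) (h0 x)).exists_lipschitzOnWith
  obtain ⟨D, t, ht, hD⟩ := hh x
  refine ⟨C * D, t ∩ h ⁻¹' s, Filter.inter_mem ht (hh.continuous.continuousAt hs), ?_⟩
  exact hC.comp (hD.mono inter_subset_left) fun y hy => hy.2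

theorem locallyLipschitz_smul {r : ℝ → ℝ} {η : ℝ → ℂ} (hr : LocallyLipschitz r)
    (hη : LocallyLipschitz η) : LocallyLipschitz fun t => r t • η t := by
  have h1 : ContDiff ℝ 1 fun z : ℝ × ℂ => z.1 • z.2 := by fun_prop
  exact h1.locallyLipschitz.comp (hr.prodMk hη)

/-- The gauge of the polygon with respect to one of its points. -/
theorem exists_gauge {c : ℂ} (h : c ∈ K.obstacle) : ∃ G : ℂ → ℝ, LocallyLipschitz G ∧
    (∀ x, x ≠ 0 → 0 < G x) ∧ (∀ (a : ℝ) (x : ℂ), 0 ≤ a → G (a • x) = a * G x) ∧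
    (∀ x, 1 ≤ G x ↔ c + x ∈ K.free) ∧ ∀ x, G x = 1 → c + x ∈ frontier K.obstacle := by
  set S : Set ℂ := (fun x => c + x) ⁻¹' K.obstacle with hS
  have hSo : IsOpen S := K.isOpen_obstacle.preimage (by fun_prop)
  have hSc : Convex ℝ S := K.convex_obstacle.translate_preimage_right c
  have hS0 : (0 : ℂ) ∈ S := by simpa [hS] using h
  have hSn : S ∈ nhds (0 : ℂ) := hSo.mem_nhds hS0
  have hSa : Absorbent ℝ S := absorbent_nhds_zero hSn
  have hSb : Bornology.IsVonNBounded ℝ S := by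
    rw [NormedSpace.isVonNBounded_iff]
    have := K.isBounded_obstacle.vadd (-c)
    refine this.subset fun x hx => ⟨c + x, hx, by simp⟩
  have hSf : ∀ x, x ∈ frontier S → c + x ∈ frontier K.obstacle := by
    intro x hx
    have := (Homeomorph.addLeft c).preimage_frontier K.obstacle
    have hx' : x ∈ frontier ((Homeomorph.addLeft c) ⁻¹' K.obstacle) := hx
    rw [← this] at hx'
    exact hx'
  obtain ⟨C, hC⟩ := hSc.lipschitz_gauge hSn
  refine ⟨gauge S, hC.locallyLipschitz, fun x hx => (gauge_pos hSa hSb).2 hx,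
    fun a x ha => gauge_smul_of_nonneg ha x, fun x => ⟨fun hx hxO =>
      absurd (gauge_lt_one_of_mem_of_isOpen hSo hxO) (not_lt.2 hx), fun hx => ?_⟩,
    fun x hx => hSf x ((gauge_eq_one_iff_mem_frontier hSc hSn).1 hx)⟩
  by_contra hlt
  have h1 := setOfPred_gauge_lt_one_eq_self_of_isOpen hSc hS0 hSo
  have : x ∈ {x | gauge S x < 1} := not_le.1 hlt
  rw [h1] at this
  exact hx this

/-- A curve that comes from infinity on a line through `c`, walks around a star-shaped set with
center `c`, and goes to infinity on the line. -/
theorem exists_radial_curve {G : ℂ → ℝ} (hGl : LocallyLipschitz G) (hGpos : ∀ x, x ≠ 0 → 0 < G x)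
    (c : ℂ) {w : ℂ} (hw : ‖w‖ = 1) : ∃ g : ℝ → ℂ, LocallyLipschitz g ∧ Function.Injective g ∧
      Filter.Tendsto (fun t => inner ℝ w (g t)) Filter.atTop Filter.atTop ∧
      Filter.Tendsto (fun t => inner ℝ w (g t)) Filter.atBot Filter.atBot ∧
      (∀ t, 1 ≤ t → g t = c + ((G w)⁻¹ + (t - 1)) • w) ∧
      (∀ t, t ≤ -1 → g t = c + ((G (-w))⁻¹ + (-t - 1)) • (-w)) ∧
      ∀ t, -1 ≤ t → t ≤ 1 → ∃ x, x ≠ 0 ∧ g t = c + (G x)⁻¹ • x := by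
  have hN : w.re * w.re + w.im * w.im = 1 := by
    have := Complex.normSq_eq_norm_sq w
    rw [hw, Complex.normSq_apply] at this
    linarith
  set k : ℝ → ℝ := fun t => max (-1) (min t 1) with hk
  have hk1 : ∀ t, |k t| ≤ 1 := fun t =>
    abs_le.2 ⟨le_max_left _ _, max_le (by norm_num) (min_le_right _ _)⟩
  have hkge : ∀ t, 1 ≤ t → k t = 1 := fun t ht => by
    simp only [hk, min_eq_right ht]; norm_num
  have hkle : ∀ t, t ≤ -1 → k t = -1 := fun t ht => by
    simp only [hk, min_eq_left (show t ≤ 1 by linarith), max_eq_left ht]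
  have hkmid : ∀ t, -1 ≤ t → t ≤ 1 → k t = t := fun t ht ht' => by
    simp only [hk, min_eq_left ht', max_eq_right ht]
  -- `η` runs from `-w` over `I * w` to `w`, avoiding `0`, and is constant outside `[-1, 1]`. The
  -- curve `g` projects it radially to the set where `G` is `1`; outside `[-1, 1]` the term `t - k
  -- t` moves the point along the line.
  set η : ℝ → ℂ := fun t => k t • w + (1 - |k t|) • (Complex.I * w) with hη
  have hηin : ∀ t, inner ℝ w (η t) = k t := fun t => by
    rw [inner_eq]; simp [hη]; linear_combination k t * hN
  have hηcr : ∀ t, cross w (η t) = 1 - |k t| := fun t => by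
    simp [hη, cross]; linear_combination (1 - |k t|) * hN
  have hη0 : ∀ t, η t ≠ 0 := by
    intro t ht
    have h1 := hηin t
    have h2 := hηcr t
    rw [ht] at h1 h2
    rw [inner_zero_right] at h1
    simp [cross, ← h1] at h2
  have hηge : ∀ t, 1 ≤ t → η t = w := fun t ht => by simp [hη, hkge t ht]
  have hηle : ∀ t, t ≤ -1 → η t = -w := fun t ht => by simp [hη, hkle t ht]
  set g : ℝ → ℂ := fun t => c + ((G (η t))⁻¹ • η t + (t - k t) • w) with hg
  have hgge : ∀ t, 1 ≤ t → g t = c + ((G w)⁻¹ + (t - 1)) • w := fun t ht => by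
    simp only [hg, hηge t ht, hkge t ht, add_smul]
  have hgle : ∀ t, t ≤ -1 → g t = c + ((G (-w))⁻¹ + (-t - 1)) • (-w) := fun t ht => by
    simp only [hg, hηle t ht, hkle t ht]; module
  have hgmid : ∀ t, -1 ≤ t → t ≤ 1 → g t = c + (G (η t))⁻¹ • η t := fun t ht ht' => by
    simp only [hg, hkmid t ht ht', sub_self, zero_smul, add_zero]
  have hkl : LocallyLipschitz k := (LocallyLipschitz.id.min_const 1).const_max (-1)
  have hkl' : LocallyLipschitz fun t => |k t| :=
    (lipschitzWith_one_norm (E := ℝ)).locallyLipschitz.comp hkl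
  have hηl : LocallyLipschitz η :=
    (locallyLipschitz_smul hkl (LocallyLipschitz.const w)).add
      (locallyLipschitz_smul ((LocallyLipschitz.const 1).sub hkl') (LocallyLipschitz.const _))
  have hgl : LocallyLipschitz g :=
    (LocallyLipschitz.const c).add ((locallyLipschitz_smul
      (locallyLipschitz_inv (hGl.comp hηl) fun t => (hGpos _ (hη0 t)).ne') hηl).add
      (locallyLipschitz_smul (LocallyLipschitz.id.sub hkl) (LocallyLipschitz.const w)))
  have hgin : ∀ t, inner ℝ w (g t - c) = (G (η t))⁻¹ * k t + (t - k t) := fun t => by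
    simp only [hg, add_sub_cancel_left]
    rw [inner_add_right, inner_smul_right, inner_smul_right, hηin, inner_self_of_norm_one hw,
      mul_one]
  have hgcr : ∀ t, cross w (g t - c) = (G (η t))⁻¹ * (1 - |k t|) := fun t => by
    rw [← hηcr]
    simp [hg, cross]; ring
  have hginj : Function.Injective g := by
    intro s t hst
    have e1 : inner ℝ w (g s - c) = inner ℝ w (g t - c) := by rw [hst]
    have e2 : cross w (g s - c) = cross w (g t - c) := by rw [hst]
    rw [hgcr, hgcr] at e2
    have p1 := inv_pos.2 (hGpos _ (hη0 s))
    have p2 := inv_pos.2 (hGpos _ (hη0 t))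
    have hmid : ∀ a, |k a| < 1 → -1 ≤ a ∧ a ≤ 1 := by
      intro a ha
      constructor
      · by_contra hlt
        rw [hkle a (by linarith)] at ha
        norm_num at ha
      · by_contra hlt
        rw [hkge a (by linarith)] at ha
        norm_num at ha
    have hout : ∀ a, |k a| = 1 → 1 ≤ a ∨ a ≤ -1 := by
      intro a ha
      by_contra! hlt
      rw [hkmid a hlt.2.le hlt.1.le] at ha
      exact absurd ha (abs_lt.2 ⟨hlt.2, hlt.1⟩).ne
    rcases (hk1 s).lt_or_eq with hs | hs
    · have ht : |k t| < 1 := by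
        refine (hk1 t).lt_of_ne fun ht => ?_
        rw [ht, sub_self, mul_zero] at e2
        have := mul_pos p1 (sub_pos.2 hs)
        linarith
      obtain ⟨s1, s2⟩ := hmid s hs
      obtain ⟨t1, t2⟩ := hmid t ht
      rw [hgin, hgin] at e1
      rw [hkmid s s1 s2] at e1 e2 hs
      rw [hkmid t t1 t2] at e1 e2 ht
      rw [sub_self, sub_self, add_zero, add_zero] at e1
      have hs' := sub_pos.2 hs
      have ht' := sub_pos.2 ht
      -- Dividing the coordinate along `w` by the one across it cancels the radial factor, and the
      -- remaining ratio determines the parameter.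
      have e3 : s * (1 - |t|) = t * (1 - |s|) := by
        apply mul_left_cancel₀ (mul_pos p1 p2).ne'
        linear_combination ((G (η t))⁻¹ * (1 - |t|)) * e1 - ((G (η t))⁻¹ * t) * e2
      rcases le_or_gt 0 s with h0 | h0
      · have : 0 ≤ t := by
          by_contra hh
          have := mul_nonneg h0 ht'.le
          have := mul_neg_of_neg_of_pos (not_le.1 hh) hs'
          linarith
        rw [abs_of_nonneg h0, abs_of_nonneg this] at e3
        linarith
      · have : t < 0 := by
          by_contra hh
          have := mul_neg_of_neg_of_pos h0 ht'
          have := mul_nonneg (not_lt.1 hh) hs'.le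
          linarith
        rw [abs_of_neg h0, abs_of_neg this] at e3
        linarith
    · have ht : |k t| = 1 := by
        rw [hs, sub_self, mul_zero] at e2
        have := (mul_eq_zero.1 e2.symm).resolve_left p2.ne'
        linarith
      rw [hgin, hgin] at e1
      rcases hout s hs with h1 | h1 <;> rcases hout t ht with h2 | h2
      · rw [hηge s h1, hηge t h2, hkge s h1, hkge t h2] at e1
        linarith
      · rw [hkge s h1, hkle t h2] at e1
        linarith
      · rw [hkle s h1, hkge t h2] at e1
        linarith
      · rw [hηle s h1, hηle t h2, hkle s h1, hkle t h2] at e1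
        linarith
  have hin : ∀ t, inner ℝ w (g t) = inner ℝ w c + inner ℝ w (g t - c) := fun t => by
    rw [← inner_add_right, add_sub_cancel]
  have htop : Filter.Tendsto (fun t => inner ℝ w (g t)) Filter.atTop Filter.atTop := by
    refine (Filter.tendsto_atTop_add_const_left _ (inner ℝ w c + (G w)⁻¹ - 1)
      Filter.tendsto_id).congr' ?_
    filter_upwards [Filter.eventually_ge_atTop 1] with t ht
    rw [hin, hgin, hηge t ht, hkge t ht]
    simp only [id]
    ring
  have hbot : Filter.Tendsto (fun t => inner ℝ w (g t)) Filter.atBot Filter.atBot := by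
    refine (Filter.tendsto_atBot_add_const_left _ (inner ℝ w c - (G (-w))⁻¹ + 1)
      Filter.tendsto_id).congr' ?_
    filter_upwards [Filter.eventually_le_atBot (-1)] with t ht
    rw [hin, hgin, hηle t ht, hkle t ht]
    simp only [id]
    ring
  exact ⟨g, hgl, hginj, htop, hbot, hgge, hgle, fun t ht ht' => ⟨_, hη0 t, hgmid t ht ht'⟩⟩

/-- The centre `c` is a point where the line runs into `O`, and the gauge of `O` about `c` makes the
radial curve follow the boundary. As `p` is free and on the line, it lies on one of the two straight
ends, depending on the sign of `t₁`, and arc length is measured from there. -/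
theorem isBrokenLine_around {p w : ℂ} (hp : p ∈ K.free) (hw : ‖w‖ = 1) {t₁ : ℝ}
    (h : p + t₁ • w ∈ K.obstacle) : ∃ β, K.IsBrokenLine p w β := by
  obtain ⟨c, hc⟩ : ∃ c, c = p + t₁ • w := ⟨_, rfl⟩
  rw [← hc] at h
  obtain ⟨G, hGl, hGpos, hGsmul, hGfree, hGfr⟩ := exists_gauge h
  obtain ⟨g, hgl, hginj, htop, hbot, hgge, hgle, hgmid⟩ := exists_radial_curve hGl hGpos c hw
  have hw0 : w ≠ 0 := by rintro rfl; simp at hw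
  have hGw := hGpos w hw0
  have hGw' := hGpos (-w) (neg_ne_zero.2 hw0)
  have hGinv : ∀ x, x ≠ 0 → G ((G x)⁻¹ • x) = 1 := fun x hx => by
    rw [hGsmul _ _ (inv_pos.2 (hGpos _ hx)).le, inv_mul_cancel₀ (hGpos _ hx).ne']
  have hgp : ∃ t₀, g t₀ = p := by
    have hpG : 1 ≤ G (p - c) := (hGfree _).2 (by simpa using hp)
    rcases le_total t₁ 0 with h1 | h1
    · have e : p - c = (-t₁) • w := by rw [hc]; module
      rw [e, hGsmul _ _ (by linarith)] at hpG
      refine ⟨-t₁ - (G w)⁻¹ + 1, ?_⟩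
      rw [hgge]
      · rw [hc]; module
      · have : (G w)⁻¹ ≤ -t₁ := by rwa [inv_le_iff_one_le_mul₀ hGw]
        linarith
    · have e : p - c = t₁ • (-w) := by rw [hc]; module
      rw [e, hGsmul _ _ h1] at hpG
      refine ⟨-(t₁ - (G (-w))⁻¹ + 1), ?_⟩
      rw [hgle]
      · rw [hc]; module
      · have : (G (-w))⁻¹ ≤ t₁ := by rwa [inv_le_iff_one_le_mul₀ hGw']
        linarith
  obtain ⟨t₀, ht₀⟩ := hgp
  obtain ⟨β, b0, b1, b2, b3, b4, b5⟩ := exists_unitSpeed hgl hginj hw htop hbot t₀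
  refine ⟨β, b0.trans ht₀, fun hfree => absurd h (hc ▸ hfree t₁), ?_, ?_, b2, b3, b4, b5⟩
  · intro x
    obtain ⟨t, ht⟩ := b1 x
    rw [ht]
    rcases le_total 1 t with h1 | h1
    · rw [hgge t h1]
      apply (hGfree _).1
      rw [hGsmul _ _ (by have := inv_pos.2 hGw; linarith), add_mul, inv_mul_cancel₀ hGw.ne']
      have := mul_nonneg (sub_nonneg.2 h1) hGw.le
      linarith
    rcases le_total t (-1) with h2 | h2
    · rw [hgle t h2]
      apply (hGfree _).1
      rw [hGsmul _ _ (by have := inv_pos.2 hGw'; linarith), add_mul, inv_mul_cancel₀ hGw'.ne']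
      have := mul_nonneg (show 0 ≤ -t - 1 by linarith) hGw'.le
      linarith
    · obtain ⟨x, hx, e⟩ := hgmid t h2 h1
      rw [e]
      exact (hGfree _).1 (hGinv x hx).ge
  · intro x
    obtain ⟨t, ht⟩ := b1 x
    rw [ht]
    rcases le_total 1 t with h1 | h1
    · exact Or.inl ⟨t₁ + ((G w)⁻¹ + (t - 1)), by rw [hgge t h1, hc]; module⟩
    rcases le_total t (-1) with h2 | h2
    · exact Or.inl ⟨t₁ - ((G (-w))⁻¹ + (-t - 1)), by rw [hgle t h2, hc]; module⟩
    · obtain ⟨x, hx, e⟩ := hgmid t h2 h1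
      rw [e]
      exact Or.inr (hGfr _ (hGinv x hx))

theorem exists_isBrokenLine {p w : ℂ} (hp : p ∈ K.free) (hw : ‖w‖ = 1) :
    ∃ β, K.IsBrokenLine p w β := by
  by_cases h : ∃ t : ℝ, p + t • w ∈ K.obstacle
  · exact isBrokenLine_around hp hw h.choose_spec
  · exact ⟨_, isBrokenLine_straight hw (not_exists.1 h)⟩

end ConvexPolygon
end ONPA

namespace ONPA

theorem eq_inner_smul_of_cross_eq_zero {w m : ℂ} (hw : ‖w‖ = 1) (h : cross w m = 0) :
    m = inner ℝ w m • w := by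
  have hN : w.re * w.re + w.im * w.im = 1 := by
    have := Complex.normSq_eq_norm_sq w
    rw [hw, Complex.normSq_apply] at this
    linarith
  rw [inner_eq]
  simp only [cross] at h
  apply Complex.ext
  · simp only [Complex.real_smul, Complex.re_ofReal_mul]
    linear_combination (-m.re) * hN - w.im * h
  · simp only [Complex.real_smul, Complex.im_ofReal_mul]
    linear_combination (-m.im) * hN + w.re * h

theorem exists_unit_perp (b : ℂ) : ∃ w : ℂ, ‖w‖ = 1 ∧ inner ℝ w b = 0 := by
  by_cases hb : b = 0
  · exact ⟨1, by simp, by simp [hb]⟩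
  · refine ⟨‖b‖⁻¹ • (Complex.I * b), ?_, ?_⟩
    · rw [norm_smul, norm_mul, Complex.norm_I, one_mul, norm_inv, norm_norm,
        inv_mul_cancel₀ (norm_ne_zero_iff.2 hb)]
    · rw [inner_smul_left, inner_eq]; simp; right; ring

/-! ### The path of an execution -/

namespace State

variable {X : State} {g : ℝ → ℂ} {τ : ℝ} {ph : Phase}

theorem move_path_of_le {t : ℝ} (h : t ≤ X.time) : (X.move g τ ph).path t = X.path t := if_pos h

theorem move_path_of_ge (hg : g 0 = X.pos) {t : ℝ} (h : X.time ≤ t) :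
    (X.move g τ ph).path t = g (t - X.time) := by
  rcases h.lt_or_eq with h | rfl
  · exact if_neg (not_le.2 h)
  · rw [move_path_of_le le_rfl, sub_self, hg, pos]

theorem move_pos (hg : g 0 = X.pos) (hτ : 0 ≤ τ) : (X.move g τ ph).pos = g τ := by
  rw [pos, move_path_of_ge hg (by simpa [move] using hτ)]
  simp [move]

theorem visited_move (hg : g 0 = X.pos) (h0 : 0 ≤ X.time) (hτ : 0 ≤ τ) :
    (X.move g τ ph).visited = X.visited ∪ g '' Icc 0 τ := by
  ext z
  constructor
  · rintro ⟨t, ht, rfl⟩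
    rcases le_total t X.time with h | h
    · exact Or.inl ⟨t, ⟨ht.1, h⟩, (move_path_of_le h).symm⟩
    · refine Or.inr ⟨t - X.time, ⟨by linarith, ?_⟩, (move_path_of_ge hg h).symm⟩
      have : t ≤ X.time + τ := ht.2
      linarith
  · rintro (⟨t, ht, rfl⟩ | ⟨t, ht, rfl⟩)
    · refine ⟨t, ⟨ht.1, ?_⟩, move_path_of_le ht.2⟩
      change t ≤ X.time + τ
      linarith [ht.2]
    · refine ⟨X.time + t, ⟨by linarith [ht.1], ?_⟩, ?_⟩
      · change X.time + t ≤ X.time + τ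
        linarith [ht.2]
      · rw [move_path_of_ge hg (by linarith [ht.1]), add_sub_cancel_left]

theorem visited_subset_move (hg : g 0 = X.pos) (h0 : 0 ≤ X.time) (hτ : 0 ≤ τ) :
    X.visited ⊆ (X.move g τ ph).visited := by
  rw [visited_move hg h0 hτ]; exact subset_union_left

theorem lipschitzOnWith_move (hX : LipschitzOnWith 1 X.path (Icc 0 X.time))
    (hg : g 0 = X.pos) (hgl : LipschitzOnWith 1 g (Ici 0)) :
    LipschitzOnWith 1 (X.move g τ ph).path (Ici 0) := by
  have key : ∀ a b : ℝ, 0 ≤ a → a ≤ b →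
      dist ((X.move g τ ph).path a) ((X.move g τ ph).path b) ≤ b - a := by
    intro a b ha hab
    have d1 : ∀ a b : ℝ, 0 ≤ a → a ≤ b → b ≤ X.time → dist (X.path a) (X.path b) ≤ b - a := by
      intro a b ha hab hb
      have := hX.dist_le_mul a ⟨ha, hab.trans hb⟩ b ⟨ha.trans hab, hb⟩
      rwa [NNReal.coe_one, one_mul, Real.dist_eq, abs_sub_comm,
        abs_of_nonneg (sub_nonneg.2 hab)] at this
    have d2 : ∀ a b : ℝ, 0 ≤ a → a ≤ b → dist (g a) (g b) ≤ b - a := by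
      intro a b ha hab
      have := hgl.dist_le_mul a ha b (ha.trans hab)
      rwa [NNReal.coe_one, one_mul, Real.dist_eq, abs_sub_comm,
        abs_of_nonneg (sub_nonneg.2 hab)] at this
    rcases le_total b X.time with h | h
    · rw [move_path_of_le h, move_path_of_le (hab.trans h)]
      exact d1 a b ha hab h
    rcases le_total a X.time with h' | h'
    · rw [move_path_of_le h', move_path_of_ge hg h]
      have e1 := d1 a X.time ha h' le_rfl
      have e2 := d2 0 (b - X.time) le_rfl (by linarith)
      rw [hg, pos] at e2
      have := dist_triangle (X.path a) (X.path X.time) (g (b - X.time))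
      linarith
    · rw [move_path_of_ge hg h', move_path_of_ge hg h]
      have := d2 (a - X.time) (b - X.time) (by linarith) (by linarith)
      linarith
  refine LipschitzOnWith.of_dist_le_mul fun a ha b hb => ?_
  rw [NNReal.coe_one, one_mul, Real.dist_eq]
  rcases le_total a b with h | h
  · rw [abs_sub_comm, abs_of_nonneg (sub_nonneg.2 h)]; exact key a b ha h
  · rw [dist_comm, abs_of_nonneg (sub_nonneg.2 h)]; exact key b a hb h

theorem walk_zero (p q : ℂ) : p + ((0 : ℝ) / ‖q - p‖) • (q - p) = p := by simp

theorem walk_end (p q : ℂ) : p + (‖q - p‖ / ‖q - p‖) • (q - p) = q := by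
  by_cases h : q - p = 0
  · rw [h]; simp; exact (sub_eq_zero.1 h).symm
  · rw [div_self (norm_ne_zero_iff.2 h)]; simp

theorem lipschitzOnWith_walk (p q : ℂ) :
    LipschitzOnWith 1 (fun t : ℝ => p + (t / ‖q - p‖) • (q - p)) (Ici 0) := by
  refine LipschitzOnWith.of_dist_le_mul fun a _ b _ => ?_
  rw [NNReal.coe_one, one_mul, dist_add_left, dist_eq_norm, ← sub_smul, norm_smul, Real.dist_eq,
    ← sub_div, norm_div, norm_norm, Real.norm_eq_abs]
  rcases eq_or_ne ‖q - p‖ 0 with h | h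
  · rw [h, mul_zero]; exact abs_nonneg _
  · exact (div_mul_cancel₀ _ h).le

theorem walk_subset_segment (p q : ℂ) :
    (fun t : ℝ => p + (t / ‖q - p‖) • (q - p)) '' Icc 0 ‖q - p‖ ⊆ segment ℝ p q := by
  rintro _ ⟨t, ht, rfl⟩
  rw [segment_eq_image']
  exact ⟨t / ‖q - p‖, ⟨div_nonneg ht.1 (norm_nonneg _), div_le_one_of_le₀ ht.2 (norm_nonneg _)⟩,
    rfl⟩

theorem walkTo_pos (q : ℂ) : (X.walkTo q ph).pos = q := by
  rw [walkTo, move_pos (walk_zero _ _) (norm_nonneg _), walk_end]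

/-- The standing facts about the path of an execution from `s`: it starts in `s`, is walked with
speed at most `1`, and avoids the obstacle. -/
structure IsFeasible (K : ConvexPolygon) (s : ℂ) (X : State) : Prop where
  time_nonneg : 0 ≤ X.time
  path_zero : X.path 0 = s
  lipschitz : LipschitzOnWith 1 X.path (Icc 0 X.time)
  subset_free : X.visited ⊆ K.free

namespace IsFeasible

variable {K : ConvexPolygon} {s : ℂ}

theorem isCompact_visited (h : X.IsFeasible K s) : IsCompact X.visited :=
  isCompact_Icc.image_of_continuousOn h.lipschitz.continuousOn

theorem isPreconnected_visited (h : X.IsFeasible K s) : IsPreconnected X.visited :=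
  isPreconnected_Icc.image _ h.lipschitz.continuousOn

theorem pos_mem (h : X.IsFeasible K s) : X.pos ∈ X.visited :=
  mem_image_of_mem _ ⟨h.time_nonneg, le_rfl⟩

theorem visited_eq_of_time (h : X.IsFeasible K s) (h0 : X.time = 0) : X.visited = {s} := by
  rw [visited, h0, Icc_self, image_singleton, h.path_zero]

theorem move (h : X.IsFeasible K s) (hg : g 0 = X.pos) (hgl : LipschitzOnWith 1 g (Ici 0))
    (hτ : 0 ≤ τ) (hF : g '' Icc 0 τ ⊆ K.free) : (X.move g τ ph).IsFeasible K s where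
  time_nonneg := add_nonneg h.time_nonneg hτ
  path_zero := (move_path_of_le h.time_nonneg).trans h.path_zero
  lipschitz := (lipschitzOnWith_move h.lipschitz hg hgl).mono Icc_subset_Ici_self
  subset_free := by
    rw [visited_move hg h.time_nonneg hτ]; exact union_subset h.subset_free hF

theorem walkTo (h : X.IsFeasible K s) {q : ℂ} (hq : segment ℝ X.pos q ⊆ K.free) :
    (X.walkTo q ph).IsFeasible K s :=
  h.move (walk_zero _ _) (lipschitzOnWith_walk _ _) (norm_nonneg _)
    ((walk_subset_segment _ _).trans hq)

end IsFeasible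

end State

/-! ### Both spiral searches as motions that go far in both directions. -/

namespace ConvexPolygon

variable {K : ConvexPolygon} {X : State} {s : ℂ} {g : ℝ → ℂ} {θ τ : ℝ}

/-- The motion `g` from the state `X` is a search with unit speed in the free space that goes
arbitrarily far, in both directions, on the line `X.pos + ℝ w`. -/
structure IsSearch (K : ConvexPolygon) (X : State) (w : ℂ) (g : ℝ → ℂ) : Prop where
  zero : g 0 = X.pos
  lipschitz : LipschitzOnWith 1 g (Ici 0)
  mem_free : ∀ t, g t ∈ K.free
  far : ∀ T : ℝ, ∃ t, 0 ≤ t ∧ ∃ r, T ≤ r ∧ g t = X.pos + r • w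
  far' : ∀ T : ℝ, ∃ t, 0 ≤ t ∧ ∃ r, T ≤ r ∧ g t = X.pos + (-r) • w

theorem isSearch_parallel {w : ℂ} {Q : ℝ} (hw : ‖w‖ = 1) (hQ : 0 < Q)
    (hfree : ∀ t : ℝ, X.pos + t • w ∈ K.free) :
    K.IsSearch X w fun t => X.pos + zigzag Q t • w where
  zero := by simp
  lipschitz := by
    refine LipschitzOnWith.of_dist_le_mul fun a ha b hb => ?_
    rw [dist_add_left, dist_eq_norm, ← sub_smul, norm_smul, hw, mul_one, ← dist_eq_norm]
    exact (lipschitzOnWith_zigzag hQ).dist_le_mul a ha b hb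
  mem_free := fun t => hfree _
  far := fun T => by
    obtain ⟨t, ht, hz⟩ := exists_zigzag_eq hQ T
    exact ⟨t, ht, T, le_rfl, by rw [hz]⟩
  far' := fun T => by
    obtain ⟨t, ht, hz⟩ := exists_zigzag_eq hQ (-T)
    exact ⟨t, ht, T, le_rfl, by rw [hz]⟩

theorem lipschitzWith_of_hasUnitSpeedOn {β : ℝ → ℂ} (h : HasUnitSpeedOn β univ) :
    LipschitzWith 1 β := by
  have key : ∀ x y : ℝ, x ≤ y → dist (β x) (β y) ≤ y - x := by
    intro x y hxy
    have h1 := h (mem_univ x) (mem_univ y)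
    rw [univ_inter, NNReal.coe_one, one_mul] at h1
    have h2 := eVariationOn.edist_le β (left_mem_Icc.2 hxy) (right_mem_Icc.2 hxy)
    rw [h1, edist_dist, ENNReal.ofReal_le_ofReal_iff (sub_nonneg.2 hxy)] at h2
    exact h2
  refine LipschitzWith.of_dist_le_mul fun a b => ?_
  rw [NNReal.coe_one, one_mul, Real.dist_eq]
  rcases le_total a b with h | h
  · rw [abs_sub_comm, abs_of_nonneg (sub_nonneg.2 h)]; exact key a b h
  · rw [dist_comm, abs_of_nonneg (sub_nonneg.2 h)]; exact key b a h

/-- Where the coordinate along `w` exceeds a bound for the closure of `O`, the curve is not on the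
boundary of `O`, hence on the line itself. -/
theorem IsBrokenLine.exists_far {p w : ℂ} {β : ℝ → ℂ} (hw : ‖w‖ = 1) (hβ : K.IsBrokenLine p w β)
    (T : ℝ) : (∃ x r, T ≤ r ∧ β x = p + r • w) ∧ ∃ x r, T ≤ r ∧ β x = p + (-r) • w := by
  obtain ⟨M, hM⟩ := K.isBounded_obstacle.closure.exists_norm_le
  have hfr : ∀ x, M < |inner ℝ w (β x)| → ∃ r : ℝ, β x = p + r • w := by
    intro x hx
    refine (hβ.mem_line_or_frontier x).resolve_right fun h => ?_
    have h1 := hM _ (frontier_subset_closure h)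
    have h2 := abs_real_inner_le_norm w (β x)
    rw [hw, one_mul] at h2
    linarith
  have hin : ∀ r : ℝ, inner ℝ w (p + r • w) = inner ℝ w p + r := fun r => by
    rw [inner_add_right, inner_smul_right, inner_self_of_norm_one hw, mul_one]
  constructor
  · obtain ⟨x, h1, h2⟩ := ((hβ.atTop.eventually_gt_atTop M).and
      (hβ.atTop.eventually_ge_atTop (inner ℝ w p + T))).exists
    obtain ⟨r, hr⟩ := hfr x (h1.trans_le (le_abs_self _))
    rw [hr, hin] at h2
    exact ⟨x, r, by linarith, hr⟩
  · obtain ⟨x, h1, h2⟩ := ((hβ.atBot.eventually_lt_atBot (-M)).and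
      (hβ.atBot.eventually_le_atBot (inner ℝ w p - T))).exists
    obtain ⟨r, hr⟩ := hfr x (by linarith [neg_le_abs (inner ℝ w (β x))])
    rw [hr, hin] at h2
    exact ⟨x, -r, by linarith, by rw [neg_neg, hr]⟩

theorem isSearch_bisection {w : ℂ} {β : ℝ → ℂ} {Q : ℝ} (hw : ‖w‖ = 1) (hQ : 0 < Q)
    (hβ : K.IsBrokenLine X.pos w β) : K.IsSearch X w fun t => β (zigzag Q t) where
  zero := by rw [zigzag_zero, hβ.start]
  lipschitz := by
    have := ((lipschitzWith_of_hasUnitSpeedOn hβ.unitSpeed).comp_lipschitzOnWith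
      (lipschitzOnWith_zigzag hQ))
    rwa [one_mul] at this
  mem_free := fun t => hβ.mem_free _
  far := fun T => by
    obtain ⟨x, r, hr, hx⟩ := (hβ.exists_far hw T).1
    obtain ⟨t, ht, hz⟩ := exists_zigzag_eq hQ x
    exact ⟨t, ht, r, hr, by rw [hz, hx]⟩
  far' := fun T => by
    obtain ⟨x, r, hr, hx⟩ := (hβ.exists_far hw T).2
    obtain ⟨t, ht, hz⟩ := exists_zigzag_eq hQ x
    exact ⟨t, ht, r, hr, by rw [hz, hx]⟩

namespace IsSearch

variable {w : ℂ}

theorem feasible (h : K.IsSearch X w g) (hX : X.IsFeasible K s) (hτ : 0 ≤ τ) {ph : Phase} :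
    (X.move g τ ph).IsFeasible K s :=
  hX.move h.zero h.lipschitz hτ (by rintro _ ⟨t, _, rfl⟩; exact h.mem_free t)

/-- Every search stops. -/
theorem exists_firstTime (h : K.IsSearch X w g) (hw : ‖w‖ = 1) (hX : X.IsFeasible K s)
    (hθ : -(Real.pi / 2) ≤ θ) (hθ' : θ ≤ Real.pi / 2) :
    ∃ τ, FirstTime (K.StopAt θ) X g τ := by
  have hc := (State.lipschitzOnWith_move (τ := 0) (ph := X.phase) hX.lipschitz h.zero
    h.lipschitz).continuousOn
  refine exists_isLeast_stopAt hc hθ' ?_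
  obtain ⟨T, hT, hfar⟩ := K.exists_isFar X.pos w
  obtain ⟨t, ht, r, hr, e⟩ := h.far T
  obtain ⟨t', ht', r', hr', e'⟩ := h.far' T
  have h0 : 0 ≤ max t t' := ht.trans (le_max_left _ _)
  have hM := h.feasible hX h0 (ph := X.phase)
  have hv := State.visited_move (ph := X.phase) h.zero hX.time_nonneg h0
  refine ⟨max t t', h0, ?_⟩
  refine StopAt.mono hθ (stopAt_of_far hM.isCompact_visited hM.isPreconnected_visited
    hM.subset_free hw hT hfar hr hr' ?_ ?_)
  · exact hv.ge (Or.inr ⟨t, ⟨ht, le_max_left _ _⟩, e⟩)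
  · exact hv.ge (Or.inr ⟨t', ⟨ht', le_max_right _ _⟩, e'⟩)

/-- A search stopping at time zero would have met the condition before it started. Positivity of the
time separates the two visits of the opening phase in `stepBound` and gives
`not_inEdgeInterior_of_isLeast` an earlier moment to fall back on. -/
theorem pos_of_firstTime (h : K.IsSearch X w g) (hX : X.IsFeasible K s)
    (hno : ¬ K.StopAt θ X.visited) (hτ : FirstTime (K.StopAt θ) X g τ) : 0 < τ := by
  refine hτ.1.1.lt_of_ne fun h0 => hno ?_
  have := hτ.1.2
  rw [← h0, State.visited_move h.zero hX.time_nonneg le_rfl, Icc_self, image_singleton, h.zero,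
    union_eq_self_of_subset_right (singleton_subset_iff.2 hX.pos_mem)] at this
  exact this

theorem not_inEdgeInterior (h : K.IsSearch X w g) (hX : X.IsFeasible K s)
    (hno : ¬ K.StopAt θ X.visited) (hτ : FirstTime (K.StopAt θ) X g τ) {ph : Phase} :
    K.Finished (X.move g τ ph).visited ∨ ¬ K.InEdgeInterior (X.move g τ ph).pos := by
  by_cases hfin : K.Finished (X.move g τ ph).visited
  · exact Or.inl hfin
  refine Or.inr (not_inEdgeInterior_of_isLeast (f := (X.move g τ ph).path) (T := X.time) (θ := θ)
    ?_ hX.time_nonneg hτ (h.pos_of_firstTime hX hno hτ) ?_ hfin)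
  · exact (State.lipschitzOnWith_move hX.lipschitz h.zero h.lipschitz).continuousOn
  · exact mapsTo_iff_image_subset.2 (h.feasible hX hτ.1.1 (ph := ph)).subset_free

end IsSearch

theorem segment_subset_free {p q : ℂ} (h : K.Visible p q) : segment ℝ p q ⊆ K.free :=
  fun _ hz hO => (eq_empty_iff_forall_notMem.1 h) _ ⟨hz, hO⟩

/-! ### Invariants of an execution -/

/-- What is known about a state in the course of an execution, according to its phase. -/
def PhaseInvariant (K : ConvexPolygon) (s : ℂ) (X : State) : Prop :=
  match X.phase with
  | Phase.opening => X.pos = s ∧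
      -- The opening phase occurs at the start or after a parallel search that has brought the scope
      -- down to `π / 2`; this disjunction prevents a second parallel search.
      ∃ σ, K.IsScope X.visited σ ∧ 0 ≤ σ.angle ∧ (X.time = 0 ∨ σ.angle ≤ Real.pi / 2)
  | Phase.parallel w Q => X.time = 0 ∧ ‖w‖ = 1 ∧ 0 < Q ∧ (∀ t : ℝ, X.pos + t • w ∈ K.free) ∧
      ¬ K.StopAt (Real.pi / 2) X.visited
  | Phase.bisection β Q => (∃ w, ‖w‖ = 1 ∧ K.IsBrokenLine X.pos w β) ∧ 0 < Q ∧
      ¬ K.StopAt (-(Real.pi / 8)) X.visited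
  | Phase.closing => K.Finished X.visited ∨ ¬ K.InEdgeInterior X.pos

/-- The invariant of an execution from `s`. -/
def Invariant (K : ConvexPolygon) (s : ℂ) (X : State) : Prop :=
  X.IsFeasible K s ∧ K.PhaseInvariant s X

theorem invariant_init (hs : s ∈ K.free) : K.Invariant s (State.init s) := by
  have hv : (State.init s).visited = {s} := by simp [State.visited, State.init]
  refine ⟨⟨le_rfl, rfl, (LipschitzWith.const s).lipschitzOnWith.weaken zero_le_one, ?_⟩, ?_⟩
  · rw [hv]; exact singleton_subset_iff.2 hs
  · have hfin : ¬ K.Finished {s} := by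
      intro h
      obtain ⟨i, hi⟩ := K.exists_side_pos s
      obtain ⟨x, rfl, hx⟩ := K.edgeSeen_iff.1 (h i)
      linarith
    obtain ⟨σ, hσ⟩ := K.exists_isScope isCompact_singleton (singleton_nonempty s)
      (singleton_subset_iff.2 hs) hfin
    exact ⟨rfl, σ, hv.symm ▸ hσ, hσ.angle_nonneg_of_singleton, Or.inl rfl⟩

/-- The way back of the parallel search leads along its line. -/
theorem visited_parallelReturn {w : ℂ} {Q : ℝ} (hQ : 0 < Q) (hX : X.IsFeasible K s)
    (hpos : X.pos = s) (hτ : 0 ≤ τ) {ph ph' : Phase} :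
    ((X.move (fun t => X.pos + zigzag Q t • w) τ ph).walkTo s ph').visited =
      (X.move (fun t => X.pos + zigzag Q t • w) τ ph).visited := by
  have hg : (fun t => X.pos + zigzag Q t • w) 0 = X.pos := by simp
  set M := X.move (fun t => X.pos + zigzag Q t • w) τ ph with hM
  have hMt : 0 ≤ M.time := add_nonneg hX.time_nonneg hτ
  rw [State.walkTo, State.visited_move (State.walk_zero _ _) hMt (norm_nonneg _),
    union_eq_self_of_subset_right]
  refine (State.walk_subset_segment _ _).trans ?_
  rw [hM, State.move_pos hg hτ, ← hM, hM, State.visited_move hg hX.time_nonneg hτ, hpos]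
  intro z hz
  right
  rw [segment_symm, segment_eq_image'] at hz
  obtain ⟨l, hl, rfl⟩ := hz
  have hpre : IsPreconnected (zigzag Q '' Icc 0 τ) := isPreconnected_Icc.image _
    ((lipschitzOnWith_zigzag hQ).continuousOn.mono Icc_subset_Ici_self)
  -- By continuity the search has passed every position between its start and its end, so the return
  -- visits nothing new and leaves the scope unchanged.
  have hmem : l * zigzag Q τ ∈ zigzag Q '' Icc 0 τ := by
    refine hpre.ordConnected.uIcc_subset (x := 0) (y := zigzag Q τ)
      ⟨0, ⟨le_rfl, hτ⟩, zigzag_zero Q⟩ ⟨τ, ⟨hτ, le_rfl⟩, rfl⟩ ?_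
    rw [mem_uIcc]
    rcases le_total 0 (zigzag Q τ) with h | h
    · exact Or.inl ⟨mul_nonneg hl.1 h, mul_le_of_le_one_left h hl.2⟩
    · exact Or.inr ⟨by nlinarith [hl.2], mul_nonpos_of_nonneg_of_nonpos hl.1 h⟩
  obtain ⟨t, ht, e⟩ := hmem
  refine ⟨t, ht, ?_⟩
  simp only [e]
  module

theorem time_eq_zero_of_opening (hX : X.IsFeasible K s) (hphase : X.phase = Phase.opening)
    (hinv : K.PhaseInvariant s X) {σ : K.Scope} (hσ : K.IsScope X.visited σ)
    (hangle : Real.pi / 2 < σ.angle) : X.time = 0 := by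
  rw [PhaseInvariant, hphase] at hinv
  obtain ⟨-, σ', hσ', -, h | h⟩ := hinv
  · exact h
  · rw [hσ'.angle_eq hX.isPreconnected_visited hX.subset_free hσ] at h
    linarith

theorem Invariant.step {Y : State} (h : K.Invariant s X) (hstep : K.Step X Y) :
    K.Invariant s Y := by
  obtain ⟨hX, hinv⟩ := h
  cases hstep with
  | chooseParallel σ w hphase hσ hangle hw hpar hdir =>
    -- Only `s` has been visited, so both lines of sight start there; this is what
    -- `parallel_line_free` needs.
    have ht := time_eq_zero_of_opening hX hphase hinv hσ hangle
    have hv := hX.visited_eq_of_time ht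
    have hpos : X.pos = s := by rw [State.pos, ht, hX.path_zero]
    refine ⟨⟨hX.time_nonneg, hX.path_zero, hX.lipschitz, hX.subset_free⟩, ht, hw, ?_, ?_,
      not_stopAt_of_lt hX.isPreconnected_visited hX.subset_free hσ hangle⟩
    · rw [abs_pos]
      intro h0
      have := eq_inner_smul_of_cross_eq_zero hw hpar
      rw [h0, zero_smul] at this
      exact hσ.vL_sub_vR_ne_zero this
    · intro t
      change X.pos + t • w ∈ K.free
      have e := eq_inner_smul_of_cross_eq_zero hw hpar
      have hne : inner ℝ w (σ.vL - σ.vR) ≠ 0 := by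
        intro h0
        rw [h0, zero_smul] at e
        exact hσ.vL_sub_vR_ne_zero e
      have := (hv ▸ hσ).parallel_line_free (t / inner ℝ w (σ.vL - σ.vR))
      rw [e, smul_smul, ← e, div_mul_cancel₀ _ hne] at this
      rwa [hpos]
  | parallelReturn w Q τ σ hphase hτ hσ hangle =>
    rw [PhaseInvariant, hphase] at hinv
    obtain ⟨ht, hw, hQ, hfree, hno⟩ := hinv
    have hpos : X.pos = s := by rw [State.pos, ht, hX.path_zero]
    have hS := isSearch_parallel (X := X) hw hQ hfree
    have hτ' : FirstTime (K.StopAt (Real.pi / 2)) X (fun t => X.pos + zigzag Q t • w) τ := hτ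
    have hM := hS.feasible hX hτ'.1.1 (ph := Phase.opening)
    have hvis := visited_parallelReturn (w := w) hQ hX hpos hτ'.1.1 (ph := Phase.opening)
      (ph' := Phase.opening)
    rw [hX.path_zero]
    refine ⟨⟨add_nonneg hM.time_nonneg (norm_nonneg _), ?_, ?_, ?_⟩, State.walkTo_pos _, σ, ?_,
      hangle, Or.inr ?_⟩
    · exact (State.move_path_of_le hM.time_nonneg).trans hM.path_zero
    · exact (State.lipschitzOnWith_move hM.lipschitz (State.walk_zero _ _)
        (State.lipschitzOnWith_walk _ _)).mono Icc_subset_Ici_self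
    · rw [hvis]; exact hM.subset_free
    · rw [hvis]; exact hσ
    · obtain hf | ⟨σ', hσ', h'⟩ := hτ'.1.2
      · exact absurd hf hσ.not_finished
      · rwa [hσ.angle_eq hM.isPreconnected_visited hM.subset_free hσ']
  | parallelClose w Q τ hphase hτ hclose =>
    rw [PhaseInvariant, hphase] at hinv
    obtain ⟨ht, hw, hQ, hfree, hno⟩ := hinv
    have hS := isSearch_parallel (X := X) hw hQ hfree
    have hτ' : FirstTime (K.StopAt (Real.pi / 2)) X (fun t => X.pos + zigzag Q t • w) τ := hτ
    exact ⟨hS.feasible hX hτ'.1.1, hS.not_inEdgeInterior hX hno hτ'⟩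
  | chooseBisection σ w β hphase hσ hangle₀ hangle hw hperp hdir hβ =>
    refine ⟨⟨hX.time_nonneg, hX.path_zero, hX.lipschitz, hX.subset_free⟩, ⟨w, hw, hβ⟩,
      hσ.bisection_length_pos hangle hw hperp,
      not_stopAt_of_lt hX.isPreconnected_visited hX.subset_free hσ ?_⟩
    linarith [Real.pi_pos]
  | bisectionClose β Q τ hphase hτ =>
    rw [PhaseInvariant, hphase] at hinv
    obtain ⟨⟨w, hw, hβ⟩, hQ, hno⟩ := hinv
    have hS := isSearch_bisection hw hQ hβ
    have hτ' : FirstTime (K.StopAt (-(Real.pi / 8))) X (fun t => β (zigzag Q t)) τ := hτ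
    exact ⟨hS.feasible hX hτ'.1.1, hS.not_inEdgeInterior hX hno hτ'⟩
  | approach σ q hphase hfin hσ hq =>
    refine ⟨hX.walkTo (segment_subset_free hq.mem_outerRay.2), Or.inr ?_⟩
    rw [State.walkTo_pos]
    exact hq.not_inEdgeInterior

/-! ### Termination -/

open Classical in
/-- A quantity that decreases with each step of an execution. -/
noncomputable def stepBound (K : ConvexPolygon) (X : State) : ℕ :=
  match X.phase with
  -- The order is: initial opening, parallel search, opening after the return, bisection search,
  -- closing. The last phase counts the unseen edges, at most `n`, so the others are placed above
  -- `n`.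
  | Phase.opening => if X.time = 0 then K.n + 4 else K.n + 2
  | Phase.parallel _ _ => K.n + 3
  | Phase.bisection _ _ => K.n + 1
  | Phase.closing => (Finset.univ.filter fun i => ¬ K.EdgeSeen X.visited i).card

theorem stepBound_closing (h : X.phase = Phase.closing) : K.stepBound X ≤ K.n := by
  rw [stepBound, h]
  exact (Finset.card_le_univ _).trans_eq (ZMod.card K.n)

theorem stepBound_lt {Y : State} (h : K.Invariant s X) (hstep : K.Step X Y) :
    K.stepBound Y < K.stepBound X := by
  obtain ⟨hX, hinv⟩ := h
  cases hstep with
  | chooseParallel σ w hphase hσ hangle hw hpar hdir =>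
    have ht := time_eq_zero_of_opening hX hphase hinv hσ hangle
    simp only [stepBound, hphase, ht, if_true]
    omega
  | parallelReturn w Q τ σ hphase hτ hσ hangle =>
    rw [PhaseInvariant, hphase] at hinv
    obtain ⟨ht, hw, hQ, hfree, hno⟩ := hinv
    have hS := isSearch_parallel (X := X) hw hQ hfree
    have hτ' : FirstTime (K.StopAt (Real.pi / 2)) X (fun t => X.pos + zigzag Q t • w) τ := hτ
    have hpos := hS.pos_of_firstTime hX hno hτ'
    have htime : 0 < ((X.move (fun t => X.pos + zigzag Q t • w) τ Phase.opening).walkTo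
        (X.path 0) Phase.opening).time :=
      add_pos_of_pos_of_nonneg (add_pos_of_nonneg_of_pos hX.time_nonneg hpos) (norm_nonneg _)
    have hph : ((X.move (fun t => X.pos + zigzag Q t • w) τ Phase.opening).walkTo
        (X.path 0) Phase.opening).phase = Phase.opening := rfl
    simp only [stepBound, hphase, hph, if_neg htime.ne']
    omega
  | parallelClose w Q τ hphase hτ hclose =>
    refine (stepBound_closing rfl).trans_lt ?_
    simp only [stepBound, hphase]
    omega
  | chooseBisection σ w β hphase hσ hangle₀ hangle hw hperp hdir hβ =>
    simp only [stepBound, hphase]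
    split_ifs <;> omega
  | bisectionClose β Q τ hphase hτ =>
    refine (stepBound_closing rfl).trans_lt ?_
    simp only [stepBound, hphase]
    omega
  | approach σ q hphase hfin hσ hq =>
    have hph : (X.walkTo q Phase.closing).phase = Phase.closing := rfl
    simp only [stepBound, hphase, hph]
    have hsub : X.visited ⊆ (X.walkTo q Phase.closing).visited :=
      State.visited_subset_move (State.walk_zero _ _) hX.time_nonneg (norm_nonneg _)
    have hmem : q ∈ (X.walkTo q Phase.closing).visited := by
      have := (hX.walkTo (ph := Phase.closing)
        (segment_subset_free hq.mem_outerRay.2)).pos_mem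
      rwa [State.walkTo_pos] at this
    obtain ⟨i, hi, hiq⟩ := hq.exists_new_edge hσ
    apply Finset.card_lt_card
    rw [Finset.ssubset_iff_of_subset]
    · refine ⟨i, by simpa using hi, ?_⟩
      simp only [Finset.mem_filter, Finset.mem_univ, true_and, not_not]
      exact K.edgeSeen_iff.2 ⟨q, hmem, hiq⟩
    · intro j hj
      simp only [Finset.mem_filter, Finset.mem_univ, true_and] at hj ⊢
      exact fun h => hj (h.mono hsub)

/-! ### An execution does not get stuck -/

theorem towardsCloser_or_neg (σ : K.Scope) (p w : ℂ) :
    K.TowardsCloser σ p w ∨ K.TowardsCloser σ p (-w) := by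
  simp only [TowardsCloser, inner_neg_left, abs_neg, Left.nonneg_neg_iff]
  rcases le_total |inner ℝ w (σ.vR - p)| |inner ℝ w (σ.vL - p)| with h | h
  · rcases le_total 0 (inner ℝ w (σ.vR - p)) with h' | h'
    · exact Or.inl (Or.inl ⟨h', h⟩)
    · exact Or.inr (Or.inl ⟨h', h⟩)
  · rcases le_total 0 (inner ℝ w (σ.vL - p)) with h' | h'
    · exact Or.inl (Or.inr ⟨h', h⟩)
    · exact Or.inr (Or.inr ⟨h', h⟩)

/-- Outside the closing phase there is always a successor: a suitable direction exists up to sign, a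
broken line exists, and every search has a first stopping time. In the closing phase the invariant
keeps an unfinished position out of the edge interiors, so a goal exists. -/
theorem finished_of_halted (h : K.Invariant s X) (hh : K.Halted X) : K.Finished X.visited := by
  obtain ⟨hX, hinv⟩ := h
  have hpi := Real.pi_pos
  rcases hphase : X.phase with _ | ⟨w, Q⟩ | ⟨β, Q⟩ | _ <;> rw [PhaseInvariant, hphase] at hinv
  · obtain ⟨-, σ, hσ, h0, -⟩ := hinv
    exfalso
    rcases lt_or_ge (Real.pi / 2) σ.angle with ha | ha
    · set m := σ.vL - σ.vR with hm
      have hmn : ‖m‖ ≠ 0 := norm_ne_zero_iff.2 hσ.vL_sub_vR_ne_zero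
      have hw : ‖‖m‖⁻¹ • m‖ = 1 := by
        rw [norm_smul, norm_inv, norm_norm, inv_mul_cancel₀ hmn]
      have hpar : cross (‖m‖⁻¹ • m) m = 0 := by simp [cross]; ring
      rcases towardsCloser_or_neg σ X.pos (‖m‖⁻¹ • m) with hd | hd
      · exact hh _ (Step.chooseParallel X σ _ hphase hσ ha hw hpar hd)
      · refine hh _ (Step.chooseParallel X σ _ hphase hσ ha (by rwa [norm_neg]) ?_ hd)
        have : cross (-(‖m‖⁻¹ • m)) m = -cross (‖m‖⁻¹ • m) m := by simp [cross]; ring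
        rw [this, hpar, neg_zero]
    · obtain ⟨w, hw, hperp⟩ := exists_unit_perp (‖σ.uR‖⁻¹ • σ.uR + ‖σ.uL‖⁻¹ • σ.uL)
      have hp := hX.subset_free hX.pos_mem
      rcases towardsCloser_or_neg σ X.pos w with hd | hd
      · obtain ⟨β, hβ⟩ := exists_isBrokenLine hp hw
        exact hh _ (Step.chooseBisection X σ w β hphase hσ h0 ha hw hperp hd hβ)
      · have hw' : ‖-w‖ = 1 := by rwa [norm_neg]
        obtain ⟨β, hβ⟩ := exists_isBrokenLine hp hw'
        exact hh _ (Step.chooseBisection X σ (-w) β hphase hσ h0 ha hw'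
          (by rw [inner_neg_left, hperp, neg_zero]) hd hβ)
  · obtain ⟨-, hw, hQ, hfree, -⟩ := hinv
    exfalso
    have hS := isSearch_parallel (X := X) hw hQ hfree
    obtain ⟨τ, hτ⟩ := hS.exists_firstTime hw hX (θ := Real.pi / 2) (by linarith) le_rfl
    obtain hf | ⟨σ, hσ, -⟩ := hτ.1.2
    · exact hh _ (Step.parallelClose X w Q τ hphase hτ (Or.inl hf))
    · rcases le_or_gt 0 σ.angle with h0 | h0
      · exact hh _ (Step.parallelReturn X w Q τ σ hphase hτ hσ h0)
      · exact hh _ (Step.parallelClose X w Q τ hphase hτ (Or.inr ⟨σ, hσ, h0⟩))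
  · obtain ⟨⟨w, hw, hβ⟩, hQ, -⟩ := hinv
    exfalso
    have hS := isSearch_bisection hw hQ hβ
    obtain ⟨τ, hτ⟩ := hS.exists_firstTime hw hX (θ := -(Real.pi / 8)) (by linarith) (by linarith)
    exact hh _ (Step.bisectionClose X β Q τ hphase hτ)
  · by_contra hfin
    obtain ⟨σ, hσ⟩ := K.exists_isScope hX.isCompact_visited ⟨_, hX.pos_mem⟩ hX.subset_free hfin
    obtain ⟨q, hq⟩ := exists_isClosingTarget hσ (hX.subset_free hX.pos_mem)
      (hinv.resolve_left hfin)
    exact hh _ (Step.approach X σ q hphase hfin hσ hq)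

theorem image_route (h : X.IsFeasible K s) : X.route '' Icc 0 1 = X.visited := by
  have : (fun u => u * X.time) '' Icc 0 1 = Icc 0 X.time := by
    rw [image_mul_right_Icc zero_le_one h.time_nonneg, zero_mul, one_mul]
  rw [State.visited, ← this, image_image]
  rfl

theorem lipschitzOnWith_route (h : X.IsFeasible K s) :
    LipschitzOnWith X.time.toNNReal X.route (Icc 0 1) := by
  have h1 : LipschitzOnWith X.time.toNNReal (fun u : ℝ => u * X.time) (Icc 0 1) :=
    LipschitzOnWith.of_dist_le_mul fun a _ b _ => by
      rw [Real.coe_toNNReal _ h.time_nonneg, Real.dist_eq, Real.dist_eq, ← sub_mul, abs_mul,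
        abs_of_nonneg h.time_nonneg, mul_comm]
  have := h.lipschitz.comp h1 fun u hu =>
    ⟨mul_nonneg hu.1 h.time_nonneg, mul_le_of_le_one_left h.time_nonneg hu.2⟩
  rwa [one_mul] at this

end ConvexPolygon
end ONPA

theorem mainTheorem2 (K : ONPA.ConvexPolygon) (s : ℂ) (hs : s ∈ K.free) :
    -- every execution from `s` stops after finitely many moves
    (¬ ∃ X : ℕ → ONPA.State, X 0 = ONPA.State.init s ∧ ∀ k, K.Step (X k) (X (k + 1))) ∧
    -- and then its path has finite length and is a watchman route that starts in `s`
    (∀ X : ONPA.State, K.Reaches s X → K.Halted X →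
      X.route 0 = s ∧
      eVariationOn X.route (Set.Icc 0 1) < ⊤ ∧
      K.IsWatchmanRoute X.route) := by
  constructor
  · rintro ⟨X, h0, hstep⟩
    have hinv : ∀ k, K.Invariant s (X k) := by
      intro k
      induction k with
      | zero => rw [h0]; exact ONPA.ConvexPolygon.invariant_init hs
      | succ k ih => exact ih.step (hstep k)
    have hdec : ∀ k, K.stepBound (X k) + k ≤ K.stepBound (X 0) := by
      intro k
      induction k with
      | zero => simp
      | succ k ih =>
        have := ONPA.ConvexPolygon.stepBound_lt (hinv k) (hstep k)
        omega
    have := hdec (K.stepBound (X 0) + 1)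
    omega
  · intro X hreach hhalt
    have hinv : K.Invariant s X := by
      clear hhalt
      induction hreach with
      | refl => exact ONPA.ConvexPolygon.invariant_init hs
      | tail _ hstep ih => exact ih.step hstep
    have hfin := ONPA.ConvexPolygon.finished_of_halted hinv hhalt
    have hl := ONPA.ConvexPolygon.lipschitzOnWith_route hinv.1
    have himg := ONPA.ConvexPolygon.image_route hinv.1
    refine ⟨?_, ?_, ⟨hl.continuousOn, ?_⟩, ?_⟩
    · rw [ONPA.State.route, zero_mul, hinv.1.path_zero]
    · have := hl.locallyBoundedVariationOn 0 1 (left_mem_Icc.2 zero_le_one)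
        (right_mem_Icc.2 zero_le_one)
      rw [inter_self] at this
      exact this.lt_top
    · rw [mapsTo_iff_image_subset, himg]; exact hinv.1.subset_free
    · rw [himg]; exact K.visibleSet_of_finished hfin
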